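/- Let $\mathbb F=\mathbb Z/2$ and let $m\ge 3$. Let $G_m$ be the group of rigid motions of $\mathbb Z$ generated by $x\mapsto 1-x$ and $x\mapsto 2m-1-x$; the orbit set $\mathbb Z/G_m$ has $m-1$ elements. For $0\le k<m$, a lifted partial permutation on $k$ letters is a $G_m$-invariant set $\widetilde S\subseteq\mathbb Z$ consisting of $k$ orbits together with a $G_m$-equivariant map $\widetilde f\colon\widetilde S\to\mathbb Z$ that is injective on orbits. For $j=1,\dots,m$ its weight is $w_j(\widetilde f)=\tfrac12\#\{i\in\widetilde S : j-\tfrac12 \text{ lies strictly between } i \text{ and } \widetilde f(i)\}$. A crossing is an equivalence class $\langle i,j\rangle$ of pairs $(i,j)\in\widetilde S\times\widetilde S$ with $\operatorname{sgn}(i-j)\ne\operatorname{sgn}(\widetilde f(i)-\widetilde f(j))$, under the relation generated by $(i,j)\sim(j,i)$ and $(i,j)\sim(\gamma i,\gamma j)$ for $\gamma\in G_m$; $\operatorname{cross}(\widetilde f)$ is the number of crossings. The resolution $\widetilde f_{\langle i,j\rangle}$ sends $\gamma i\mapsto\gamma\widetilde f(j)$ and $\gamma j\mapsto\gamma\widetilde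 f(i)$ for $\gamma\in G_m$, and agrees with $\widetilde f$ elsewhere on $\widetilde S$. The pong algebra $P(m,k)$ is the free $\mathbb F[v_1,\dots,v_m]$-module on the lifted partial permutations on $k$ letters, where $v_j$ has weight the $j$-th standard basis vector. Its product is bilinear, with $\widetilde g\cdot\widetilde f=v\,(\widetilde g\circ\widetilde f)$ if the domain of $\widetilde g$ is the image of $\widetilde f$ and $\operatorname{cross}(\widetilde g\circ\widetilde f)=\operatorname{cross}(\widetilde g)+\operatorname{cross}(\widetilde f)$, and $\widetilde g\cdot\widetilde f=0$ otherwise. Its differential is linear, with $d\widetilde f=\sum_c v\,\widetilde f_c$, the sum being over the crossings $c$ of $\widetilde f$ with $\operatorname{cross}(\widetilde f_c)=\operatorname{cross}(\widetilde f)-1$. In each term $v$ is the monomial in $v_1,\dots,v_m$ that makes the product, respectively the differential, preserve weights. Let $Q(m,k)=P(m,k)/(v_1,\dots,v_m)$, with the induced product and differential. In $Q(m,m-1)$, for $1\le l\le m$ let $X_l$ be the class of the lifted partial permutation with domain $\mathbb Z$ that exchanges $\gamma(l-1)$ and $\gamma(l)$ for every $\gamma\in G_m$ and fixes all other integers. For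 $0<i<m$ let $\mathcal X_{0,i}$, respectively $\mathcal X_{i,m}$, be the class of the one that exchanges $\gamma(i)$ with $\gamma(1-i)$, respectively with $\gamma(2m-1-i)$, for every $\gamma\in G_m$ and fixes all other integers. Put $\Omega=\sum_{0<i<m}[\mathcal X_{0,i},\mathcal X_{i,m}]$. Then $X_1,\dots,X_m$ and $\Omega$ are cycles, and there is an isomorphism of $\mathbb F$-algebras $$H_*(Q(m,m-1))\;\cong\;\mathbb F[X_1,\dots,X_m,\Omega]/(X_1^2,\dots,X_m^2)$$ that carries the homology classes of $X_1,\dots,X_m$ and $\Omega$ to the generators of the same names. -/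

import Mathlib

namespace Pong

/-- The group of rigid motions of `ℤ` generated by the reflections `x ↦ 1 - x` and
`x ↦ 2m - 1 - x` of the line through `1/2` and through `m - 1/2`. -/
def wallGroup (m : ℕ) : Subgroup (Equiv.Perm ℤ) :=
  Subgroup.closure {Equiv.subLeft (1 : ℤ), Equiv.subLeft (2 * (m : ℤ) - 1)}

theorem wallGroup_form {m : ℕ} {γ : Equiv.Perm ℤ} (h : γ ∈ wallGroup m) :
    (∃ n : ℤ, ∀ x, γ x = x + (2 * m - 2) * n) ∨ (∃ n : ℤ, ∀ x, γ x = 1 - x + (2 * m - 2) * n) := by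
  induction h using Subgroup.closure_induction with
  | mem x hx =>
    rcases hx with rfl | hx
    · exact Or.inr ⟨0, fun x => by simp⟩
    · rw [Set.mem_singleton_iff] at hx
      subst hx
      exact Or.inr ⟨1, fun x => by simp; ring⟩
  | one => exact Or.inl ⟨0, fun x => by simp⟩
  | mul x y _ _ hx hy =>
    rcases hx with ⟨a, ha⟩ | ⟨a, ha⟩ <;> rcases hy with ⟨b, hb⟩ | ⟨b, hb⟩
    · exact Or.inl ⟨a + b, fun z => by rw [Equiv.Perm.mul_apply, ha, hb]; ring⟩
    · exact Or.inr ⟨a + b, fun z => by rw [Equiv.Perm.mul_apply, ha, hb]; ring⟩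
    · exact Or.inr ⟨a - b, fun z => by rw [Equiv.Perm.mul_apply, ha, hb]; ring⟩
    · exact Or.inl ⟨a - b, fun z => by rw [Equiv.Perm.mul_apply, ha, hb]; ring⟩
  | inv x _ hx =>
    rcases hx with ⟨a, ha⟩ | ⟨a, ha⟩
    · exact Or.inl ⟨-a, fun z => by rw [Equiv.Perm.inv_eq_iff_eq, ha]; ring⟩
    · exact Or.inr ⟨a, fun z => by rw [Equiv.Perm.inv_eq_iff_eq, ha]; ring⟩

theorem wallGroup_abs {m : ℕ} {γ : Equiv.Perm ℤ} (h : γ ∈ wallGroup m) (x y : ℤ) :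
    |γ x - γ y| = |x - y| := by
  rcases wallGroup_form h with ⟨n, hn⟩ | ⟨n, hn⟩
  · rw [hn, hn]; congr 1; ring
  · rw [hn, hn, abs_sub_comm x y]; congr 1; ring

theorem wallGroup_order {m : ℕ} {γ : Equiv.Perm ℤ} (h : γ ∈ wallGroup m) :
    (∀ x y, γ x < γ y ↔ x < y) ∨ (∀ x y, γ x < γ y ↔ y < x) := by
  rcases wallGroup_form h with ⟨n, hn⟩ | ⟨n, hn⟩
  · left; intro x y; rw [hn, hn]; constructor <;> intro h <;> linarith
  · right; intro x y; rw [hn, hn]; constructor <;> intro h <;> linarith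

theorem wallGroup_free {m : ℕ} {γ : Equiv.Perm ℤ} (h : γ ∈ wallGroup m) {x : ℤ} (hx : γ x = x)
    (y : ℤ) : γ y = y := by
  rcases wallGroup_form h with ⟨n, hn⟩ | ⟨n, hn⟩
  · rw [hn] at hx ⊢; linarith
  · rw [hn] at hx
    have : (2 * (m : ℤ) - 2) * n = 2 * ((m - 1) * n) := by ring
    omega

theorem wallGroup_free' {m : ℕ} {γ δ : Equiv.Perm ℤ} (h : γ ∈ wallGroup m) (h' : δ ∈ wallGroup m)
    {x : ℤ} (hx : γ x = δ x) (y : ℤ) : γ y = δ y := by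
  have := wallGroup_free ((wallGroup m).mul_mem ((wallGroup m).inv_mem h') h) (x := x)
    (by rw [Equiv.Perm.mul_apply, Equiv.Perm.inv_eq_iff_eq, hx]) y
  rwa [Equiv.Perm.mul_apply, Equiv.Perm.inv_eq_iff_eq] at this

/-- The position set `ℤ / G_m`. -/
abbrev Position (m : ℕ) : Type := MulAction.orbitRel.Quotient (wallGroup m) ℤ

/-- The position of an integer, i.e. its orbit. -/
def pos (m : ℕ) (i : ℤ) : Position m := Quotient.mk _ i

theorem pos_eq_iff {m : ℕ} {i j : ℤ} : pos m i = pos m j ↔ ∃ γ ∈ wallGroup m, γ i = j := by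
  unfold pos
  rw [eq_comm]
  refine Quotient.eq.trans ?_
  rw [MulAction.orbitRel_apply, MulAction.mem_orbit_iff]
  constructor
  · rintro ⟨γ, h⟩; exact ⟨γ.1, γ.2, h⟩
  · rintro ⟨γ, h, h'⟩; exact ⟨⟨γ, h⟩, h'⟩

/-- A lifted partial permutation on `k` letters: a `G_m`-invariant set `dom ⊆ ℤ` with `k` orbits,
and a `G_m`-equivariant map `dom → ℤ` that is injective on orbits. The map is stored as a function
on all of `ℤ`, set to the identity outside `dom`, so that equality of these structures is equality
of partial functions. -/
@[ext]
structure LiftedPartialPerm (m k : ℕ) where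
  dom : Set ℤ
  toFun : ℤ → ℤ
  dom_invariant : ∀ γ ∈ wallGroup m, ∀ i ∈ dom, γ i ∈ dom
  equivariant : ∀ γ ∈ wallGroup m, ∀ i ∈ dom, toFun (γ i) = γ (toFun i)
  card_orbits : (pos m '' dom).encard = k
  injective_orbits : ∀ i ∈ dom, ∀ j ∈ dom, pos m (toFun i) = pos m (toFun j) → pos m i = pos m j
  map_outside : ∀ i, i ∉ dom → toFun i = i

namespace LiftedPartialPerm

variable {m k : ℕ}

instance : CoeFun (LiftedPartialPerm m k) (fun _ => ℤ → ℤ) := ⟨toFun⟩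

theorem mem_dom_iff (f : LiftedPartialPerm m k) {γ : Equiv.Perm ℤ} (hγ : γ ∈ wallGroup m) (i : ℤ) :
    γ i ∈ f.dom ↔ i ∈ f.dom := by
  refine ⟨fun h => ?_, f.dom_invariant γ hγ i⟩
  simpa using f.dom_invariant γ⁻¹ ((wallGroup m).inv_mem hγ) _ h

theorem map_smul (f : LiftedPartialPerm m k) {γ : Equiv.Perm ℤ} (hγ : γ ∈ wallGroup m) (i : ℤ) :
    f (γ i) = γ (f i) := by
  by_cases h : i ∈ f.dom
  · exact f.equivariant γ hγ i h
  · rw [f.map_outside i h, f.map_outside (γ i) (by rwa [f.mem_dom_iff hγ])]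

theorem eq_of_map_eq (f : LiftedPartialPerm m k) {γ : Equiv.Perm ℤ} (hγ : γ ∈ wallGroup m) {i j : ℤ}
    (hi : i ∈ f.dom) (hj : j ∈ f.dom) (h : f j = γ (f i)) : j = γ i := by
  obtain ⟨δ, hδ, h'⟩ := pos_eq_iff.1 (f.injective_orbits i hi j hj (pos_eq_iff.2 ⟨γ, hγ, h.symm⟩))
  rw [← h', f.map_smul hδ] at h
  rw [← h', wallGroup_free' hδ hγ h]

theorem injOn (f : LiftedPartialPerm m k) : Set.InjOn f f.dom := fun i hi j hj h =>
  (f.eq_of_map_eq (wallGroup m).one_mem hi hj (by simpa using h.symm)).symm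

theorem finite_orbits (f : LiftedPartialPerm m k) : (pos m '' f.dom).Finite := by
  rw [← Set.encard_ne_top_iff, f.card_orbits]
  exact ENat.natCast_ne_top k

theorem exists_rep (f : LiftedPartialPerm m k) :
    ∃ R : Set ℤ, R.Finite ∧ ∀ i ∈ f.dom, ∃ γ ∈ wallGroup m, ∃ r ∈ R, γ r = i := by
  refine ⟨Quotient.out '' (pos m '' f.dom), f.finite_orbits.image _, fun i hi => ?_⟩
  obtain ⟨γ, hγ, h⟩ := pos_eq_iff.1 (show pos m (pos m i).out = pos m i from Quotient.out_eq _)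
  exact ⟨γ, hγ, _, ⟨_, ⟨i, hi, rfl⟩, rfl⟩, h⟩

theorem exists_bound (f : LiftedPartialPerm m k) : ∃ D : ℤ, ∀ i ∈ f.dom, |f i - i| ≤ D := by
  obtain ⟨R, hR, h⟩ := f.exists_rep
  obtain ⟨D, hD⟩ := (hR.image (fun r => |f r - r|)).bddAbove
  refine ⟨D, fun i hi => ?_⟩
  obtain ⟨γ, hγ, r, hr, rfl⟩ := h i hi
  rw [f.map_smul hγ, wallGroup_abs hγ]
  exact hD ⟨r, hr, rfl⟩

/-- The set of the lifted strands of `f` that cross the vertical line at `l + 1/2`. -/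
def strandsAcross (f : LiftedPartialPerm m k) (l : ℤ) : Set ℤ :=
  {i | i ∈ f.dom ∧ ((i ≤ l ∧ l < f i) ∨ (f i ≤ l ∧ l < i))}

theorem strandsAcross_finite (f : LiftedPartialPerm m k) (l : ℤ) : (f.strandsAcross l).Finite := by
  obtain ⟨D, hD⟩ := f.exists_bound
  refine (Set.finite_Icc (l - D) (l + D)).subset ?_
  rintro i ⟨hi, h⟩
  have := abs_le.1 (hD i hi)
  simp only [Set.mem_Icc]
  omega

/-- Twice the vector of local multiplicities of `f`; the entry with index `l : Fin m` is the number
of lifted strands of `f` that cross `l + 1/2`, so the local multiplicity there is half of it. -/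
noncomputable def twiceWeight (f : LiftedPartialPerm m k) (l : Fin m) : ℕ :=
  (f.strandsAcross (l : ℕ)).ncard

end LiftedPartialPerm

/-- Two pairs of integers are equivalent when they differ by an element of `G_m` and, possibly,
the exchange of the entries. -/
def pairSetoid (m : ℕ) : Setoid (ℤ × ℤ) where
  r p q := ∃ γ ∈ wallGroup m, (γ p.1, γ p.2) = q ∨ (γ p.2, γ p.1) = q
  iseqv :=
    { refl := fun p => ⟨1, (wallGroup m).one_mem, Or.inl rfl⟩
      symm := by
        rintro p _ ⟨γ, hγ, rfl | rfl⟩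
        · exact ⟨γ⁻¹, (wallGroup m).inv_mem hγ, Or.inl (by simp)⟩
        · exact ⟨γ⁻¹, (wallGroup m).inv_mem hγ, Or.inr (by simp)⟩
      trans := by
        rintro p _ _ ⟨γ, hγ, rfl | rfl⟩ ⟨δ, hδ, rfl | rfl⟩
        · exact ⟨δ * γ, (wallGroup m).mul_mem hδ hγ, Or.inl rfl⟩
        · exact ⟨δ * γ, (wallGroup m).mul_mem hδ hγ, Or.inr rfl⟩
        · exact ⟨δ * γ, (wallGroup m).mul_mem hδ hγ, Or.inr rfl⟩
        · exact ⟨δ * γ, (wallGroup m).mul_mem hδ hγ, Or.inl rfl⟩ }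

/-- The set of the equivalence classes `⟨i, j⟩`. -/
def PairClass (m : ℕ) : Type := Quotient (pairSetoid m)

/-- The equivalence class `⟨i, j⟩`. -/
def pairClass (m : ℕ) (i j : ℤ) : PairClass m := Quotient.mk (pairSetoid m) (i, j)

theorem pairClass_eq_iff {m : ℕ} {i j i' j' : ℤ} : pairClass m i j = pairClass m i' j' ↔
    ∃ γ ∈ wallGroup m, (γ i = i' ∧ γ j = j') ∨ (γ j = i' ∧ γ i = j') := by
  refine Quotient.eq.trans ?_
  change (∃ γ ∈ wallGroup m, (γ i, γ j) = (i', j') ∨ (γ j, γ i) = (i', j')) ↔ _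
  simp only [Prod.mk.injEq]

theorem pairClass_cases {m : ℕ} (c : PairClass m) : ∃ i j, c = pairClass m i j := by
  induction c using Quotient.inductionOn with
  | h p => exact ⟨p.1, p.2, rfl⟩

namespace LiftedPartialPerm

variable {m k : ℕ}

/-- `(i, j)` is a lifted crossing of `f`. -/
def IsLiftedCrossing (f : LiftedPartialPerm m k) (i j : ℤ) : Prop :=
  i ∈ f.dom ∧ j ∈ f.dom ∧ Int.sign (i - j) ≠ Int.sign (f i - f j)

theorem isLiftedCrossing_iff {f : LiftedPartialPerm m k} {i j : ℤ} : f.IsLiftedCrossing i j ↔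
    i ∈ f.dom ∧ j ∈ f.dom ∧ ((i < j ∧ f j < f i) ∨ (j < i ∧ f i < f j)) := by
  unfold IsLiftedCrossing
  refine and_congr_right fun hi => and_congr_right fun hj => ?_
  have h0 : f i = f j → i = j := fun h => f.injOn hi hj h
  have h1 : i = j → f i = f j := fun h => by rw [h]
  rcases lt_trichotomy i j with h | h | h <;> rcases lt_trichotomy (f i) (f j) with h' | h' | h' <;>
    first
      | (rw [Int.sign_eq_neg_one_of_neg (by omega : i - j < 0)])
      | (rw [Int.sign_eq_one_of_pos (by omega : 0 < i - j)])
      | (rw [show i - j = 0 by omega, Int.sign_zero])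
  all_goals first
      | (rw [Int.sign_eq_neg_one_of_neg (by omega : f i - f j < 0)])
      | (rw [Int.sign_eq_one_of_pos (by omega : 0 < f i - f j)])
      | (rw [show f i - f j = 0 by omega, Int.sign_zero])
  all_goals constructor <;> intro H
  all_goals omega

theorem IsLiftedCrossing.symm {f : LiftedPartialPerm m k} {i j : ℤ} (h : f.IsLiftedCrossing i j) :
    f.IsLiftedCrossing j i := by
  rw [isLiftedCrossing_iff] at *
  tauto

theorem IsLiftedCrossing.smul {f : LiftedPartialPerm m k} {i j : ℤ} (h : f.IsLiftedCrossing i j)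
    {γ : Equiv.Perm ℤ} (hγ : γ ∈ wallGroup m) : f.IsLiftedCrossing (γ i) (γ j) := by
  rw [isLiftedCrossing_iff] at *
  rw [f.mem_dom_iff hγ, f.mem_dom_iff hγ, f.map_smul hγ, f.map_smul hγ]
  rcases wallGroup_order hγ with h' | h' <;> simp only [h'] <;> tauto

/-- The set of the crossings of `f`. -/
def crossings (f : LiftedPartialPerm m k) : Set (PairClass m) :=
  {c | ∃ i j, f.IsLiftedCrossing i j ∧ c = pairClass m i j}

theorem mem_crossings_iff {f : LiftedPartialPerm m k} {i j : ℤ} :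
    pairClass m i j ∈ f.crossings ↔ f.IsLiftedCrossing i j := by
  refine ⟨?_, fun h => ⟨i, j, h, rfl⟩⟩
  rintro ⟨i', j', h, h'⟩
  obtain ⟨γ, hγ, ⟨rfl, rfl⟩ | ⟨rfl, rfl⟩⟩ := pairClass_eq_iff.1 h'.symm
  · exact h.smul hγ
  · exact (h.smul hγ).symm

theorem crossings_finite (f : LiftedPartialPerm m k) : f.crossings.Finite := by
  obtain ⟨D, hD⟩ := f.exists_bound
  obtain ⟨R, hR, hrep⟩ := f.exists_rep
  refine ((hR.prod (Set.finite_Icc (-(2 * D)) (2 * D))).image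
    (fun p => pairClass m p.1 (p.1 + p.2))).subset ?_
  rintro c ⟨i, j, h, rfl⟩
  obtain ⟨γ, hγ, r, hr, rfl⟩ := hrep i h.1
  have h1 := abs_le.1 (hD _ h.1)
  have h2 := abs_le.1 (hD _ h.2.1)
  have h3 := (isLiftedCrossing_iff.1 h).2.2
  have h4 : |γ r - j| ≤ 2 * D := by rw [abs_le]; omega
  have h5 : |r - γ⁻¹ j| ≤ 2 * D := by
    rw [← wallGroup_abs hγ]; simpa using h4
  rw [abs_le] at h5
  refine ⟨(r, γ⁻¹ j - r), ⟨hr, by simp only [Set.mem_Icc]; omega⟩, ?_⟩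
  rw [pairClass_eq_iff]
  exact ⟨γ, hγ, Or.inl ⟨rfl, by simp⟩⟩

/-- The crossing number. -/
noncomputable def cross (f : LiftedPartialPerm m k) : ℕ := f.crossings.ncard

/-- `g` and `f` can be composed when the domain of `g` is the image of `f`. -/
def Composable (g f : LiftedPartialPerm m k) : Prop := g.dom = f '' f.dom

theorem image_dom_invariant (f : LiftedPartialPerm m k) {γ : Equiv.Perm ℤ} (hγ : γ ∈ wallGroup m)
    {i : ℤ} (hi : i ∈ f '' f.dom) : γ i ∈ f '' f.dom := by
  obtain ⟨j, hj, rfl⟩ := hi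
  exact ⟨γ j, f.dom_invariant γ hγ j hj, f.map_smul hγ j⟩

theorem Composable.mem {g f : LiftedPartialPerm m k} (h : Composable g f) {i : ℤ} (hi : i ∈ f.dom) :
    f i ∈ g.dom := by
  rw [h]; exact ⟨i, hi, rfl⟩

open Classical in
/-- The composition `g ∘ f` of composable lifted partial permutations. -/
noncomputable def comp (g f : LiftedPartialPerm m k) (h : Composable g f) :
    LiftedPartialPerm m k where
  dom := f.dom
  toFun i := if i ∈ f.dom then g (f i) else i
  dom_invariant := f.dom_invariant
  equivariant γ hγ i hi := by
    rw [if_pos hi, if_pos (f.dom_invariant γ hγ i hi), f.map_smul hγ, g.map_smul hγ]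
  card_orbits := f.card_orbits
  injective_orbits i hi j hj hij := by
    rw [if_pos hi, if_pos hj] at hij
    exact f.injective_orbits i hi j hj (g.injective_orbits _ (h.mem hi) _ (h.mem hj) hij)
  map_outside i hi := by rw [if_neg hi]

theorem comp_apply {g f : LiftedPartialPerm m k} (h : Composable g f) {i : ℤ} (hi : i ∈ f.dom) :
    comp g f h i = g (f i) := if_pos hi

theorem comp_dom {g f : LiftedPartialPerm m k} (h : Composable g f) : (comp g f h).dom = f.dom := rfl

/-- Extensionality on the domain. -/
theorem ext_on {f g : LiftedPartialPerm m k} (h : f.dom = g.dom) (h' : ∀ i ∈ f.dom, f i = g i) :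
    f = g := by
  refine LiftedPartialPerm.ext h (funext fun i => ?_)
  by_cases hi : i ∈ f.dom
  · exact h' i hi
  · rw [f.map_outside i hi, g.map_outside i (by rwa [← h])]

open Classical in
/-- The `G_m`-equivariant exchange of the orbits of `i` and `j`: it sends `γ i` to `γ j` and
`γ j` to `γ i` for `γ` in `G_m`, and fixes the other integers. -/
noncomputable def _root_.Pong.swapAt (m : ℕ) (i j : ℤ) (n : ℤ) : ℤ :=
  if h : ∃ γ ∈ wallGroup m, γ i = n then h.choose j
  else if h : ∃ γ ∈ wallGroup m, γ j = n then h.choose i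
  else n

/-- The exchange of `i` and `j` is consistent: this can fail only if `i` and `j` differ by a
translation in `G_m`. -/
def _root_.Pong.Swappable (m : ℕ) (i j : ℤ) : Prop := ∀ γ ∈ wallGroup m, γ i = j → γ j = i

end LiftedPartialPerm

section swap

variable {m : ℕ} {i j : ℤ}

theorem swapAt_left {γ : Equiv.Perm ℤ} (hγ : γ ∈ wallGroup m) : swapAt m i j (γ i) = γ j := by
  have h : ∃ δ ∈ wallGroup m, δ i = γ i := ⟨γ, hγ, rfl⟩
  unfold swapAt
  rw [dif_pos h]
  exact wallGroup_free' h.choose_spec.1 hγ h.choose_spec.2 j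

theorem swapAt_right (hs : Swappable m i j) {γ : Equiv.Perm ℤ} (hγ : γ ∈ wallGroup m) :
    swapAt m i j (γ j) = γ i := by
  by_cases h : ∃ δ ∈ wallGroup m, δ i = γ j
  · obtain ⟨δ, hδ, h⟩ := h
    rw [← h, swapAt_left hδ]
    have := hs (γ⁻¹ * δ) ((wallGroup m).mul_mem ((wallGroup m).inv_mem hγ) hδ) (by simp [h])
    rwa [Equiv.Perm.mul_apply, Equiv.Perm.inv_eq_iff_eq] at this
  · have h' : ∃ δ ∈ wallGroup m, δ j = γ j := ⟨γ, hγ, rfl⟩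
    unfold swapAt
    rw [dif_neg h, dif_pos h']
    exact wallGroup_free' h'.choose_spec.1 hγ h'.choose_spec.2 i

theorem swapAt_other {n : ℤ} (h : ¬ ∃ γ ∈ wallGroup m, γ i = n) (h' : ¬ ∃ γ ∈ wallGroup m, γ j = n) :
    swapAt m i j n = n := by
  unfold swapAt
  rw [dif_neg h, dif_neg h']

/-- Case distinction for `swapAt`. -/
theorem swapAt_cases (m : ℕ) (i j n : ℤ) : (∃ γ ∈ wallGroup m, n = γ i) ∨
    (∃ γ ∈ wallGroup m, n = γ j) ∨
    ((¬ ∃ γ ∈ wallGroup m, γ i = n) ∧ (¬ ∃ γ ∈ wallGroup m, γ j = n)) := by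
  by_cases h : ∃ γ ∈ wallGroup m, γ i = n
  · obtain ⟨γ, hγ, h⟩ := h; exact Or.inl ⟨γ, hγ, h.symm⟩
  by_cases h' : ∃ γ ∈ wallGroup m, γ j = n
  · obtain ⟨γ, hγ, h'⟩ := h'; exact Or.inr (Or.inl ⟨γ, hγ, h'.symm⟩)
  exact Or.inr (Or.inr ⟨h, h'⟩)

theorem swapAt_swapAt (hs : Swappable m i j) (n : ℤ) : swapAt m i j (swapAt m i j n) = n := by
  rcases swapAt_cases m i j n with ⟨γ, hγ, rfl⟩ | ⟨γ, hγ, rfl⟩ | ⟨h, h'⟩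
  · rw [swapAt_left hγ, swapAt_right hs hγ]
  · rw [swapAt_right hs hγ, swapAt_left hγ]
  · rw [swapAt_other h h', swapAt_other h h']

theorem swapAt_smul (hs : Swappable m i j) {δ : Equiv.Perm ℤ} (hδ : δ ∈ wallGroup m) (n : ℤ) :
    swapAt m i j (δ n) = δ (swapAt m i j n) := by
  rcases swapAt_cases m i j n with ⟨γ, hγ, rfl⟩ | ⟨γ, hγ, rfl⟩ | ⟨h, h'⟩
  · rw [swapAt_left hγ, ← Equiv.Perm.mul_apply, swapAt_left ((wallGroup m).mul_mem hδ hγ)]; rfl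
  · rw [swapAt_right hs hγ, ← Equiv.Perm.mul_apply, swapAt_right hs ((wallGroup m).mul_mem hδ hγ)]
    rfl
  · have key : ∀ x : ℤ, (¬ ∃ γ ∈ wallGroup m, γ x = n) → ¬ ∃ γ ∈ wallGroup m, γ x = δ n := by
      rintro x hx ⟨γ, hγ, e⟩
      exact hx ⟨δ⁻¹ * γ, (wallGroup m).mul_mem ((wallGroup m).inv_mem hδ) hγ, by simp [e]⟩
    rw [swapAt_other h h', swapAt_other (key i h) (key j h')]

theorem swapAt_dist (hs : Swappable m i j) (n : ℤ) :
    swapAt m i j n = n ∨ |swapAt m i j n - n| = |i - j| := by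
  rcases swapAt_cases m i j n with ⟨γ, hγ, rfl⟩ | ⟨γ, hγ, rfl⟩ | ⟨h, h'⟩
  · right; rw [swapAt_left hγ, wallGroup_abs hγ, abs_sub_comm]
  · right; rw [swapAt_right hs hγ, wallGroup_abs hγ]
  · left; exact swapAt_other h h'

theorem swapAt_congr (hs : Swappable m i j) {i' j' : ℤ} (hs' : Swappable m i' j')
    (h : pairClass m i j = pairClass m i' j') : swapAt m i j = swapAt m i' j' := by
  funext n
  obtain ⟨δ, hδ, ⟨rfl, rfl⟩ | ⟨rfl, rfl⟩⟩ := pairClass_eq_iff.1 h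
  all_goals
    have hδ' := (wallGroup m).inv_mem hδ
    have back : ∀ x : ℤ, (¬ ∃ γ ∈ wallGroup m, γ x = n) → ¬ ∃ γ ∈ wallGroup m, γ (δ x) = n := by
      rintro x hx ⟨γ, hγ, e⟩
      exact hx ⟨γ * δ, (wallGroup m).mul_mem hγ hδ, e⟩
    have fwd : ∀ γ : Equiv.Perm ℤ, ∀ x : ℤ, γ x = (γ * δ⁻¹) (δ x) := fun γ x => by simp
  · rcases swapAt_cases m i j n with ⟨γ, hγ, rfl⟩ | ⟨γ, hγ, rfl⟩ | ⟨h, h'⟩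
    · rw [swapAt_left hγ, fwd γ i, swapAt_left ((wallGroup m).mul_mem hγ hδ'), ← fwd]
    · rw [swapAt_right hs hγ, fwd γ j, swapAt_right hs' ((wallGroup m).mul_mem hγ hδ'), ← fwd]
    · rw [swapAt_other h h', swapAt_other (back _ h) (back _ h')]
  · rcases swapAt_cases m i j n with ⟨γ, hγ, rfl⟩ | ⟨γ, hγ, rfl⟩ | ⟨h, h'⟩
    · rw [swapAt_left hγ, fwd γ i, swapAt_right hs' ((wallGroup m).mul_mem hγ hδ'), ← fwd]
    · rw [swapAt_right hs hγ, fwd γ j, swapAt_left ((wallGroup m).mul_mem hγ hδ'), ← fwd]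
    · rw [swapAt_other h h', swapAt_other (back _ h') (back _ h)]

end swap

namespace LiftedPartialPerm

variable {m k : ℕ}

theorem IsLiftedCrossing.swappable {f : LiftedPartialPerm m k} {i j : ℤ}
    (h : f.IsLiftedCrossing i j) : Swappable m i j := by
  rintro γ hγ rfl
  rcases wallGroup_form hγ with ⟨n, hn⟩ | ⟨n, hn⟩
  · exfalso
    have := (isLiftedCrossing_iff.1 h).2.2
    rw [f.map_smul hγ, hn, hn] at this
    omega
  · rw [hn, hn]; ring

theorem swapAt_mem_dom {f : LiftedPartialPerm m k} {i j : ℤ} (hi : i ∈ f.dom) (hj : j ∈ f.dom)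
    (hs : Swappable m i j) {n : ℤ} (hn : n ∈ f.dom) : swapAt m i j n ∈ f.dom := by
  rcases swapAt_cases m i j n with ⟨γ, hγ, rfl⟩ | ⟨γ, hγ, rfl⟩ | ⟨h, h'⟩
  · rw [swapAt_left hγ]; exact f.dom_invariant γ hγ j hj
  · rw [swapAt_right hs hγ]; exact f.dom_invariant γ hγ i hi
  · rwa [swapAt_other h h']

/-- The resolution of `f` at the lifted crossing `(i, j)`: it sends `γ i` to `γ (f j)` and `γ j` to
`γ (f i)` for `γ` in `G_m`, and agrees with `f` on the other integers. -/
noncomputable def resolve (f : LiftedPartialPerm m k) (i j : ℤ) (h : f.IsLiftedCrossing i j) :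
    LiftedPartialPerm m k where
  dom := f.dom
  toFun n := f (swapAt m i j n)
  dom_invariant := f.dom_invariant
  equivariant γ hγ n _ := by rw [swapAt_smul h.swappable hγ, f.map_smul hγ]
  card_orbits := f.card_orbits
  injective_orbits a ha b hb hab := by
    have := f.injective_orbits _ (swapAt_mem_dom h.1 h.2.1 h.swappable ha)
      _ (swapAt_mem_dom h.1 h.2.1 h.swappable hb) hab
    obtain ⟨γ, hγ, e⟩ := pos_eq_iff.1 this
    refine pos_eq_iff.2 ⟨γ, hγ, ?_⟩
    rw [← swapAt_smul h.swappable hγ] at e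
    rw [← swapAt_swapAt h.swappable (γ a), e, swapAt_swapAt h.swappable]
  map_outside n hn := by
    have : swapAt m i j n = n := by
      refine swapAt_other ?_ ?_
      · rintro ⟨γ, hγ, rfl⟩; exact hn (f.dom_invariant γ hγ i h.1)
      · rintro ⟨γ, hγ, rfl⟩; exact hn (f.dom_invariant γ hγ j h.2.1)
    rw [this, f.map_outside n hn]

/-- The resolution `f_c` of `f` at the crossing `c`. -/
noncomputable def resolveAt (f : LiftedPartialPerm m k) (c : f.crossings) : LiftedPartialPerm m k :=
  f.resolve c.2.choose c.2.choose_spec.choose c.2.choose_spec.choose_spec.1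

theorem resolveAt_eq {f : LiftedPartialPerm m k} {i j : ℤ} (h : pairClass m i j ∈ f.crossings) :
    f.resolveAt ⟨pairClass m i j, h⟩ = f.resolve i j (mem_crossings_iff.1 h) := by
  refine LiftedPartialPerm.ext rfl (funext fun n => ?_)
  have hc := h.choose_spec.choose_spec
  exact congrArg (fun s => f.toFun (s n))
    (swapAt_congr hc.1.swappable (mem_crossings_iff.1 h).swappable hc.2.symm)

end LiftedPartialPerm

end Pong

namespace Pong

/-- `w` exceeds `w'` by even nonnegative numbers. -/
def EvenLE {m : ℕ} (w' w : Fin m → ℕ) : Prop := ∀ l, ∃ e, w l = w' l + 2 * e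

theorem ncard_add_ncard_eq {α : Type*} {A B C : Set α} (hA : A.Finite) (hB : B.Finite)
    (h : ∀ x, x ∈ C ↔ (x ∈ A ∧ x ∉ B) ∨ (x ∈ B ∧ x ∉ A)) :
    A.ncard + B.ncard = C.ncard + 2 * (A ∩ B).ncard := by
  have hC : C = (A \ B) ∪ (B \ A) := by ext x; rw [h]; rfl
  have h1 := Set.ncard_inter_add_ncard_sdiff_eq_ncard A B hA
  have h2 := Set.ncard_inter_add_ncard_sdiff_eq_ncard B A hB
  have h3 : C.ncard = (A \ B).ncard + (B \ A).ncard := by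
    rw [hC]
    refine Set.ncard_union_eq ?_ (hA.subset Set.sdiff_subset) (hB.subset Set.sdiff_subset)
    exact Set.disjoint_left.2 fun x hx hx' => hx.2 hx'.1
  rw [Set.inter_comm B A] at h2
  omega

namespace LiftedPartialPerm

variable {m k : ℕ}

theorem twiceWeight_comp {g f : LiftedPartialPerm m k} (h : Composable g f) :
    EvenLE (comp g f h).twiceWeight (g.twiceWeight + f.twiceWeight) := by
  intro l
  set B : Set ℤ := {i | i ∈ f.dom ∧ f i ∈ g.strandsAcross (l : ℕ)} with hB
  have himg : f '' B = g.strandsAcross (l : ℕ) := by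
    ext x
    constructor
    · rintro ⟨i, hi, rfl⟩; exact hi.2
    · intro hx
      obtain ⟨i, hi, rfl⟩ : x ∈ f '' f.dom := by rw [← h]; exact hx.1
      exact ⟨i, ⟨hi, hx⟩, rfl⟩
  have hinj : Set.InjOn f B := f.injOn.mono fun i hi => hi.1
  have hBfin : B.Finite := Set.Finite.of_finite_image (by rw [himg]; exact g.strandsAcross_finite _) hinj
  have hcard : B.ncard = g.twiceWeight l := by
    rw [twiceWeight, ← himg, hinj.ncard_image]
  refine ⟨(f.strandsAcross (l : ℕ) ∩ B).ncard, ?_⟩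
  have := ncard_add_ncard_eq (C := (comp g f h).strandsAcross (l : ℕ))
    (f.strandsAcross_finite (l : ℕ)) hBfin ?_
  · rw [Pi.add_apply, ← hcard, add_comm B.ncard]; exact this
  · intro i
    by_cases hi : i ∈ f.dom
    · have hi' := h.mem hi
      simp only [strandsAcross, Set.mem_ofPred_eq, comp_dom, hi, comp_apply h hi, hB, hi', true_and]
      omega
    · simp [strandsAcross, hB, hi, comp_dom]

/-- The map of classes of pairs induced by `f`. -/
def classMap (f : LiftedPartialPerm m k) : PairClass m → PairClass m :=
  Quotient.map (fun p => (f p.1, f p.2)) (by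
    rintro p _ ⟨γ, hγ, rfl | rfl⟩
    · exact ⟨γ, hγ, Or.inl (by simp only [f.map_smul hγ])⟩
    · exact ⟨γ, hγ, Or.inr (by simp only [f.map_smul hγ])⟩)

theorem classMap_pairClass (f : LiftedPartialPerm m k) (i j : ℤ) :
    f.classMap (pairClass m i j) = pairClass m (f i) (f j) := rfl

theorem classMap_inj (f : LiftedPartialPerm m k) {i j i' j' : ℤ} (hi : i ∈ f.dom) (hj : j ∈ f.dom)
    (hi' : i' ∈ f.dom) (hj' : j' ∈ f.dom)
    (h : f.classMap (pairClass m i j) = f.classMap (pairClass m i' j')) :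
    pairClass m i j = pairClass m i' j' := by
  rw [classMap_pairClass, classMap_pairClass, pairClass_eq_iff] at h
  obtain ⟨γ, hγ, ⟨h1, h2⟩ | ⟨h1, h2⟩⟩ := h
  · exact pairClass_eq_iff.2 ⟨γ, hγ, Or.inl
      ⟨(f.eq_of_map_eq hγ hi hi' h1.symm).symm, (f.eq_of_map_eq hγ hj hj' h2.symm).symm⟩⟩
  · exact pairClass_eq_iff.2 ⟨γ, hγ, Or.inr
      ⟨(f.eq_of_map_eq hγ hj hi' h1.symm).symm, (f.eq_of_map_eq hγ hi hj' h2.symm).symm⟩⟩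

/-- The classes of pairs of strands of `f` that are sent to crossings of `g`. -/
def pulledCrossings (g f : LiftedPartialPerm m k) : Set (PairClass m) :=
  {c | ∃ i j, i ∈ f.dom ∧ j ∈ f.dom ∧ c = pairClass m i j ∧ f.classMap c ∈ g.crossings}

theorem mem_pulledCrossings {g f : LiftedPartialPerm m k} {i j : ℤ} :
    pairClass m i j ∈ pulledCrossings g f ↔
      i ∈ f.dom ∧ j ∈ f.dom ∧ g.IsLiftedCrossing (f i) (f j) := by
  constructor
  · rintro ⟨i', j', hi, hj, h, h'⟩
    rw [classMap_pairClass, mem_crossings_iff] at h'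
    obtain ⟨γ, hγ, ⟨rfl, rfl⟩ | ⟨rfl, rfl⟩⟩ := pairClass_eq_iff.1 h
    · rw [f.mem_dom_iff hγ] at hi hj; exact ⟨hi, hj, h'⟩
    · rw [f.mem_dom_iff hγ] at hi hj; exact ⟨hj, hi, h'⟩
  · rintro ⟨hi, hj, h⟩
    exact ⟨i, j, hi, hj, rfl, mem_crossings_iff.2 h⟩

theorem classMap_injOn (g f : LiftedPartialPerm m k) :
    Set.InjOn f.classMap (pulledCrossings g f) := by
  rintro _ ⟨i, j, hi, hj, rfl, -⟩ _ ⟨i', j', hi', hj', rfl, -⟩ h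
  exact f.classMap_inj hi hj hi' hj' h

theorem classMap_image {g f : LiftedPartialPerm m k} (h : Composable g f) :
    f.classMap '' pulledCrossings g f = g.crossings := by
  ext c
  constructor
  · rintro ⟨_, ⟨i, j, hi, hj, rfl, h'⟩, rfl⟩; exact h'
  · rintro ⟨x, y, hxy, rfl⟩
    obtain ⟨i, hi, rfl⟩ : x ∈ f '' f.dom := by rw [← h]; exact hxy.1
    obtain ⟨j, hj, rfl⟩ : y ∈ f '' f.dom := by rw [← h]; exact hxy.2.1
    exact ⟨_, mem_pulledCrossings.2 ⟨hi, hj, hxy⟩, rfl⟩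

theorem pulledCrossings_finite {g f : LiftedPartialPerm m k} (h : Composable g f) :
    (pulledCrossings g f).Finite :=
  Set.Finite.of_finite_image (by rw [classMap_image h]; exact g.crossings_finite)
    (classMap_injOn g f)

theorem mem_crossings_comp {g f : LiftedPartialPerm m k} (h : Composable g f) (c : PairClass m) :
    c ∈ (comp g f h).crossings ↔ (c ∈ f.crossings ∧ c ∉ pulledCrossings g f) ∨
      (c ∈ pulledCrossings g f ∧ c ∉ f.crossings) := by
  obtain ⟨i, j, rfl⟩ := pairClass_cases c
  rw [mem_crossings_iff, mem_crossings_iff, mem_pulledCrossings, isLiftedCrossing_iff,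
    isLiftedCrossing_iff, isLiftedCrossing_iff, comp_dom]
  by_cases hi : i ∈ f.dom
  · by_cases hj : j ∈ f.dom
    · have h1 : f i = f j ↔ i = j := ⟨fun h => f.injOn hi hj h, fun h => by rw [h]⟩
      have h2 : g (f i) = g (f j) ↔ f i = f j :=
        ⟨fun e => g.injOn (h.mem hi) (h.mem hj) e, fun h => by rw [h]⟩
      simp only [hi, hj, h.mem hi, h.mem hj, true_and, comp_apply h hi, comp_apply h hj]
      omega
    · simp [hj]
  · simp [hi]

theorem cross_comp {g f : LiftedPartialPerm m k} (h : Composable g f) :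
    g.cross + f.cross = (comp g f h).cross + 2 * (f.crossings ∩ pulledCrossings g f).ncard := by
  have := ncard_add_ncard_eq f.crossings_finite (pulledCrossings_finite h) (mem_crossings_comp h)
  rw [cross, cross, cross, ← this, ← classMap_image h, (classMap_injOn g f).ncard_image]
  exact add_comm _ _

theorem cross_comp_le {g f : LiftedPartialPerm m k} (h : Composable g f) :
    (comp g f h).cross ≤ g.cross + f.cross := by
  have := cross_comp h; omega

theorem crossing_swapAt {f : LiftedPartialPerm m k} {i j : ℤ} (h : f.IsLiftedCrossing i j) (n : ℤ) :
    swapAt m i j n = n ∨ f.IsLiftedCrossing n (swapAt m i j n) := by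
  rcases swapAt_cases m i j n with ⟨γ, hγ, rfl⟩ | ⟨γ, hγ, rfl⟩ | ⟨h1, h2⟩
  · right; rw [swapAt_left hγ]; exact h.smul hγ
  · right; rw [swapAt_right h.swappable hγ]; exact h.symm.smul hγ
  · left; exact swapAt_other h1 h2

theorem twiceWeight_resolve {f : LiftedPartialPerm m k} {i j : ℤ} (h : f.IsLiftedCrossing i j) :
    EvenLE (f.resolve i j h).twiceWeight f.twiceWeight := by
  classical
  intro l
  obtain ⟨T, hT⟩ : ∃ T : ℤ → ℤ, T = swapAt m i j := ⟨_, rfl⟩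
  have hTT : ∀ n, T (T n) = n := fun n => by rw [hT]; exact swapAt_swapAt h.swappable n
  have hTd : ∀ n, n ∈ f.dom → T n ∈ f.dom := fun n hn => by
    rw [hT]; exact swapAt_mem_dom h.1 h.2.1 h.swappable hn
  have hTc : ∀ n, T n = n ∨ f.IsLiftedCrossing n (T n) := fun n => by
    rw [hT]; exact crossing_swapAt h n
  obtain ⟨L, hL⟩ : ∃ L : ℤ, L = ((l : ℕ) : ℤ) := ⟨_, rfl⟩
  -- the pairs of strands exchanged across the line, split into the two sides
  set A₁ : Set ℤ := {n | n ∈ f.dom ∧ n ≤ L ∧ L < T n ∧ L < f n ∧ f (T n) ≤ L} with hA₁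
  set X := f.strandsAcross L with hX
  set Y := (f.resolve i j h).strandsAcross L with hY
  set σ : ℤ → ℤ := fun n => if (n ≤ L ↔ T n ≤ L) then T n else n with hσ
  have hσσ : ∀ n, σ (σ n) = n := by
    intro n
    by_cases c : (n ≤ L ↔ T n ≤ L)
    · have : σ n = T n := if_pos c
      rw [this, hσ]
      simp only
      rw [if_pos (by rw [hTT]; exact c.symm), hTT]
    · have : σ n = n := if_neg c
      rw [this, this]
  have hfin : X.Finite := f.strandsAcross_finite _
  have hA₁X : A₁ ⊆ X := fun n hn => ⟨hn.1, Or.inl ⟨hn.2.1, hn.2.2.2.1⟩⟩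
  have hTA₁X : T '' A₁ ⊆ X := by
    rintro _ ⟨n, hn, rfl⟩
    exact ⟨hTd n hn.1, Or.inr ⟨hn.2.2.2.2, hn.2.2.1⟩⟩
  have hdisj : Disjoint A₁ (T '' A₁) := by
    rw [Set.disjoint_left]
    rintro _ hn ⟨n, hn', rfl⟩
    exact absurd hn.2.1 (not_le.2 hn'.2.2.1)
  have hYeq : σ '' Y = X \ (A₁ ∪ T '' A₁) := by
    have key : ∀ n, n ∈ Y ↔ σ n ∈ X \ (A₁ ∪ T '' A₁) := by
      intro n
      have e1 : n ∈ T '' A₁ ↔ T n ∈ A₁ := by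
        constructor
        · rintro ⟨p, hp, rfl⟩; rwa [hTT]
        · intro hn; exact ⟨_, hn, hTT n⟩
      have e2 : ∀ n, n ∈ T '' A₁ ↔ T n ∈ A₁ := by
        intro n
        constructor
        · rintro ⟨p, hp, rfl⟩; rwa [hTT]
        · intro hn; exact ⟨_, hn, hTT n⟩
      have hYn : n ∈ Y ↔ n ∈ f.dom ∧ ((n ≤ L ∧ L < f (T n)) ∨ (f (T n) ≤ L ∧ L < n)) := by
        rw [hT]; rfl
      have hd : n ∈ f.dom ↔ T n ∈ f.dom := ⟨hTd n, fun hh => by simpa [hTT] using hTd _ hh⟩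
      rw [hYn, Set.mem_sdiff, Set.mem_union, e2]
      have hc := hTc n
      rw [isLiftedCrossing_iff] at hc
      by_cases c : (n ≤ L ↔ T n ≤ L)
      · have hs : σ n = T n := if_pos c
        rw [hs, hTT]
        simp only [hX, hA₁, strandsAcross, Set.mem_ofPred_eq, hTT, ← hd]
        by_cases hn : n ∈ f.dom
        · simp only [hn, true_and]
          omega
        · simp only [hn, false_and]
      · have hs : σ n = n := if_neg c
        rw [hs]
        simp only [hX, hA₁, strandsAcross, Set.mem_ofPred_eq, hTT, ← hd]
        by_cases hn : n ∈ f.dom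
        · simp only [hn, true_and] at hc ⊢
          have hne : T n ≠ n := by intro e; rw [e] at c; exact c Iff.rfl
          rcases hc with hc | hc
          · exact absurd hc hne
          · have := hc.2
            omega
        · simp only [hn, false_and]
    ext n
    constructor
    · rintro ⟨p, hp, rfl⟩; exact (key p).1 hp
    · intro hn; exact ⟨σ n, (key _).2 (by rwa [hσσ]), hσσ n⟩
  have hcY : Y.ncard = (X \ (A₁ ∪ T '' A₁)).ncard := by
    rw [← hYeq, Set.ncard_image_of_injective _ (Function.LeftInverse.injective hσσ)]
  have hcU : (A₁ ∪ T '' A₁).ncard = A₁.ncard + A₁.ncard := by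
    rw [Set.ncard_union_eq hdisj (hfin.subset hA₁X) (hfin.subset hTA₁X),
      Set.ncard_image_of_injective _ (Function.LeftInverse.injective hTT)]
  have hsum := Set.ncard_sdiff_add_ncard_of_subset (Set.union_subset hA₁X hTA₁X) hfin
  refine ⟨A₁.ncard, ?_⟩
  change (f.strandsAcross ((l : ℕ) : ℤ)).ncard =
    ((f.resolve i j h).strandsAcross ((l : ℕ) : ℤ)).ncard + _
  rw [← hL]
  change X.ncard = Y.ncard + _
  omega

theorem cross_resolve {f : LiftedPartialPerm m k} {i j : ℤ} (h : f.IsLiftedCrossing i j) :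
    (f.resolve i j h).cross + 1 ≤ f.cross := by
  classical
  obtain ⟨T, hT⟩ : ∃ T : ℤ → ℤ, T = swapAt m i j := ⟨_, rfl⟩
  have hTT : ∀ n, T (T n) = n := fun n => by rw [hT]; exact swapAt_swapAt h.swappable n
  have hTd : ∀ n, n ∈ f.dom → T n ∈ f.dom := fun n hn => by
    rw [hT]; exact swapAt_mem_dom h.1 h.2.1 h.swappable hn
  have hTc : ∀ n, T n = n ∨ f.IsLiftedCrossing n (T n) := fun n => by
    rw [hT]; exact crossing_swapAt h n
  have hTs : ∀ γ ∈ wallGroup m, ∀ n, T (γ n) = γ (T n) := fun γ hγ n => by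
    rw [hT]; exact swapAt_smul h.swappable hγ n
  have hTdist : ∀ n, T n = n ∨ |T n - n| = |i - j| := fun n => by
    rw [hT]; exact swapAt_dist h.swappable n
  have hTi : T i = j := by rw [hT]; exact swapAt_left (wallGroup m).one_mem
  have hTj : T j = i := by rw [hT]; exact swapAt_right h.swappable (wallGroup m).one_mem
  -- `T` preserves the order of the pair
  set same : ℤ × ℤ → Prop := fun p => (p.1 < p.2 ↔ T p.1 < T p.2) ∧ (p.2 < p.1 ↔ T p.2 < T p.1)
    with hsame
  set s : ℤ × ℤ → ℤ × ℤ := fun p => if same p then (T p.1, T p.2) else p with hs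
  have same_smul : ∀ γ ∈ wallGroup m, ∀ p : ℤ × ℤ, same (γ p.1, γ p.2) ↔ same p := by
    intro γ hγ p
    simp only [hsame, hTs γ hγ]
    rcases wallGroup_order hγ with h' | h' <;> (simp only [h']; try tauto)
  have same_symm : ∀ p : ℤ × ℤ, same (p.2, p.1) ↔ same p := by
    intro p; simp only [hsame]; tauto
  have s_smul : ∀ γ ∈ wallGroup m, ∀ p : ℤ × ℤ, s (γ p.1, γ p.2) = (γ (s p).1, γ (s p).2) := by
    intro γ hγ p
    by_cases c : same p
    · have c' := (same_smul γ hγ p).2 c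
      simp only [hs]; rw [if_pos c, if_pos c']; simp only [hTs γ hγ]
    · have c' := mt (same_smul γ hγ p).1 c
      simp only [hs]; rw [if_neg c, if_neg c']
  have s_symm : ∀ p : ℤ × ℤ, s (p.2, p.1) = ((s p).2, (s p).1) := by
    intro p
    by_cases c : same p
    · have c' := (same_symm p).2 c
      simp only [hs]; rw [if_pos c, if_pos c']
    · have c' := mt (same_symm p).1 c
      simp only [hs]; rw [if_neg c, if_neg c']
  have s_s : ∀ p, s (s p) = p := by
    intro p
    by_cases c : same p
    · have e : s p = (T p.1, T p.2) := if_pos c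
      have c' : same (T p.1, T p.2) := by
        simp only [hsame, hTT] at c ⊢
        tauto
      rw [e]
      simp only [hs]
      rw [if_pos c', hTT, hTT]
    · have e : s p = p := if_neg c
      rw [e, e]
  set S : PairClass m → PairClass m := Quotient.map s (by
    rintro p _ ⟨γ, hγ, rfl | rfl⟩
    · exact ⟨γ, hγ, Or.inl (s_smul γ hγ p).symm⟩
    · refine ⟨γ, hγ, Or.inr ?_⟩
      rw [s_symm (γ p.1, γ p.2), s_smul γ hγ p]) with hS
  have S_mk : ∀ p : ℤ × ℤ, S (pairClass m p.1 p.2) = pairClass m (s p).1 (s p).2 := fun p => rfl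
  have S_inj : Function.Injective S := by
    refine Function.LeftInverse.injective (g := S) fun c => ?_
    obtain ⟨a, b, rfl⟩ := pairClass_cases c
    rw [S_mk (a, b), S_mk, s_s]
  have hx : S (pairClass m i j) = pairClass m i j := by
    rw [S_mk (i, j)]
    have : ¬ same (i, j) := by
      simp only [hsame, hTi, hTj]
      have := (isLiftedCrossing_iff.1 h).2.2
      omega
    have e : s (i, j) = (i, j) := if_neg this
    rw [e]
  have sub : S '' (f.resolve i j h).crossings ⊆ f.crossings \ {pairClass m i j} := by
    rintro _ ⟨c, hc, rfl⟩
    refine ⟨?_, ?_⟩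
    · obtain ⟨a, b, rfl⟩ := pairClass_cases c
      rw [mem_crossings_iff, isLiftedCrossing_iff] at hc
      have hc' : a ∈ f.dom ∧ b ∈ f.dom ∧
          ((a < b ∧ f (T b) < f (T a)) ∨ (b < a ∧ f (T a) < f (T b))) := by
        rw [hT]; exact hc
      obtain ⟨ha, hb, hab⟩ := hc'
      rw [S_mk (a, b), mem_crossings_iff]
      by_cases c : same (a, b)
      · have e : s (a, b) = (T a, T b) := if_pos c
        rw [e, isLiftedCrossing_iff]
        refine ⟨hTd a ha, hTd b hb, ?_⟩
        change (T a < T b ∧ f (T b) < f (T a)) ∨ (T b < T a ∧ f (T a) < f (T b))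
        change (a < b ↔ T a < T b) ∧ (b < a ↔ T b < T a) at c
        clear hc
        omega
      · have e : s (a, b) = (a, b) := if_neg c
        rw [e, isLiftedCrossing_iff]
        refine ⟨ha, hb, ?_⟩
        change (a < b ∧ f b < f a) ∨ (b < a ∧ f a < f b)
        change ¬ ((a < b ↔ T a < T b) ∧ (b < a ↔ T b < T a)) at c
        have ca := hTc a
        have cb := hTc b
        have da := hTdist a
        have db := hTdist b
        have ne : T a = T b → a = b := fun e => by rw [← hTT a, e, hTT]
        rw [isLiftedCrossing_iff] at ca cb
        have ca' : T a = a ∨ ((a < T a ∧ f (T a) < f a) ∨ (T a < a ∧ f a < f (T a))) :=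
          ca.imp id fun h => h.2.2
        have cb' : T b = b ∨ ((b < T b ∧ f (T b) < f b) ∨ (T b < b ∧ f b < f (T b))) :=
          cb.imp id fun h => h.2.2
        have ea : T a = a → f (T a) = f a := fun e => by rw [e]
        have eb : T b = b → f (T b) = f b := fun e => by rw [e]
        clear ca cb hc e hx S_inj S_mk
        clear hS
        clear S s_s s_symm s_smul
        clear hs
        clear s same_symm same_smul
        clear hsame
        clear same
        clear hTT hTd hTc hTs hTdist hTi hTj
        clear hT
        generalize f (T a) = fta at *
        generalize f (T b) = ftb at *
        generalize f a = fa at *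
        generalize f b = fb at *
        generalize T a = ta at *
        generalize T b = tb at *
        rw [abs_eq_abs] at da db
        omega
    · rintro (e : S c = pairClass m i j)
      have : c = pairClass m i j := S_inj (e.trans hx.symm)
      rw [this, mem_crossings_iff, isLiftedCrossing_iff] at hc
      have h1 : f.resolve i j h i = f j := by
        change f (swapAt m i j i) = f j
        rw [← hT, hTi]
      have h2 : f.resolve i j h j = f i := by
        change f (swapAt m i j j) = f i
        rw [← hT, hTj]
      rw [h1, h2] at hc
      have := (isLiftedCrossing_iff.1 h).2.2
      omega
  have hle := Set.ncard_le_ncard sub (f.crossings_finite.subset Set.sdiff_subset)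
  rw [Set.ncard_image_of_injective _ S_inj] at hle
  have := Set.ncard_sdiff_singleton_add_one (mem_crossings_iff.2 h) f.crossings_finite
  unfold cross
  omega

theorem cross_resolveAt (f : LiftedPartialPerm m k) (c : f.crossings) :
    (f.resolveAt c).cross + 1 ≤ f.cross := cross_resolve _

theorem twiceWeight_resolveAt (f : LiftedPartialPerm m k) (c : f.crossings) :
    EvenLE (f.resolveAt c).twiceWeight f.twiceWeight := twiceWeight_resolve _

theorem resolveAt_dom (f : LiftedPartialPerm m k) (c : f.crossings) :
    (f.resolveAt c).dom = f.dom := rfl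

theorem resolveAt_image (f : LiftedPartialPerm m k) (c : f.crossings) :
    f.resolveAt c '' (f.resolveAt c).dom = f '' f.dom := by
  obtain ⟨c, hc⟩ := c
  obtain ⟨i, j, rfl⟩ := pairClass_cases c
  rw [resolveAt_eq]
  have h := mem_crossings_iff.1 hc
  ext x
  constructor
  · rintro ⟨n, hn, rfl⟩
    exact ⟨swapAt m i j n, swapAt_mem_dom h.1 h.2.1 h.swappable hn, rfl⟩
  · rintro ⟨n, hn, rfl⟩
    refine ⟨swapAt m i j n, swapAt_mem_dom h.1 h.2.1 h.swappable hn, ?_⟩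
    change f (swapAt m i j (swapAt m i j n)) = f n
    rw [swapAt_swapAt h.swappable]

theorem Composable.resolve_right {g f : LiftedPartialPerm m k} (h : Composable g f)
    (c : f.crossings) : Composable g (f.resolveAt c) := by
  unfold Composable
  rw [resolveAt_image]; exact h

theorem composable_resolve_right_iff {g f : LiftedPartialPerm m k} (c : f.crossings) :
    Composable g (f.resolveAt c) ↔ Composable g f := by
  unfold Composable
  rw [resolveAt_image]

theorem Composable.resolve_left {g f : LiftedPartialPerm m k} (h : Composable g f)
    (c : g.crossings) : Composable (g.resolveAt c) f := h

theorem composable_resolve_left_iff {g f : LiftedPartialPerm m k} (c : g.crossings) :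
    Composable (g.resolveAt c) f ↔ Composable g f := Iff.rfl

theorem comp_resolve_right {g f : LiftedPartialPerm m k} (h : Composable g f) {c : PairClass m}
    (hc : c ∈ f.crossings) (hc' : c ∈ (comp g f h).crossings) :
    comp g (f.resolveAt ⟨c, hc⟩) (h.resolve_right _) =
      (comp g f h).resolveAt ⟨c, hc'⟩ := by
  obtain ⟨i, j, rfl⟩ := pairClass_cases c
  refine ext_on rfl fun n (hn : n ∈ f.dom) => ?_
  rw [comp_apply (h.resolve_right _) hn, resolveAt_eq, resolveAt_eq]
  change g (f (swapAt m i j n)) = (comp g f h) (swapAt m i j n)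
  have hx := mem_crossings_iff.1 hc
  rw [comp_apply h (swapAt_mem_dom hx.1 hx.2.1 hx.swappable hn)]

theorem map_swapAt {f : LiftedPartialPerm m k} {i j : ℤ} (hi : i ∈ f.dom) (hj : j ∈ f.dom)
    (hs : Swappable m i j) (hs' : Swappable m (f i) (f j)) {n : ℤ} (hn : n ∈ f.dom) :
    swapAt m (f i) (f j) (f n) = f (swapAt m i j n) := by
  rcases swapAt_cases m i j n with ⟨γ, hγ, rfl⟩ | ⟨γ, hγ, rfl⟩ | ⟨h, h'⟩
  · rw [swapAt_left hγ, f.map_smul hγ, swapAt_left hγ, f.map_smul hγ]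
  · rw [swapAt_right hs hγ, f.map_smul hγ, swapAt_right hs' hγ, f.map_smul hγ]
  · rw [swapAt_other h h']
    refine swapAt_other ?_ ?_
    · rintro ⟨γ, hγ, e⟩; exact h ⟨γ, hγ, (f.eq_of_map_eq hγ hi hn e.symm).symm⟩
    · rintro ⟨γ, hγ, e⟩; exact h' ⟨γ, hγ, (f.eq_of_map_eq hγ hj hn e.symm).symm⟩

theorem swappable_of_map {f : LiftedPartialPerm m k} {i j : ℤ} (hi : i ∈ f.dom) (hj : j ∈ f.dom)
    (hs' : Swappable m (f i) (f j)) : Swappable m i j := by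
  intro γ hγ e
  exact (f.eq_of_map_eq hγ hj hi (hs' γ hγ (by rw [← f.map_smul hγ, e])).symm).symm

theorem comp_resolve_left {g f : LiftedPartialPerm m k} (h : Composable g f) {c : PairClass m}
    (hc : f.classMap c ∈ g.crossings) (hp : c ∈ pulledCrossings g f)
    (hc' : c ∈ (comp g f h).crossings) :
    comp (g.resolveAt ⟨f.classMap c, hc⟩) f (h.resolve_left _) = (comp g f h).resolveAt ⟨c, hc'⟩ := by
  obtain ⟨i, j, rfl⟩ := pairClass_cases c
  refine ext_on rfl fun n (hn : n ∈ f.dom) => ?_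
  obtain ⟨hi, hj, hx⟩ := mem_pulledCrossings.1 hp
  rw [comp_apply (h.resolve_left _) hn, resolveAt_eq]
  have e := resolveAt_eq (f := g) (i := f i) (j := f j) hc
  change g.resolveAt ⟨pairClass m (f i) (f j), hc⟩ (f n) = (comp g f h) (swapAt m i j n)
  have hs := swappable_of_map hi hj hx.swappable
  rw [e, comp_apply h (swapAt_mem_dom hi hj hs hn)]
  change g (swapAt m (f i) (f j) (f n)) = _
  rw [map_swapAt hi hj hs hx.swappable hn]

theorem comp_resolve_left_right {g f : LiftedPartialPerm m k} (h : Composable g f) {c : PairClass m}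
    (hc : f.classMap c ∈ g.crossings) (hp : c ∈ pulledCrossings g f) (hc' : c ∈ f.crossings) :
    comp (g.resolveAt ⟨f.classMap c, hc⟩) f (h.resolve_left _) =
      comp g (f.resolveAt ⟨c, hc'⟩) (h.resolve_right _) := by
  obtain ⟨i, j, rfl⟩ := pairClass_cases c
  refine ext_on rfl fun n (hn : n ∈ f.dom) => ?_
  obtain ⟨hi, hj, hx⟩ := mem_pulledCrossings.1 hp
  rw [comp_apply (h.resolve_left _) hn, comp_apply (h.resolve_right _) hn, resolveAt_eq]
  have e := resolveAt_eq (f := g) (i := f i) (j := f j) hc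
  change g.resolveAt ⟨pairClass m (f i) (f j), hc⟩ (f n) = g (f (swapAt m i j n))
  have hs := swappable_of_map hi hj hx.swappable
  rw [e]
  change g (swapAt m (f i) (f j) (f n)) = _
  rw [map_swapAt hi hj hs hx.swappable hn]

end LiftedPartialPerm

end Pong

namespace Pong

section positions

variable {m : ℕ}

theorem exists_translation (m : ℕ) (n : ℤ) : ∃ γ ∈ wallGroup m, ∀ x, γ x = x + (2 * m - 2) * n := by
  have h1 : Equiv.subLeft (1 : ℤ) ∈ wallGroup m := Subgroup.subset_closure (Or.inl rfl)
  have h2 : Equiv.subLeft (2 * (m : ℤ) - 1) ∈ wallGroup m := Subgroup.subset_closure (Or.inr rfl)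
  induction n using Int.induction_on with
  | zero => exact ⟨1, (wallGroup m).one_mem, fun x => by simp⟩
  | succ n ih =>
    obtain ⟨γ, hγ, h⟩ := ih
    refine ⟨Equiv.subLeft (2 * (m : ℤ) - 1) * (Equiv.subLeft 1 * γ),
      (wallGroup m).mul_mem h2 ((wallGroup m).mul_mem h1 hγ), fun x => ?_⟩
    simp only [Equiv.Perm.mul_apply, Equiv.subLeft_apply, h]; ring
  | pred n ih =>
    obtain ⟨γ, hγ, h⟩ := ih
    refine ⟨Equiv.subLeft 1 * (Equiv.subLeft (2 * (m : ℤ) - 1) * γ),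
      (wallGroup m).mul_mem h1 ((wallGroup m).mul_mem h2 hγ), fun x => ?_⟩
    simp only [Equiv.Perm.mul_apply, Equiv.subLeft_apply, h]; ring

theorem exists_pos_eq [m.AtLeastTwo] (i : ℤ) : ∃ r ∈ Set.Icc (1 : ℤ) (m - 1), pos m r = pos m i := by
  have hm : 2 ≤ m := Nat.AtLeastTwo.prop
  obtain ⟨γ, hγ, h⟩ := exists_translation m ((i - 1) / (2 * m - 2))
  have hd := Int.mul_ediv_add_emod (i - 1) (2 * m - 2)
  have h0 := Int.emod_nonneg (i - 1) (show (2 * (m : ℤ) - 2) ≠ 0 by omega)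
  have h1 := Int.emod_lt_of_pos (i - 1) (show 0 < (2 * (m : ℤ) - 2) by omega)
  generalize (2 * (m : ℤ) - 2) * ((i - 1) / (2 * m - 2)) = q at h hd
  generalize (i - 1) % (2 * (m : ℤ) - 2) = r at h0 h1 hd
  by_cases hr : r + 1 ≤ m - 1
  · refine ⟨r + 1, ⟨by omega, hr⟩, pos_eq_iff.2 ⟨γ, hγ, ?_⟩⟩
    rw [h]; omega
  · refine ⟨2 * m - 1 - (r + 1), ⟨by omega, by omega⟩, pos_eq_iff.2
      ⟨γ * Equiv.subLeft (2 * (m : ℤ) - 1), (wallGroup m).mul_mem hγ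
        (Subgroup.subset_closure (Or.inr rfl)), ?_⟩⟩
    rw [Equiv.Perm.mul_apply, Equiv.subLeft_apply, h]; omega

theorem pos_injOn (m : ℕ) : Set.InjOn (pos m) (Set.Icc (1 : ℤ) (m - 1)) := by
  intro i hi j hj hij
  rw [Set.mem_Icc] at hi hj
  obtain ⟨γ, hγ, h⟩ := pos_eq_iff.1 hij
  rcases wallGroup_form hγ with ⟨n, hn⟩ | ⟨n, hn⟩
  · rw [hn] at h
    rcases lt_trichotomy n 0 with h' | h' | h'
    · exfalso; nlinarith
    · rw [h'] at h; omega
    · exfalso; nlinarith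
  · rw [hn] at h
    exfalso
    rcases lt_trichotomy n 0 with h' | h' | h'
    · nlinarith
    · rw [h'] at h; omega
    · nlinarith

theorem pos_image_univ [m.AtLeastTwo] : pos m '' Set.Icc (1 : ℤ) (m - 1) = Set.univ := by
  refine Set.eq_univ_of_forall fun p => ?_
  induction p using Quotient.inductionOn with
  | h i =>
    obtain ⟨r, hr, h⟩ := exists_pos_eq (m := m) i
    exact ⟨r, hr, h⟩

/-- There are `m - 1` positions. -/
theorem encard_position [m.AtLeastTwo] : (Set.univ : Set (Position m)).encard = (m - 1 : ℕ) := by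
  have hm : 2 ≤ m := Nat.AtLeastTwo.prop
  rw [← pos_image_univ, (pos_injOn m).encard_image, ← Set.coe_fintypeCard, Fintype.card_ofFinset,
    Int.card_Icc]
  congr 1
  omega

instance finite_position [m.AtLeastTwo] : Finite (Position m) := by
  rw [← Set.finite_univ_iff, ← Set.encard_ne_top_iff, encard_position]
  exact ENat.natCast_ne_top _

end positions

namespace LiftedPartialPerm

variable {m k : ℕ}

/-- The idempotents: the lifted partial permutations that fix every element of their domain. -/
def IsIdempotent (e : LiftedPartialPerm m k) : Prop := ∀ i, e i = i

theorem finite_idempotents (m k : ℕ) [m.AtLeastTwo] :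
    {e : LiftedPartialPerm m k | e.IsIdempotent}.Finite := by
  refine Set.Finite.of_injOn (f := fun e => pos m '' e.dom) (t := Set.univ)
    (fun _ _ => Set.mem_univ _) ?_ Set.finite_univ
  intro e he e' he' h
  have key : ∀ e e' : LiftedPartialPerm m k, pos m '' e.dom = pos m '' e'.dom → e.dom ⊆ e'.dom := by
    intro e e' h i hi
    obtain ⟨j, hj, hij⟩ : pos m i ∈ pos m '' e'.dom := by rw [← h]; exact ⟨i, hi, rfl⟩
    obtain ⟨γ, hγ, rfl⟩ := pos_eq_iff.1 hij
    exact e'.dom_invariant γ hγ j hj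
  refine ext_on ((key e e' h).antisymm (key e' e h.symm)) fun i _ => ?_
  rw [he i, he' i]

theorem card_image (f : LiftedPartialPerm m k) : (pos m '' (f '' f.dom)).encard = k := by
  set F : Position m → Position m := Quotient.map f (by
    intro i j h
    have h' : pos m i = pos m j := Quotient.sound h
    obtain ⟨γ, hγ, rfl⟩ := pos_eq_iff.1 h'
    rw [f.map_smul hγ]
    exact Quotient.exact (pos_eq_iff.2 ⟨γ, hγ, rfl⟩ : pos m (f i) = pos m (γ (f i))))
  have hF : ∀ i, F (pos m i) = pos m (f i) := fun i => rfl
  have : pos m '' (f '' f.dom) = F '' (pos m '' f.dom) := by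
    rw [Set.image_image, Set.image_image]
    exact Set.image_congr fun i _ => (hF i).symm
  rw [this, Set.InjOn.encard_image, f.card_orbits]
  rintro _ ⟨i, hi, rfl⟩ _ ⟨j, hj, rfl⟩ h
  exact f.injective_orbits i hi j hj h

/-- The idempotent with the given domain. -/
def idempotent (S : Set ℤ) (hS : ∀ γ ∈ wallGroup m, ∀ i ∈ S, γ i ∈ S)
    (hk : (pos m '' S).encard = k) : LiftedPartialPerm m k where
  dom := S
  toFun i := i
  dom_invariant := hS
  equivariant _ _ _ _ := rfl
  card_orbits := hk
  injective_orbits _ _ _ _ h := h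
  map_outside _ _ := rfl

theorem IsIdempotent.twiceWeight {e : LiftedPartialPerm m k} (he : e.IsIdempotent) :
    e.twiceWeight = 0 := by
  funext l
  have : e.strandsAcross ((l : ℕ) : ℤ) = ∅ := by
    refine Set.eq_empty_of_forall_notMem ?_
    rintro i ⟨-, h⟩
    rw [he i] at h
    omega
  rw [LiftedPartialPerm.twiceWeight, this, Set.ncard_empty]; rfl

theorem IsIdempotent.cross {e : LiftedPartialPerm m k} (he : e.IsIdempotent) : e.cross = 0 := by
  have : e.crossings = ∅ := by
    refine Set.eq_empty_of_forall_notMem ?_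
    rintro _ ⟨i, j, h, rfl⟩
    have := (isLiftedCrossing_iff.1 h).2.2
    rw [he i, he j] at this
    omega
  rw [LiftedPartialPerm.cross, this, Set.ncard_empty]

theorem IsIdempotent.comp_left {e f : LiftedPartialPerm m k} (he : e.IsIdempotent)
    (h : Composable e f) : comp e f h = f :=
  ext_on rfl fun i (hi : i ∈ f.dom) => by rw [comp_apply h hi, he]

theorem IsIdempotent.comp_right {e f : LiftedPartialPerm m k} (he : e.IsIdempotent)
    (h : Composable f e) : comp f e h = f := by
  have hd : f.dom = e.dom := by
    have h' : f.dom = e '' e.dom := h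
    rw [h', Set.image_congr (fun i _ => he i), Set.image_id']
  refine ext_on hd.symm fun i (hi : i ∈ e.dom) => ?_
  rw [comp_apply h hi, he]

theorem comp_image {g f : LiftedPartialPerm m k} (h : Composable g f) :
    comp g f h '' (comp g f h).dom = g '' g.dom := by
  have h' : g.dom = f '' f.dom := h
  rw [comp_dom, Set.image_congr (fun i hi => comp_apply h hi), ← Set.image_image g, ← h']

theorem comp_assoc {h g f : LiftedPartialPerm m k} (hg : Composable h g) (gf : Composable g f)
    (h1 : Composable (comp h g hg) f) (h2 : Composable h (comp g f gf)) :
    comp (comp h g hg) f h1 = comp h (comp g f gf) h2 := by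
  refine ext_on rfl fun i (hi : i ∈ f.dom) => ?_
  rw [comp_apply h1 hi, comp_apply hg (gf.mem hi), comp_apply h2 hi, comp_apply gf hi]

end LiftedPartialPerm

end Pong

namespace Pong

open LiftedPartialPerm

/-- The base ring `𝔽₂[v_1, …, v_m]`; the variable `X l` is `v_{l+1}`. -/
abbrev BaseRing (m : ℕ) : Type := MvPolynomial (Fin m) (ZMod 2)

/-- The monomial of weight `(w - w') / 2`. -/
noncomputable def weightMonomial {m : ℕ} (w w' : Fin m → ℕ) : BaseRing m :=
  ∏ l, MvPolynomial.X l ^ ((w l - w' l) / 2)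

theorem weightMonomial_mul {m : ℕ} {w w' w'' : Fin m → ℕ} (h : EvenLE w' w) (h' : EvenLE w'' w') :
    weightMonomial w w' * weightMonomial w' w'' = weightMonomial w w'' := by
  unfold weightMonomial
  rw [← Finset.prod_mul_distrib]
  refine Finset.prod_congr rfl fun l _ => ?_
  rw [← pow_add]
  congr 1
  obtain ⟨a, ha⟩ := h l
  obtain ⟨b, hb⟩ := h' l
  omega

theorem weightMonomial_add_left {m : ℕ} (u w w' : Fin m → ℕ) :
    weightMonomial (u + w) (u + w') = weightMonomial w w' := by
  unfold weightMonomial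
  refine Finset.prod_congr rfl fun l _ => ?_
  rw [Pi.add_apply, Pi.add_apply, Nat.add_sub_add_left]

theorem weightMonomial_add_right {m : ℕ} (u w w' : Fin m → ℕ) :
    weightMonomial (w + u) (w' + u) = weightMonomial w w' := by
  rw [add_comm w, add_comm w', weightMonomial_add_left]

theorem weightMonomial_self {m : ℕ} (w : Fin m → ℕ) : weightMonomial w w = 1 := by
  simp [weightMonomial]

theorem EvenLE.add_left {m : ℕ} {w w' : Fin m → ℕ} (u : Fin m → ℕ) (h : EvenLE w' w) :
    EvenLE (u + w') (u + w) := fun l => by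
  obtain ⟨a, ha⟩ := h l
  exact ⟨a, by rw [Pi.add_apply, Pi.add_apply, ha, add_assoc]⟩

theorem EvenLE.add_right {m : ℕ} {w w' : Fin m → ℕ} (u : Fin m → ℕ) (h : EvenLE w' w) :
    EvenLE (w' + u) (w + u) := by
  rw [add_comm w', add_comm w]; exact h.add_left u

theorem EvenLE.trans {m : ℕ} {w w' w'' : Fin m → ℕ} (h : EvenLE w'' w') (h' : EvenLE w' w) :
    EvenLE w'' w := fun l => by
  obtain ⟨a, ha⟩ := h l
  obtain ⟨b, hb⟩ := h' l
  exact ⟨a + b, by rw [hb, ha]; ring⟩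

theorem EvenLE.refl {m : ℕ} (w : Fin m → ℕ) : EvenLE w w := fun _ => ⟨0, rfl⟩

/-- The pong algebra with `m` walls and `k` strands: the free module over `𝔽₂[v_1, …, v_m]` on the
lifted partial permutations on `k` letters. -/
def PongAlgebra (m k : ℕ) : Type := LiftedPartialPerm m k →₀ BaseRing m

namespace PongAlgebra

variable {m k : ℕ}

noncomputable instance : AddCommGroup (PongAlgebra m k) :=
  inferInstanceAs (AddCommGroup (LiftedPartialPerm m k →₀ BaseRing m))

noncomputable instance : Module (BaseRing m) (PongAlgebra m k) :=
  inferInstanceAs (Module (BaseRing m) (LiftedPartialPerm m k →₀ BaseRing m))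

/-- The pure algebra element of a lifted partial permutation. -/
noncomputable def pure (f : LiftedPartialPerm m k) : PongAlgebra m k :=
  Finsupp.single (M := BaseRing m) f 1

/-- The linear map with given values on the pure algebra elements. -/
noncomputable def lift {M : Type} [AddCommGroup M] [Module (BaseRing m) M]
    (v : LiftedPartialPerm m k → M) : PongAlgebra m k →ₗ[BaseRing m] M :=
  Finsupp.linearCombination (BaseRing m) v

theorem lift_pure {M : Type} [AddCommGroup M] [Module (BaseRing m) M]
    (v : LiftedPartialPerm m k → M) (f : LiftedPartialPerm m k) : lift v (pure f) = v f :=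
  (Finsupp.linearCombination_single (BaseRing m) (1 : BaseRing m) f).trans (one_smul _ _)

theorem induction {p : PongAlgebra m k → Prop} (zero : p 0) (add : ∀ a b, p a → p b → p (a + b))
    (smul : ∀ (r : BaseRing m) f, p (r • pure f)) (a : PongAlgebra m k) : p a := by
  refine Finsupp.induction_linear (motive := p) a zero (fun a b => add a b) fun f r => ?_
  have : (Finsupp.single f r : LiftedPartialPerm m k →₀ BaseRing m) = r • Finsupp.single f 1 := by
    rw [Finsupp.smul_single, smul_eq_mul, mul_one]
  rw [this]
  exact smul r f

theorem add_self (a : PongAlgebra m k) : a + a = 0 := by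
  have h : (2 : BaseRing m) = 0 := CharTwo.two_eq_zero
  rw [← two_smul (BaseRing m) a, h, zero_smul]

open Classical in
/-- The element `v • f` of weight `w / 2`, with `v` a monomial, if `f` has crossing number `n`, and
zero otherwise. -/
noncomputable def term (w : Fin m → ℕ) (n : ℕ) (f : LiftedPartialPerm m k) : PongAlgebra m k :=
  if f.cross = n then weightMonomial w f.twiceWeight • pure f else 0

open Classical in
/-- The product of two pure algebra elements: it is `v • (g ∘ f)`, where the monomial `v` makes the
weight additive, if the composition is defined and the crossing number is additive,
and zero otherwise. -/
noncomputable def pureMul (g f : LiftedPartialPerm m k) : PongAlgebra m k :=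
  if h : Composable g f then term (g.twiceWeight + f.twiceWeight) (g.cross + f.cross) (comp g f h)
  else 0

/-- The bilinear product of the pong algebra. -/
noncomputable def mulHom :
    PongAlgebra m k →ₗ[BaseRing m] PongAlgebra m k →ₗ[BaseRing m] PongAlgebra m k :=
  lift fun g => lift fun f => pureMul g f

noncomputable instance : Mul (PongAlgebra m k) := ⟨fun a b => mulHom a b⟩

theorem mul_def (a b : PongAlgebra m k) : a * b = mulHom a b := rfl

theorem pure_mul_pure (g f : LiftedPartialPerm m k) : pure g * pure f = pureMul g f := by
  rw [mul_def, mulHom, lift_pure, lift_pure]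

protected theorem smul_mul (r : BaseRing m) (a b : PongAlgebra m k) : (r • a) * b = r • (a * b) := by
  rw [mul_def, mul_def, LinearMap.map_smul, LinearMap.smul_apply]

protected theorem mul_smul (r : BaseRing m) (a b : PongAlgebra m k) : a * (r • b) = r • (a * b) := by
  rw [mul_def, mul_def, LinearMap.map_smul]

protected theorem add_mul (a b c : PongAlgebra m k) : (a + b) * c = a * c + b * c := by
  rw [mul_def, mul_def, mul_def, LinearMap.map_add, LinearMap.add_apply]

protected theorem mul_add (a b c : PongAlgebra m k) : a * (b + c) = a * b + a * c := by
  rw [mul_def, mul_def, mul_def, LinearMap.map_add]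

protected theorem zero_mul (a : PongAlgebra m k) : 0 * a = 0 := by
  rw [mul_def, LinearMap.map_zero, LinearMap.zero_apply]

protected theorem mul_zero (a : PongAlgebra m k) : a * 0 = 0 := by
  rw [mul_def, LinearMap.map_zero]

theorem pure_mul_term {g f : LiftedPartialPerm m k} {w : Fin m → ℕ} {n : ℕ} (h : Composable g f)
    (hn : f.cross ≤ n) (hw : EvenLE f.twiceWeight w) :
    pure g * term w n f = term (g.twiceWeight + w) (g.cross + n) (comp g f h) := by
  have hle := cross_comp_le h
  unfold term
  by_cases h1 : f.cross = n
  · rw [if_pos h1, PongAlgebra.mul_smul, pure_mul_pure, pureMul, dif_pos h, term, h1]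
    split_ifs
    · rw [smul_smul, ← weightMonomial_add_left g.twiceWeight w,
        weightMonomial_mul (hw.add_left _) (twiceWeight_comp h)]
    · rw [smul_zero]
  · rw [if_neg h1, PongAlgebra.mul_zero, if_neg (by omega)]

theorem term_mul_pure {g f : LiftedPartialPerm m k} {w : Fin m → ℕ} {n : ℕ} (h : Composable g f)
    (hn : g.cross ≤ n) (hw : EvenLE g.twiceWeight w) :
    term w n g * pure f = term (w + f.twiceWeight) (n + f.cross) (comp g f h) := by
  have hle := cross_comp_le h
  unfold term
  by_cases h1 : g.cross = n
  · rw [if_pos h1, PongAlgebra.smul_mul, pure_mul_pure, pureMul, dif_pos h, term, h1]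
    split_ifs
    · rw [smul_smul, ← weightMonomial_add_right f.twiceWeight w,
        weightMonomial_mul (hw.add_right _) (twiceWeight_comp h)]
    · rw [smul_zero]
  · rw [if_neg h1, PongAlgebra.zero_mul, if_neg (by omega)]

theorem pure_mul_term_of_not {g f : LiftedPartialPerm m k} {w : Fin m → ℕ} {n : ℕ}
    (h : ¬ Composable g f) : pure g * term w n f = 0 := by
  unfold term
  split_ifs
  · rw [PongAlgebra.mul_smul, pure_mul_pure, pureMul, dif_neg h, smul_zero]
  · exact PongAlgebra.mul_zero _

theorem term_mul_pure_of_not {g f : LiftedPartialPerm m k} {w : Fin m → ℕ} {n : ℕ}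
    (h : ¬ Composable g f) : term w n g * pure f = 0 := by
  unfold term
  split_ifs
  · rw [PongAlgebra.smul_mul, pure_mul_pure, pureMul, dif_neg h, smul_zero]
  · exact PongAlgebra.zero_mul _

theorem pure_mul_assoc (h g f : LiftedPartialPerm m k) :
    pure h * pure g * pure f = pure h * (pure g * pure f) := by
  rw [pure_mul_pure, pure_mul_pure, pureMul, pureMul]
  by_cases A : Composable h g <;> by_cases B : Composable g f
  · have h1 : Composable (comp h g A) f := B
    have h2 : Composable h (comp g f B) := by
      unfold Composable; rw [comp_image]; exact A
    rw [dif_pos A, dif_pos B, term_mul_pure h1 (cross_comp_le A) (twiceWeight_comp A),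
      pure_mul_term h2 (cross_comp_le B) (twiceWeight_comp B), add_assoc, add_assoc,
      comp_assoc A B h1 h2]
  · have h1 : ¬ Composable (comp h g A) f := B
    rw [dif_pos A, dif_neg B, term_mul_pure_of_not h1, PongAlgebra.mul_zero]
  · have h2 : ¬ Composable h (comp g f B) := by
      unfold Composable; rw [comp_image]; exact A
    rw [dif_neg A, dif_pos B, pure_mul_term_of_not h2, PongAlgebra.zero_mul]
  · rw [dif_neg A, dif_neg B, PongAlgebra.zero_mul, PongAlgebra.mul_zero]

protected theorem mul_assoc (a b c : PongAlgebra m k) : a * b * c = a * (b * c) := by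
  induction a using PongAlgebra.induction with
  | zero => simp only [PongAlgebra.zero_mul]
  | add x y hx hy => simp only [PongAlgebra.add_mul, hx, hy]
  | smul r h =>
    induction b using PongAlgebra.induction with
    | zero => simp only [PongAlgebra.zero_mul, PongAlgebra.mul_zero]
    | add x y hx hy => simp only [PongAlgebra.add_mul, PongAlgebra.mul_add, hx, hy]
    | smul s g =>
      induction c using PongAlgebra.induction with
      | zero => simp only [PongAlgebra.mul_zero]
      | add x y hx hy => simp only [PongAlgebra.mul_add, hx, hy]
      | smul t f => simp only [PongAlgebra.smul_mul, PongAlgebra.mul_smul, pure_mul_assoc]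

/-- The unit: the sum of all idempotents. -/
noncomputable instance [m.AtLeastTwo] : One (PongAlgebra m k) :=
  ⟨∑ e ∈ (finite_idempotents m k).toFinset, pure e⟩

theorem one_def [m.AtLeastTwo] :
    (1 : PongAlgebra m k) = ∑ e ∈ (finite_idempotents m k).toFinset, pure e := rfl

theorem one_mul_pure [m.AtLeastTwo] (f : LiftedPartialPerm m k) : 1 * pure f = pure f := by
  obtain ⟨e₀, he₀, hd⟩ : ∃ e₀ : LiftedPartialPerm m k, e₀.IsIdempotent ∧ Composable e₀ f :=
    ⟨idempotent (f '' f.dom) (fun γ hγ i hi => f.image_dom_invariant hγ hi) f.card_image,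
      fun _ => rfl, rfl⟩
  rw [one_def, mul_def, map_sum, LinearMap.sum_apply, Finset.sum_eq_single e₀]
  · rw [← mul_def, pure_mul_pure, pureMul, dif_pos hd, he₀.comp_left, he₀.twiceWeight, he₀.cross,
      zero_add, zero_add, term, if_pos rfl, weightMonomial_self, one_smul]
  · intro e he hne
    have he' : e.IsIdempotent := (Set.Finite.mem_toFinset _).1 he
    rw [← mul_def, pure_mul_pure, pureMul, dif_neg]
    intro h
    have h1 : e.dom = f '' f.dom := h
    have h2 : e₀.dom = f '' f.dom := hd
    exact hne (ext_on (h1.trans h2.symm) fun i _ => by rw [he' i, he₀ i])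
  · intro h
    exact absurd ((Set.Finite.mem_toFinset _).2 he₀) h

theorem pure_mul_one [m.AtLeastTwo] (f : LiftedPartialPerm m k) : pure f * 1 = pure f := by
  have key : ∀ e : LiftedPartialPerm m k, e.IsIdempotent → (Composable f e ↔ e.dom = f.dom) := by
    intro e he
    unfold Composable
    rw [Set.image_congr (fun i _ => he i), Set.image_id', eq_comm]
  obtain ⟨e₀, he₀, hd⟩ : ∃ e₀ : LiftedPartialPerm m k, e₀.IsIdempotent ∧ e₀.dom = f.dom :=
    ⟨idempotent f.dom f.dom_invariant f.card_orbits, fun _ => rfl, rfl⟩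
  rw [one_def, mul_def, map_sum, Finset.sum_eq_single e₀]
  · rw [← mul_def, pure_mul_pure, pureMul, dif_pos ((key e₀ he₀).2 hd), he₀.comp_right,
      he₀.twiceWeight, he₀.cross, add_zero, add_zero, term, if_pos rfl, weightMonomial_self,
      one_smul]
  · intro e he hne
    have he' : e.IsIdempotent := (Set.Finite.mem_toFinset _).1 he
    rw [← mul_def, pure_mul_pure, pureMul, dif_neg]
    rw [key e he']
    intro h1
    exact hne (ext_on (h1.trans hd.symm) fun i _ => by rw [he' i, he₀ i])
  · intro h
    exact absurd ((Set.Finite.mem_toFinset _).2 he₀) h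

noncomputable instance [m.AtLeastTwo] : Ring (PongAlgebra m k) :=
  { (inferInstance : AddCommGroup (PongAlgebra m k)),
    (inferInstance : Mul (PongAlgebra m k)),
    (inferInstance : One (PongAlgebra m k)) with
    left_distrib := PongAlgebra.mul_add
    right_distrib := PongAlgebra.add_mul
    zero_mul := PongAlgebra.zero_mul
    mul_zero := PongAlgebra.mul_zero
    mul_assoc := PongAlgebra.mul_assoc
    one_mul := fun a => by
      induction a using PongAlgebra.induction with
      | zero => exact PongAlgebra.mul_zero _
      | add x y hx hy => rw [PongAlgebra.mul_add, hx, hy]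
      | smul r f => rw [PongAlgebra.mul_smul, one_mul_pure]
    mul_one := fun a => by
      induction a using PongAlgebra.induction with
      | zero => exact PongAlgebra.zero_mul _
      | add x y hx hy => rw [PongAlgebra.add_mul, hx, hy]
      | smul r f => rw [PongAlgebra.smul_mul, pure_mul_one] }

noncomputable instance [m.AtLeastTwo] : Algebra (BaseRing m) (PongAlgebra m k) :=
  Algebra.ofModule PongAlgebra.smul_mul PongAlgebra.mul_smul

noncomputable instance [m.AtLeastTwo] : Algebra (ZMod 2) (PongAlgebra m k) :=
  Algebra.compHom _ (algebraMap (ZMod 2) (BaseRing m))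

noncomputable instance (f : LiftedPartialPerm m k) : Fintype f.crossings :=
  f.crossings_finite.fintype

/-- The differential of a pure algebra element: the sum of `v • f_c` over the crossings `c` of `f`
such that the crossing number of `f_c` is one less than that of `f`, where the monomial `v` makes
the weights of `v • f_c` and `f` equal. -/
noncomputable def pureD (f : LiftedPartialPerm m k) : PongAlgebra m k :=
  ∑ c : f.crossings, term f.twiceWeight (f.cross - 1) (f.resolveAt c)

/-- The differential of the pong algebra. -/
noncomputable def d : PongAlgebra m k →ₗ[BaseRing m] PongAlgebra m k := lift pureD

theorem d_pure (f : LiftedPartialPerm m k) : d (pure f) = pureD f := lift_pure _ _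

theorem d_term {f : LiftedPartialPerm m k} {w : Fin m → ℕ} {n : ℕ} (hn : f.cross ≤ n)
    (hw : EvenLE f.twiceWeight w) :
    d (term w n f) = ∑ c : f.crossings, term w (n - 1) (f.resolveAt c) := by
  by_cases h : f.cross = n
  · rw [term, if_pos h, LinearMap.map_smul, d_pure, pureD, Finset.smul_sum]
    refine Finset.sum_congr rfl fun c _ => ?_
    rw [h]
    unfold term
    split_ifs
    · rw [smul_smul, weightMonomial_mul hw (twiceWeight_resolveAt f c)]
    · rw [smul_zero]
  · rw [term, if_neg h, LinearMap.map_zero]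
    refine (Finset.sum_eq_zero fun c _ => ?_).symm
    have := cross_resolveAt f c
    rw [term, if_neg (by omega)]

theorem sum_eq_add_of_symmDiff {α M : Type} [AddCommGroup M] (h2 : ∀ x : M, x + x = 0)
    (A B C : Set α) [Fintype A] [Fintype B] [Fintype C]
    (h : ∀ x, x ∈ C ↔ (x ∈ A ∧ x ∉ B) ∨ (x ∈ B ∧ x ∉ A)) (t : α → M) :
    ∑ x : C, t x = ∑ x : A, t x + ∑ x : B, t x := by
  classical
  rw [Finset.sum_set_coe, Finset.sum_set_coe, Finset.sum_set_coe]
  have e : C.toFinset = (A.toFinset \ B.toFinset) ∪ (B.toFinset \ A.toFinset) := by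
    ext x; simp [h]
  have hd : Disjoint (A.toFinset \ B.toFinset) (B.toFinset \ A.toFinset) := by
    rw [Finset.disjoint_left]
    intro x hx hx'
    rw [Finset.mem_sdiff] at hx hx'
    exact hx.2 hx'.1
  rw [e, Finset.sum_union hd, ← Finset.sum_inter_add_sum_sdiff A.toFinset B.toFinset t,
    ← Finset.sum_inter_add_sum_sdiff B.toFinset A.toFinset t, Finset.inter_comm B.toFinset]
  have := h2 (∑ x ∈ A.toFinset ∩ B.toFinset, t x)
  generalize (∑ x ∈ A.toFinset ∩ B.toFinset, t x) = z at *
  generalize (∑ x ∈ A.toFinset \ B.toFinset, t x) = x at *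
  generalize (∑ x ∈ B.toFinset \ A.toFinset, t x) = y at *
  calc x + y = (z + z) + (x + y) := by rw [this, zero_add]
    _ = _ := by abel

theorem classMap_mem {g f : LiftedPartialPerm m k} {c : PairClass m}
    (hc : c ∈ pulledCrossings g f) : f.classMap c ∈ g.crossings := by
  obtain ⟨i, j, -, -, -, h⟩ := hc
  exact h

theorem sum_pulledCrossings {M : Type} [AddCommGroup M] {g f : LiftedPartialPerm m k}
    (h : Composable g f) [Fintype (pulledCrossings g f)] (F : g.crossings → M) (t : PairClass m → M)
    (ht : ∀ c (hc : c ∈ pulledCrossings g f), t c = F ⟨f.classMap c, classMap_mem hc⟩) :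
    ∑ c : g.crossings, F c = ∑ c : pulledCrossings g f, t c := by
  let φ : pulledCrossings g f → g.crossings := fun c => ⟨f.classMap c, classMap_mem c.2⟩
  have hφ : Function.Bijective φ := by
    refine ⟨fun c c' e => ?_, ?_⟩
    · exact Subtype.ext (classMap_injOn g f c.2 c'.2 (congrArg Subtype.val e))
    · rintro ⟨c, hc⟩
      have hc' := hc
      rw [← classMap_image h] at hc'
      obtain ⟨x, hx, rfl⟩ := hc'
      exact ⟨⟨x, hx⟩, rfl⟩
  exact (Fintype.sum_bijective φ hφ _ _ fun c => ht c c.2).symm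

theorem d_pure_mul_pure (g f : LiftedPartialPerm m k) :
    d (pure g * pure f) = d (pure g) * pure f + pure g * d (pure f) := by
  classical
  have L : d (pure g) * pure f =
      ∑ c : g.crossings, term g.twiceWeight (g.cross - 1) (g.resolveAt c) * pure f := by
    rw [d_pure, pureD, mul_def, map_sum, LinearMap.sum_apply]; rfl
  have R : pure g * d (pure f) =
      ∑ c : f.crossings, pure g * term f.twiceWeight (f.cross - 1) (f.resolveAt c) := by
    rw [d_pure, pureD, mul_def, map_sum]; rfl
  rw [L, R, pure_mul_pure, pureMul]
  by_cases h : Composable g f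
  · rw [dif_pos h, d_term (cross_comp_le h) (twiceWeight_comp h)]
    obtain ⟨w, hw⟩ : ∃ w, w = g.twiceWeight + f.twiceWeight := ⟨_, rfl⟩
    obtain ⟨n, hn⟩ : ∃ n, n = g.cross + f.cross - 1 := ⟨_, rfl⟩
    rw [← hw, ← hn]
    have L' : ∀ c : g.crossings, term g.twiceWeight (g.cross - 1) (g.resolveAt c) * pure f =
        term w n (comp (g.resolveAt c) f (h.resolve_left c)) := by
      intro c
      have := cross_resolveAt g c
      rw [term_mul_pure (h.resolve_left c) (by omega) (twiceWeight_resolveAt g c), ← hw]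
      congr 1
      omega
    have R' : ∀ c : f.crossings, pure g * term f.twiceWeight (f.cross - 1) (f.resolveAt c) =
        term w n (comp g (f.resolveAt c) (h.resolve_right c)) := by
      intro c
      have := cross_resolveAt f c
      rw [pure_mul_term (h.resolve_right c) (by omega) (twiceWeight_resolveAt f c), ← hw]
      congr 1
      omega
    rw [Finset.sum_congr rfl fun c _ => L' c, Finset.sum_congr rfl fun c _ => R' c]
    obtain ⟨t, tA, tB⟩ : ∃ t : PairClass m → PongAlgebra m k,
        (∀ c : f.crossings, term w n (comp g (f.resolveAt c) (h.resolve_right c)) = t c) ∧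
        (∀ (c : PairClass m) (hp : c ∈ pulledCrossings g f), t c =
          term w n (comp (g.resolveAt ⟨f.classMap c, classMap_mem hp⟩) f (h.resolve_left _))) := by
      refine ⟨fun c =>
        if hc : c ∈ f.crossings then term w n (comp g (f.resolveAt ⟨c, hc⟩) (h.resolve_right _))
        else if hp : c ∈ pulledCrossings g f then
          term w n (comp (g.resolveAt ⟨f.classMap c, classMap_mem hp⟩) f (h.resolve_left _))
        else 0, fun c => ?_, fun c hp => ?_⟩
      · simp only
        rw [dif_pos c.2]
      · by_cases hc : c ∈ f.crossings
        · simp only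
          rw [dif_pos hc, comp_resolve_left_right h (classMap_mem hp) hp hc]
        · simp only
          rw [dif_neg hc, dif_pos hp]
    let _ : Fintype (pulledCrossings g f) := (pulledCrossings_finite h).fintype
    have tC : ∀ c : (comp g f h).crossings, term w n ((comp g f h).resolveAt c) = t c := by
      rintro ⟨c, hc⟩
      rcases (mem_crossings_comp h c).1 hc with h1 | h1
      · rw [← tA ⟨c, h1.1⟩, comp_resolve_right h h1.1 hc]
      · rw [tB c h1.1, comp_resolve_left h (classMap_mem h1.1) h1.1 hc]
    have eB : ∑ c : g.crossings, term w n (comp (g.resolveAt c) f (h.resolve_left c)) =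
        ∑ c : pulledCrossings g f, t c :=
       sum_pulledCrossings h
        (fun c => term w n (comp (g.resolveAt c) f (h.resolve_left c))) t tB
    have eA : ∑ c : f.crossings, term w n (comp g (f.resolveAt c) (h.resolve_right c)) =
        ∑ c : f.crossings, t c := Finset.sum_congr rfl fun c _ => tA c
    have eC : ∑ c : (comp g f h).crossings, term w n ((comp g f h).resolveAt c) =
        ∑ c : (comp g f h).crossings, t c := Finset.sum_congr rfl fun c _ => tC c
    rw [eA, eB, eC, add_comm]
    exact sum_eq_add_of_symmDiff add_self _ _ _ (mem_crossings_comp h) t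
  · rw [dif_neg h, LinearMap.map_zero, Finset.sum_eq_zero, Finset.sum_eq_zero, add_zero]
    · intro c _
      exact pure_mul_term_of_not (by rwa [composable_resolve_right_iff])
    · intro c _
      exact term_mul_pure_of_not (by rwa [composable_resolve_left_iff])

/-- The Leibniz rule (the signs play no role in characteristic two). -/
theorem d_mul (a b : PongAlgebra m k) : d (a * b) = d a * b + a * d b := by
  induction a using PongAlgebra.induction with
  | zero => simp only [PongAlgebra.zero_mul, LinearMap.map_zero, add_zero]
  | add x y hx hy => simp only [PongAlgebra.add_mul, LinearMap.map_add, hx, hy]; abel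
  | smul r g =>
    induction b using PongAlgebra.induction with
    | zero => simp only [PongAlgebra.mul_zero, LinearMap.map_zero, add_zero]
    | add x y hx hy => simp only [PongAlgebra.mul_add, LinearMap.map_add, hx, hy]; abel
    | smul s f =>
      simp only [PongAlgebra.smul_mul, PongAlgebra.mul_smul, LinearMap.map_smul, d_pure_mul_pure,
        smul_add]

end PongAlgebra

end Pong

namespace Pong

section homology

variable {F A : Type} [CommRing F] [Ring A] [Algebra F A]

/-- The subalgebra of cycles of a differential that satisfies the Leibniz rule (without signs). -/
def cycles (d : A →ₗ[F] A) (hd : ∀ a b, d (a * b) = d a * b + a * d b) : Subalgebra F A where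
  carrier := {a | d a = 0}
  mul_mem' {a b} (ha : d a = 0) (hb : d b = 0) := by
    change d (a * b) = 0
    rw [hd, ha, hb, zero_mul, mul_zero, add_zero]
  add_mem' {a b} (ha : d a = 0) (hb : d b = 0) := by
    change d (a + b) = 0
    rw [map_add, ha, hb, add_zero]
  algebraMap_mem' r := by
    have h1 : d 1 = 0 := by
      have := hd 1 1
      rwa [mul_one, one_mul, mul_one, left_eq_add] at this
    change d (algebraMap F A r) = 0
    rw [Algebra.algebraMap_eq_smul_one, map_smul, h1, smul_zero]

theorem mem_cycles {d : A →ₗ[F] A} {hd : ∀ a b, d (a * b) = d a * b + a * d b} {a : A} :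
    a ∈ cycles d hd ↔ d a = 0 := Iff.rfl

/-- The ideal of boundaries in the algebra of cycles. -/
def boundaries (d : A →ₗ[F] A) (hd : ∀ a b, d (a * b) = d a * b + a * d b) :
    Ideal (cycles d hd) where
  carrier := {z | ∃ x, d x = z}
  add_mem' := by
    rintro a b ⟨x, hx⟩ ⟨y, hy⟩
    exact ⟨x + y, by rw [map_add, hx, hy]; rfl⟩
  zero_mem' := ⟨0, by rw [map_zero]; rfl⟩
  smul_mem' := by
    rintro c z ⟨x, hx⟩
    refine ⟨c * x, ?_⟩
    rw [hd, mem_cycles.1 c.2, zero_mul, zero_add, hx]; rfl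

instance (d : A →ₗ[F] A) (hd : ∀ a b, d (a * b) = d a * b + a * d b) :
    (boundaries d hd).IsTwoSided where
  mul_mem_of_left := by
    rintro z c ⟨x, hx⟩
    refine ⟨x * c, ?_⟩
    rw [hd, mem_cycles.1 c.2, mul_zero, add_zero, hx]; rfl

/-- The homology algebra `ker d / im d`: cycles modulo boundaries. -/
def Homology (d : A →ₗ[F] A) (hd : ∀ a b, d (a * b) = d a * b + a * d b) : Type :=
  cycles d hd ⧸ boundaries d hd

instance (d : A →ₗ[F] A) (hd : ∀ a b, d (a * b) = d a * b + a * d b) : Ring (Homology d hd) :=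
  inferInstanceAs (Ring (cycles d hd ⧸ boundaries d hd))

instance (d : A →ₗ[F] A) (hd : ∀ a b, d (a * b) = d a * b + a * d b) : Algebra F (Homology d hd) :=
  inferInstanceAs (Algebra F (cycles d hd ⧸ boundaries d hd))

/-- The homology class of a cycle. -/
def homologyClass (d : A →ₗ[F] A) (hd : ∀ a b, d (a * b) = d a * b + a * d b) (a : A)
    (ha : d a = 0) : Homology d hd :=
  Ideal.Quotient.mk (boundaries d hd) ⟨a, ha⟩

end homology

variable (m k : ℕ) [m.AtLeastTwo]

/-- The two-sided ideal of the pong algebra generated by `v_1, …, v_m`; these elements are central,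
so this is also the left ideal that they generate. -/
noncomputable def variableIdeal : Ideal (PongAlgebra m k) :=
  Ideal.span (Set.range fun l : Fin m =>
    algebraMap (BaseRing m) (PongAlgebra m k) (MvPolynomial.X l))

instance : (variableIdeal m k).IsTwoSided where
  mul_mem_of_left := by
    intro a b ha
    induction ha using Submodule.span_induction with
    | mem x hx =>
      obtain ⟨l, rfl⟩ := hx
      rw [Algebra.commutes]
      exact Ideal.mul_mem_left _ _ (Ideal.subset_span ⟨l, rfl⟩)
    | zero => rw [zero_mul]; exact Ideal.zero_mem _
    | add x y _ _ hx hy => rw [add_mul]; exact Ideal.add_mem _ hx hy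
    | smul r x _ hx => rw [smul_eq_mul, mul_assoc]; exact Ideal.mul_mem_left _ _ hx

theorem d_mem_variableIdeal {a : PongAlgebra m k} (ha : a ∈ variableIdeal m k) :
    PongAlgebra.d a ∈ variableIdeal m k := by
  induction ha using Submodule.span_induction with
  | mem x hx =>
    obtain ⟨l, rfl⟩ := hx
    have h1 : PongAlgebra.d (1 : PongAlgebra m k) = 0 := by
      have := PongAlgebra.d_mul (1 : PongAlgebra m k) 1
      rwa [mul_one, one_mul, mul_one, left_eq_add] at this
    beta_reduce
    rw [Algebra.algebraMap_eq_smul_one, LinearMap.map_smul, h1, smul_zero]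
    exact Ideal.zero_mem _
  | zero => rw [LinearMap.map_zero]; exact Ideal.zero_mem _
  | add x y _ _ hx hy => rw [LinearMap.map_add]; exact Ideal.add_mem _ hx hy
  | smul r x hx' hx =>
    rw [smul_eq_mul, PongAlgebra.d_mul]
    exact Ideal.add_mem _ (Ideal.mul_mem_left _ _ hx') (Ideal.mul_mem_left _ _ hx)

/-- The quotient `Q(m, k)` of the pong algebra by the ideal generated by `v_1, …, v_m`. -/
abbrev QuotAlgebra : Type := PongAlgebra m k ⧸ variableIdeal m k

/-- The quotient map. -/
noncomputable abbrev toQuot : PongAlgebra m k →+* QuotAlgebra m k := Ideal.Quotient.mk (variableIdeal m k)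

/-- The differential induced on `Q(m, k)`. -/
noncomputable def quotD : QuotAlgebra m k →ₗ[ZMod 2] QuotAlgebra m k :=
  AddMonoidHom.toZModLinearMap 2
    (QuotientAddGroup.map (variableIdeal m k).toAddSubgroup (variableIdeal m k).toAddSubgroup
      PongAlgebra.d.toAddMonoidHom (fun _ ha => d_mem_variableIdeal m k ha) :
      QuotAlgebra m k →+ QuotAlgebra m k)

theorem quotD_toQuot (a : PongAlgebra m k) :
    quotD m k (toQuot m k a) = toQuot m k (PongAlgebra.d a) := rfl

theorem quotD_mul (a b : QuotAlgebra m k) :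
    quotD m k (a * b) = quotD m k a * b + a * quotD m k b := by
  obtain ⟨a, rfl⟩ := Ideal.Quotient.mk_surjective a
  obtain ⟨b, rfl⟩ := Ideal.Quotient.mk_surjective b
  rw [← map_mul, quotD_toQuot, quotD_toQuot, quotD_toQuot, PongAlgebra.d_mul, map_add, map_mul,
    map_mul]

/-- The homology algebra of `Q(m, k)`, over the field with two elements. -/
abbrev QuotHomology : Type := Homology (quotD m k) (quotD_mul m k)

theorem swappable_of_odd {m : ℕ} {i j : ℤ} (h : Odd (j - i)) : Swappable m i j := by
  intro γ hγ e
  rcases wallGroup_form hγ with ⟨n, hn⟩ | ⟨n, hn⟩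
  · exfalso
    rw [hn] at e
    obtain ⟨a, ha⟩ := h
    have : (2 * (m : ℤ) - 2) * n = 2 * ((m - 1) * n) := by ring
    omega
  · rw [hn] at e ⊢; omega

/-- The lifted partial permutation on all `m - 1` letters that exchanges `γ i` and `γ j` for all
`γ` in `G_m`, and fixes the other integers. -/
noncomputable def exchange (i j : ℤ) (h : Odd (j - i)) : LiftedPartialPerm m (m - 1) where
  dom := Set.univ
  toFun := swapAt m i j
  dom_invariant _ _ _ _ := Set.mem_univ _
  equivariant γ hγ n _ := swapAt_smul (swappable_of_odd h) hγ n
  card_orbits := by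
    rw [← encard_position]
    congr 1
    refine Set.eq_univ_of_forall fun p => ?_
    induction p using Quotient.inductionOn with
    | h i => exact ⟨i, Set.mem_univ _, rfl⟩
  injective_orbits a _ b _ hab := by
    have hs := swappable_of_odd (m := m) h
    obtain ⟨γ, hγ, e⟩ := pos_eq_iff.1 hab
    refine pos_eq_iff.2 ⟨γ, hγ, ?_⟩
    rw [← swapAt_smul hs hγ] at e
    rw [← swapAt_swapAt hs (γ a), e, swapAt_swapAt hs]
  map_outside _ h := absurd (Set.mem_univ _) h

/-- The element `𝒳_{0,i}` of the pong algebra with `m` walls and `m - 1` strands: the strand at `i`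
goes to `1 - i` (so it bounces off the left wall back to `i`), and the others are stationary. -/
noncomputable def leftBounce (i : ℤ) : PongAlgebra m (m - 1) :=
  PongAlgebra.pure (exchange m (1 - i) i ⟨i - 1, by ring⟩)

/-- The element `𝒳_{i,m}` of the pong algebra with `m` walls and `m - 1` strands: the strand at `i`
goes to `2m - 1 - i` (so it bounces off the right wall back to `i`), and the others are
stationary. -/
noncomputable def rightBounce (i : ℤ) : PongAlgebra m (m - 1) :=
  PongAlgebra.pure (exchange m i (2 * m - 1 - i) ⟨m - 1 - i, by ring⟩)

/-- The element `X_{l+1} = X_{l,l+1}` of `Q(m, m-1)` for `l = 0, …, m-1`: it exchanges `l` and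
`l + 1` equivariantly. For `l = 0` this is `𝒳_{0,1}`, for `l = m - 1` it is `𝒳_{m-1,m}`. -/
noncomputable def xGen (l : Fin m) : QuotAlgebra m (m - 1) :=
  toQuot m (m - 1) (PongAlgebra.pure (exchange m (l : ℕ) ((l : ℕ) + 1) ⟨0, by ring⟩))

/-- The element `Ω = ∑_{0<i<m} [𝒳_{0,i}, 𝒳_{i,m}]` of `Q(m, m-1)`. -/
noncomputable def omegaGen : QuotAlgebra m (m - 1) :=
  toQuot m (m - 1) (∑ i ∈ Finset.Ioo (0 : ℤ) m,
    (leftBounce m i * rightBounce m i - rightBounce m i * leftBounce m i))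

/-- The ideal `(X_1², …, X_m²)` of the polynomial ring `𝔽₂[X_1, …, X_m, Ω]`, where the variable
`some l` is `X_{l+1}` and `none` is `Ω`. -/
noncomputable def squaresIdeal (m : ℕ) : Ideal (MvPolynomial (Option (Fin m)) (ZMod 2)) :=
  Ideal.span (Set.range fun l : Fin m => MvPolynomial.X (some l) ^ 2)

end Pong

/-! With m - 1 strands every position is occupied, so the basis of P(m, m-1) is a group: the
permutations of ℤ that commute with G_m. This is the affine Coxeter group of type C, generated by
the m exchanges of l and l + 1. The crossing number is the length, and the terms of the differential
are the Bruhat covers (`Cov`). The differential preserves the total weight (exponent of the monomial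
plus weight of the permutation), so in total weight w the complex has one basis element for each
permutation of weight at most w, and all its coefficients are 0 or 1 (`repr_d_basis`).

The homology of P(m, m-1) itself is F[Ω]. It is found by cancelling matched pairs
(`AcyclicOn.of_matching`, `Collapses.acyclicOn`). If w is not constant, multiplication by one
suitable simple reflection respects the bound w and matches everything (`exists_simple_bounded`). If
w is constantly k, all m simple reflections are used in turn, on the left for even indices and on
the right for odd ones, so that these operations commute. What resists them are the juggling
permutations with 2k strands over each line (`bounded_and_bump_iff`): even numbers move weakly to
the right and odd ones weakly to the left. Exchanging consecutive even numbers cancels these in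
turn, down to the k-th power of a single translation (`isMatching_rest`, `rest_pivot`). So there is
at most one class in each constant weight. It is represented by a power of Ω, which is the sum of
the translations of single orbits: a conjugacy-invariant set, hence Ω is central (`omega_mul`), and
a cycle because the translations that cover a given element come in pairs (`d_omega`). The
coefficient of the surviving translation in Ω^k is one (`repr_omega_pow`), and this coefficient
vanishes on boundaries (`repr_d_critical`).

The variables are then divided out one at a time. They form a regular sequence on a free module, and
d X_l = v_l (`d_simple_fin`), so multiplication by v_l is null-homotopic and each division doubles
the homology: every class also appears multiplied by X_l. This is the content of `exists_normalForm`
and `normalForm_independent`: the squarefree monomials in the X_l, times powers of Ω, represent a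
basis of the homology of Q(m, m-1).

The relations complete the presentation. The square of X_l vanishes because the length is not
additive. Distant generators commute. For neighbours, X_a X_b X_a is a multiple v_a y, and
cancelling v_a in its differential shows that the commutator of X_a and X_b is d y
(`exists_d_eq_commutator_of`). -/

namespace Pong

/-! ### Cancellation of matched pairs in a complex with a basis. -/

section matching

variable {F V B : Type*} [Field F] [AddCommGroup V] [Module F V]

/-- Every cycle that is supported in `I` is a boundary. -/
def AcyclicOn (b : Module.Basis B F V) (d : V →ₗ[F] V) (I : Set B) : Prop :=
  ∀ z, (∀ x, x ∉ I → b.repr z x = 0) → d z = 0 → ∃ y, d y = z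

/-- The span of the basis vectors in `I` is a subcomplex. -/
def IsLowerFor (b : Module.Basis B F V) (d : V →ₗ[F] V) (I : Set B) : Prop :=
  ∀ x ∈ I, ∀ y, y ∉ I → b.repr (d (b x)) y = 0

variable {b : Module.Basis B F V} {d : V →ₗ[F] V}

theorem repr_map_eq_sum (z : V) (y : B) :
    b.repr (d z) y = (b.repr z).sum fun x r => r * b.repr (d (b x)) y := by
  conv_lhs => rw [← b.linearCombination_repr z, Finsupp.linearCombination_apply, Finsupp.sum]
  simp only [map_sum, map_smul, Finsupp.coe_finsetSum, Finset.sum_apply, Finsupp.smul_apply,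
    smul_eq_mul, Finsupp.sum]

theorem IsLowerFor.repr_eq_zero {I : Set B} (hI : IsLowerFor b d I) {z : V}
    (hz : ∀ x, x ∉ I → b.repr z x = 0) {y : B} (hy : y ∉ I) : b.repr (d z) y = 0 := by
  rw [repr_map_eq_sum]
  refine Finset.sum_eq_zero fun x hx => ?_
  beta_reduce
  rw [hI x (by_contra fun h => Finsupp.mem_support_iff.1 hx (hz x h)) y hy, mul_zero]

/-- Cancellation of a perfect matching `σ` on `I' \ I` between the elements in `U` and the elements
outside `U`. -/
theorem AcyclicOn.of_matching {I I' U : Set B} (hd : ∀ z, d (d z) = 0)  (hI : IsLowerFor b d I) (hI' : IsLowerFor b d I') (σ : B → B)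
    (hσ : ∀ x ∈ I' \ I, σ x ∈ I' \ I) (hσσ : ∀ x ∈ I' \ I, σ (σ x) = x)
    (hU : ∀ x ∈ I' \ I, σ x ∈ U ↔ x ∉ U)
    (hone : ∀ x ∈ I' \ I, x ∈ U → b.repr (d (b x)) (σ x) = 1)
    (hzero : ∀ x ∈ I' \ I, x ∈ U → ∀ y ∈ I' \ I, y ∉ U → y ≠ σ x → b.repr (d (b x)) y = 0)
    (h : AcyclicOn b d I) : AcyclicOn b d I' := by
  classical
  intro z hz hdz
  -- The lower element l is hit by its partner `σ l` with coefficient one and by no other upper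
  -- element, so `d y₀` has the same lower coefficients as z, and no ordering of the pairs is
  -- needed.
  set s : Finset B := (b.repr z).support.filter fun x => x ∈ I' \ I ∧ x ∉ U with hs
  set y₀ : V := ∑ l ∈ s, b.repr z l • b (σ l) with hy₀
  have hsmem : ∀ l ∈ s, l ∈ I' \ I ∧ l ∉ U := fun l hl => (Finset.mem_filter.1 hl).2
  have key : ∀ l ∈ I' \ I, l ∉ U → b.repr (d y₀) l = b.repr z l := by
    intro l hl hlU
    simp only [hy₀, map_sum, map_smul, Finsupp.coe_finsetSum, Finset.sum_apply,
      Finsupp.smul_apply, smul_eq_mul]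
    have hterm : ∀ x ∈ s, b.repr z x * b.repr (d (b (σ x))) l =
        if x = l then b.repr z l else 0 := by
      intro x hx
      obtain ⟨h1, h2⟩ := hsmem x hx
      split_ifs with e
      · subst e
        have := hone (σ x) (hσ x h1) ((hU x h1).2 h2)
        rw [hσσ x h1] at this
        rw [this, mul_one]
      · rw [hzero (σ x) (hσ x h1) ((hU x h1).2 h2) l hl hlU
          (by rw [hσσ x h1]; exact fun h => e h.symm), mul_zero]
    rw [Finset.sum_congr rfl hterm, Finset.sum_ite_eq' s l]
    split_ifs with h1
    · rfl
    · by_contra h2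
      exact h1 (Finset.mem_filter.2 ⟨Finsupp.mem_support_iff.2 (Ne.symm h2), hl, hlU⟩)
  have hy₀I : ∀ x, x ∉ I' → b.repr y₀ x = 0 := by
    intro x hx
    simp only [hy₀, map_sum, map_smul, Finsupp.coe_finsetSum, Finset.sum_apply,
      Finsupp.smul_apply, smul_eq_mul, Module.Basis.repr_self]
    refine Finset.sum_eq_zero fun l hl => ?_
    rw [Finsupp.single_eq_of_ne, mul_zero]
    rintro rfl
    exact hx (hσ l (hsmem l hl).1).1
  set z' : V := z - d y₀ with hz'
  have hz'1 : ∀ x, x ∉ I' → b.repr z' x = 0 := by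
    intro x hx
    rw [hz', map_sub, Finsupp.sub_apply, hz x hx, hI'.repr_eq_zero hy₀I hx, sub_zero]
  have hz'2 : ∀ l ∈ I' \ I, l ∉ U → b.repr z' l = 0 := by
    intro l hl hlU
    rw [hz', map_sub, Finsupp.sub_apply, key l hl hlU, sub_self]
  have hdz' : d z' = 0 := by rw [hz', map_sub, hdz, hd, sub_zero]
  -- Read `d z' = 0` at the partner of u. The subcomplex I does not reach it, the lower coefficients
  -- of z' are already zero, and the other upper elements do not hit it, so only the coefficient at
  -- u remains.
  have hz'3 : ∀ u ∈ I' \ I, u ∈ U → b.repr z' u = 0 := by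
    intro u hu huU
    have hl := hσ u hu
    have hlU : σ u ∉ U := fun h => (hU u hu).1 h huU
    have h0 : b.repr (d z') (σ u) = 0 := by rw [hdz', map_zero, Finsupp.zero_apply]
    rw [repr_map_eq_sum, Finsupp.sum_eq_single u] at h0
    · rwa [hone u hu huU, mul_one] at h0
    · intro x hx hxu
      by_cases hxI : x ∈ I
      · rw [hI x hxI _ hl.2, mul_zero]
      by_cases hxI' : x ∈ I'
      · by_cases hxU : x ∈ U
        · rw [hzero x ⟨hxI', hxI⟩ hxU _ hl hlU, mul_zero]
          intro e
          have := congrArg σ e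
          rw [hσσ u hu, hσσ x ⟨hxI', hxI⟩] at this
          exact hxu this.symm
        · exact absurd (hz'2 x ⟨hxI', hxI⟩ hxU) hx
      · exact absurd (hz'1 x hxI') hx
    · intro _; rw [zero_mul]
  obtain ⟨y, hy⟩ := h z' (fun x hx => by
    by_cases hxI' : x ∈ I'
    · by_cases hxU : x ∈ U
      · exact hz'3 x ⟨hxI', hx⟩ hxU
      · exact hz'2 x ⟨hxI', hx⟩ hxU
    · exact hz'1 x hxI') hdz'
  exact ⟨y + y₀, by rw [map_add, hy, hz', sub_add_cancel]⟩

end matching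

/-! ### The rigid motions in terms of congruences modulo the period 2m - 2. -/

section

variable {m : ℕ}

theorem exists_reflection (m : ℕ) (n : ℤ) :
    ∃ γ ∈ wallGroup m, ∀ x, γ x = 1 - x + (2 * m - 2) * n := by
  obtain ⟨γ, hγ, h⟩ := exists_translation m n
  refine ⟨γ * Equiv.subLeft (1 : ℤ), (wallGroup m).mul_mem hγ (Subgroup.subset_closure (Or.inl rfl)),
    fun x => ?_⟩
  rw [Equiv.Perm.mul_apply, Equiv.subLeft_apply, h]

theorem exists_wallGroup_apply_eq {p x : ℤ} : (∃ γ ∈ wallGroup m, γ p = x) ↔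
    (2 * (m : ℤ) - 2 ∣ x - p) ∨ (2 * (m : ℤ) - 2 ∣ x + p - 1) := by
  constructor
  · rintro ⟨γ, hγ, rfl⟩
    rcases wallGroup_form hγ with ⟨n, hn⟩ | ⟨n, hn⟩
    · exact Or.inl ⟨n, by rw [hn]; ring⟩
    · exact Or.inr ⟨n, by rw [hn]; ring⟩
  · rintro (⟨n, hn⟩ | ⟨n, hn⟩)
    · obtain ⟨γ, hγ, h⟩ := exists_translation m n
      exact ⟨γ, hγ, by rw [h, ← hn]; ring⟩
    · obtain ⟨γ, hγ, h⟩ := exists_reflection m n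
      exact ⟨γ, hγ, by rw [h, ← hn]; ring⟩

/-- The orbit of p consists of the numbers congruent to p or to 1 - p modulo the period, which turns
the choice of a group element in `swapAt` into case distinctions open to arithmetic. -/
theorem swapAt_apply {p q : ℤ} (hs : Swappable m p q) (x : ℤ) : swapAt m p q x =
    if 2 * (m : ℤ) - 2 ∣ x - p then x - p + q else
    if 2 * (m : ℤ) - 2 ∣ x + p - 1 then x + p - q else
    if 2 * (m : ℤ) - 2 ∣ x - q then x - q + p else
    if 2 * (m : ℤ) - 2 ∣ x + q - 1 then x + q - p else x := by
  split_ifs with h1 h2 h3 h4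
  · obtain ⟨n, hn⟩ := h1
    obtain ⟨γ, hγ, h⟩ := exists_translation m n
    have e : x = γ p := by rw [h, ← hn]; ring
    rw [e, swapAt_left hγ, h, h]; ring
  · obtain ⟨n, hn⟩ := h2
    obtain ⟨γ, hγ, h⟩ := exists_reflection m n
    have e : x = γ p := by rw [h, ← hn]; ring
    rw [e, swapAt_left hγ, h, h]; ring
  · obtain ⟨n, hn⟩ := h3
    obtain ⟨γ, hγ, h⟩ := exists_translation m n
    have e : x = γ q := by rw [h, ← hn]; ring
    rw [e, swapAt_right hs hγ, h, h]; ring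
  · obtain ⟨n, hn⟩ := h4
    obtain ⟨γ, hγ, h⟩ := exists_reflection m n
    have e : x = γ q := by rw [h, ← hn]; ring
    rw [e, swapAt_right hs hγ, h, h]; ring
  · refine swapAt_other ?_ ?_ <;> rw [exists_wallGroup_apply_eq] <;> tauto

/-- The reflections in G_m are involutions, so only a nontrivial translation from p to q can
obstruct the exchange. -/
theorem swappable_iff {p q : ℤ} : Swappable m p q ↔ (2 * (m : ℤ) - 2 ∣ q - p → p = q) := by
  constructor
  · rintro h ⟨n, hn⟩
    obtain ⟨γ, hγ, h'⟩ := exists_translation m n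
    have := h γ hγ (by rw [h', ← hn]; ring)
    rw [h', ← hn] at this
    omega
  · intro h γ hγ e
    rcases wallGroup_form hγ with ⟨n, hn⟩ | ⟨n, hn⟩
    · have := h ⟨n, by rw [← e, hn]; ring⟩
      subst this; exact e
    · rw [hn] at e ⊢; omega

theorem eq_zero_of_period_dvd {z : ℤ} (h : 2 * (m : ℤ) - 2 ∣ z) (h1 : z < 2 * m - 2)
    (h2 : -(2 * (m : ℤ) - 2) < z) : z = 0 :=
  Int.eq_zero_of_abs_lt_dvd h (abs_lt.2 ⟨h2, h1⟩)

theorem even_of_period_dvd {z : ℤ} (h : 2 * (m : ℤ) - 2 ∣ z) : Even z := by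
  obtain ⟨n, rfl⟩ := h
  exact ⟨(m - 1) * n, by ring⟩

end

/-! ### The group of full lifted permutations and its exchanges. -/

/-- The lifted partial permutations whose domain is all of `ℤ`. -/
abbrev FullPerm (m : ℕ) : Type := LiftedPartialPerm m (m - 1)

namespace FullPerm

open LiftedPartialPerm

variable {m : ℕ}

theorem apply_add_period (f : FullPerm m) (x n : ℤ) :
    f (x + (2 * m - 2) * n) = f x + (2 * m - 2) * n := by
  obtain ⟨γ, hγ, h⟩ := exists_translation m n
  rw [← h, f.map_smul hγ, h]

theorem apply_reflect (f : FullPerm m) (x : ℤ) : f (1 - x) = 1 - f x := by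
  obtain ⟨γ, hγ, h⟩ := exists_reflection m 0
  have := f.map_smul hγ x
  rw [h, h, mul_zero, add_zero, add_zero] at this
  exact this

theorem apply_sub_of_dvd (f : FullPerm m) {x y : ℤ} (h : 2 * (m : ℤ) - 2 ∣ y - x) :
    f y = f x + (y - x) := by
  obtain ⟨n, hn⟩ := h
  have := f.apply_add_period x n
  rw [← hn] at this
  rw [← this]; congr 1; ring

variable [m.AtLeastTwo]

/-- There are only m - 1 orbits in all, and the domain contains m - 1 of them. -/
theorem dom_eq (f : FullPerm m) : f.dom = Set.univ := by
  have h1 : pos m '' f.dom = Set.univ := by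
    refine Set.Finite.eq_of_subset_of_encard_le f.finite_orbits (Set.subset_univ _) ?_
    rw [f.card_orbits, encard_position]
  refine Set.eq_univ_of_forall fun i => ?_
  obtain ⟨j, hj, e⟩ : pos m i ∈ pos m '' f.dom := by rw [h1]; trivial
  obtain ⟨γ, hγ, rfl⟩ := pos_eq_iff.1 e
  exact f.dom_invariant γ hγ j hj

theorem mem_dom (f : FullPerm m) (i : ℤ) : i ∈ f.dom := by rw [f.dom_eq]; trivial

theorem image_dom (f : FullPerm m) : f '' f.dom = Set.univ := by
  have h1 : pos m '' (f '' f.dom) = Set.univ := by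
    refine Set.Finite.eq_of_subset_of_encard_le (Set.toFinite _) (Set.subset_univ _) ?_
    rw [f.card_image, encard_position]
  refine Set.eq_univ_of_forall fun i => ?_
  obtain ⟨j, hj, e⟩ : pos m i ∈ pos m '' (f '' f.dom) := by rw [h1]; trivial
  obtain ⟨γ, hγ, rfl⟩ := pos_eq_iff.1 e
  exact f.image_dom_invariant hγ hj

theorem bijective (f : FullPerm m) : Function.Bijective f := by
  refine ⟨fun i j h => f.injOn (f.mem_dom i) (f.mem_dom j) h, fun i => ?_⟩
  obtain ⟨j, -, h⟩ : i ∈ f '' f.dom := by rw [f.image_dom]; trivial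
  exact ⟨j, h⟩

theorem composable (g f : FullPerm m) : Composable g f := by
  unfold Composable
  rw [g.dom_eq, f.image_dom]

/-- The lifted permutation of an equivariant permutation of `ℤ`. -/
def ofPerm (σ : Equiv.Perm ℤ) (h : ∀ γ ∈ wallGroup m, ∀ i, σ (γ i) = γ (σ i)) : FullPerm m where
  dom := Set.univ
  toFun := σ
  dom_invariant _ _ _ _ := Set.mem_univ _
  equivariant γ hγ i _ := h γ hγ i
  card_orbits := by
    rw [← encard_position]
    congr 1
    refine Set.eq_univ_of_forall fun p => ?_
    induction p using Quotient.inductionOn with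
    | h i => exact ⟨i, Set.mem_univ _, rfl⟩
  injective_orbits a _ b _ hab := by
    obtain ⟨γ, hγ, e⟩ := pos_eq_iff.1 hab
    exact pos_eq_iff.2 ⟨γ, hγ, σ.injective (by rw [h γ hγ, e])⟩
  map_outside _ h := absurd (Set.mem_univ _) h

/-- The full lifted permutations as the centralizer of the group of rigid motions. -/
noncomputable def equivCentralizer :
    FullPerm m ≃ Subgroup.centralizer (wallGroup m : Set (Equiv.Perm ℤ)) where
  toFun f := ⟨Equiv.ofBijective f f.bijective, by
    rw [Subgroup.mem_centralizer_iff]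
    intro γ hγ
    ext i
    exact (f.map_smul hγ i).symm⟩
  invFun σ := ofPerm σ.1 fun γ hγ i =>
    (DFunLike.congr_fun (Subgroup.mem_centralizer_iff.1 σ.2 γ hγ) i).symm
  left_inv f := LiftedPartialPerm.ext f.dom_eq.symm rfl
  right_inv σ := by
    ext i
    rfl

noncomputable instance : Group (FullPerm m) := equivCentralizer.group

theorem mul_apply (g f : FullPerm m) (i : ℤ) : (g * f) i = g (f i) := rfl

theorem one_apply (i : ℤ) : (1 : FullPerm m) i = i := rfl

theorem inv_apply_self (f : FullPerm m) (i : ℤ) : f⁻¹ (f i) = i := by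
  rw [← mul_apply, inv_mul_cancel, one_apply]

theorem apply_inv_self (f : FullPerm m) (i : ℤ) : f (f⁻¹ i) = i := by
  rw [← mul_apply, mul_inv_cancel, one_apply]

theorem inv_apply_eq {f : FullPerm m} {i j : ℤ} : f⁻¹ i = j ↔ f j = i :=
  ⟨fun h => by rw [← h, apply_inv_self], fun h => by rw [← h, inv_apply_self]⟩

theorem ext_apply {f g : FullPerm m} (h : ∀ i, f i = g i) : f = g :=
  ext_on (f.dom_eq.trans g.dom_eq.symm) fun i _ => h i

theorem comp_eq_mul (g f : FullPerm m) (h : Composable g f) : comp g f h = g * f :=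
  ext_apply fun i => comp_apply h (f.mem_dom i)

theorem apply_eq_iff (f : FullPerm m) {i j : ℤ} : f i = f j ↔ i = j :=
  f.bijective.1.eq_iff

open Classical in
/-- The equivariant exchange of `i` and `j`, if it is consistent, and the identity otherwise. -/
noncomputable def sw (m : ℕ) [m.AtLeastTwo] (i j : ℤ) : FullPerm m :=
  if h : Swappable m i j then
    ofPerm ⟨swapAt m i j, swapAt m i j, swapAt_swapAt h, swapAt_swapAt h⟩
      fun _ hγ n => swapAt_smul h hγ n
  else 1

theorem sw_apply {i j : ℤ} (h : Swappable m i j) (x : ℤ) : sw m i j x = swapAt m i j x := by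
  rw [sw, dif_pos h]; rfl

theorem sw_mul_self (i j : ℤ) : sw m i j * sw m i j = 1 := by
  by_cases h : Swappable m i j
  · refine ext_apply fun x => ?_
    rw [mul_apply, sw_apply h, sw_apply h, swapAt_swapAt h, one_apply]
  · rw [sw, dif_neg h, mul_one]

theorem sw_inv (i j : ℤ) : (sw m i j)⁻¹ = sw m i j := inv_eq_of_mul_eq_one_left (sw_mul_self i j)

theorem sw_sw_apply (i j x : ℤ) : sw m i j (sw m i j x) = x := by
  rw [← mul_apply, sw_mul_self, one_apply]

theorem sw_left {i j : ℤ} (h : Swappable m i j) : sw m i j i = j := by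
  rw [sw_apply h]; exact swapAt_left (wallGroup m).one_mem

theorem sw_right {i j : ℤ} (h : Swappable m i j) : sw m i j j = i := by
  rw [sw_apply h]; exact swapAt_right h (wallGroup m).one_mem

theorem swappable_map (f : FullPerm m) {i j : ℤ} (h : Swappable m i j) :
    Swappable m (f i) (f j) := by
  rw [swappable_iff] at *
  intro hd
  have := f⁻¹.apply_sub_of_dvd hd
  rw [inv_apply_self, inv_apply_self] at this
  rw [h (by rw [this]; simpa using hd)]

/-- Conjugation of an exchange. -/
theorem mul_sw (f : FullPerm m) {i j : ℤ} (h : Swappable m i j) :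
    f * sw m i j = sw m (f i) (f j) * f := by
  refine ext_apply fun x => ?_
  rw [mul_apply, mul_apply, sw_apply h, sw_apply (f.swappable_map h),
    map_swapAt (f.mem_dom i) (f.mem_dom j) h (f.swappable_map h) (f.mem_dom x)]

theorem sw_congr {i j i' j' : ℤ} (h : Swappable m i j) (h' : Swappable m i' j')
    (e : pairClass m i j = pairClass m i' j') : sw m i j = sw m i' j' :=
  ext_apply fun x => by rw [sw_apply h, sw_apply h', swapAt_congr h h' e]

/-- A nontrivial exchange determines its pair, since it moves i to j. This is what makes resolutions
at distinct crossings distinct. -/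
theorem pairClass_eq_of_sw_eq {i j i' j' : ℤ} (h : Swappable m i j) (h' : Swappable m i' j')
    (hne : i ≠ j) (e : sw m i j = sw m i' j') : pairClass m i j = pairClass m i' j' := by
  have h1 : swapAt m i' j' i = j := by rw [← sw_apply h', ← e, sw_left h]
  rcases swapAt_cases m i' j' i with ⟨γ, hγ, rfl⟩ | ⟨γ, hγ, rfl⟩ | ⟨h2, h3⟩
  · rw [swapAt_left hγ] at h1
    exact (pairClass_eq_iff.2 ⟨γ, hγ, Or.inl ⟨rfl, h1⟩⟩).symm
  · rw [swapAt_right h' hγ] at h1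
    exact (pairClass_eq_iff.2 ⟨γ, hγ, Or.inr ⟨rfl, h1⟩⟩).symm
  · rw [swapAt_other h2 h3] at h1
    exact absurd h1 hne

theorem crossing_iff {f : FullPerm m} {i j : ℤ} : f.IsLiftedCrossing i j ↔
    (i < j ∧ f j < f i) ∨ (j < i ∧ f i < f j) := by
  rw [isLiftedCrossing_iff]
  exact ⟨fun h => h.2.2, fun h => ⟨f.mem_dom i, f.mem_dom j, h⟩⟩

theorem crossing_of_lt {f : FullPerm m} {i j : ℤ} (h : i < j) (h' : f j < f i) :
    f.IsLiftedCrossing i j := crossing_iff.2 (Or.inl ⟨h, h'⟩)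

theorem resolve_eq {f : FullPerm m} {i j : ℤ} (h : f.IsLiftedCrossing i j) :
    f.resolve i j h = f * sw m i j := by
  refine ext_apply fun x => ?_
  rw [mul_apply, sw_apply h.swappable]; rfl

theorem cross_mul_sw_lt {f : FullPerm m} {i j : ℤ} (h : f.IsLiftedCrossing i j) :
    (f * sw m i j).cross < f.cross := by
  rw [← resolve_eq h]; exact cross_resolve h

theorem exchange_eq_sw (i j : ℤ) (h : Odd (j - i)) : exchange m i j h = sw m i j :=
  ext_apply fun x => (sw_apply (swappable_of_odd h) x).symm

/-- Multiplicativity of the crossing number up to cancellations. -/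
theorem cross_mul (g f : FullPerm m) : g.cross + f.cross =
    (g * f).cross + 2 * (f.crossings ∩ pulledCrossings g f).ncard := by
  rw [← comp_eq_mul g f (composable g f)]
  exact cross_comp _

theorem mem_pulledCrossings' {g f : FullPerm m} {i j : ℤ} :
    pairClass m i j ∈ pulledCrossings g f ↔ g.IsLiftedCrossing (f i) (f j) := by
  rw [mem_pulledCrossings]
  exact ⟨fun h => h.2.2, fun h => ⟨f.mem_dom i, f.mem_dom j, h⟩⟩

theorem cross_one : (1 : FullPerm m).cross = 0 :=
  IsIdempotent.cross fun i => one_apply i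

/-- Every crossing of f is undone by its inverse, so the correction term of `cross_mul` for the
product 1 counts all of them. -/
theorem cross_inv (f : FullPerm m) : f⁻¹.cross = f.cross := by
  have h := cross_mul f⁻¹ f
  have e : f.crossings ∩ pulledCrossings f⁻¹ f = f.crossings := by
    refine Set.inter_eq_left.2 fun c hc => ?_
    obtain ⟨i, j, rfl⟩ := pairClass_cases c
    rw [mem_pulledCrossings']
    rw [mem_crossings_iff] at hc
    rw [crossing_iff] at *
    rw [inv_apply_self, inv_apply_self]
    tauto
  rw [inv_mul_cancel, cross_one, e] at h
  change f⁻¹.cross + f.cross = 0 + 2 * f.cross at h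
  omega

/-! ### Simple reflections and the crossing number as a length function. -/

/-- The simple reflection that exchanges `l` and `l + 1`. -/
noncomputable abbrev simple (m : ℕ) [m.AtLeastTwo] (l : ℤ) : FullPerm m := sw m l (l + 1)

theorem swappable_succ (m : ℕ) (l : ℤ) : Swappable m l (l + 1) := swappable_of_odd ⟨0, by ring⟩

theorem simple_left (l : ℤ) : simple m l l = l + 1 := sw_left (swappable_succ m l)

theorem simple_right (l : ℤ) : simple m l (l + 1) = l := sw_right (swappable_succ m l)

theorem simple_near (l x : ℤ) :
    simple m l x = x ∨ simple m l x = x + 1 ∨ simple m l x = x - 1 := by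
  rw [sw_apply (swappable_succ m l), swapAt_apply (swappable_succ m l)]
  split_ifs <;> omega

theorem simple_apply_of_not_dvd {l x : ℤ} (h1 : ¬ 2 * (m : ℤ) - 2 ∣ x - l)
    (h2 : ¬ 2 * (m : ℤ) - 2 ∣ x + l - 1) (h3 : ¬ 2 * (m : ℤ) - 2 ∣ x - l - 1)
    (h4 : ¬ 2 * (m : ℤ) - 2 ∣ x + l) : simple m l x = x := by
  rw [sw_apply (swappable_succ m l), swapAt_apply (swappable_succ m l), if_neg h1, if_neg h2,
    if_neg (by rwa [← sub_sub]), if_neg (by rwa [← add_assoc, add_sub_cancel_right])]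

theorem simple_le_iff {l i : ℤ} (h1 : ¬ 2 * (m : ℤ) - 2 ∣ i - l) (h2 : ¬ 2 * (m : ℤ) - 2 ∣ i + l)
    (x : ℤ) : simple m l x ≤ i ↔ x ≤ i := by
  rw [sw_apply (swappable_succ m l), swapAt_apply (swappable_succ m l)]
  split_ifs with c1 c2 c3 c4
  · have : x ≠ i := by rintro rfl; exact h1 c1
    omega
  · have : x ≠ i + 1 := by rintro rfl; exact h2 (by convert c2 using 1; ring)
    omega
  · have : x ≠ i + 1 := by rintro rfl; exact h1 (by convert c3 using 1; ring)
    omega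
  · have : x ≠ i := by rintro rfl; exact h2 (by convert c4 using 1; ring)
    omega
  · rfl

theorem sw_comm {i j : ℤ} (h : Swappable m i j) : sw m i j = sw m j i := by
  have h' : Swappable m j i := by
    rw [swappable_iff] at *
    intro hd
    exact (h (by rwa [dvd_sub_comm])).symm
  exact sw_congr h h' (pairClass_eq_iff.2 ⟨1, (wallGroup m).one_mem, Or.inr ⟨rfl, rfl⟩⟩)

/-- A simple reflection moves each number by at most one, so it can reverse only pairs of neighbours
that it exchanges. -/
theorem sw_eq_simple_of_crossing {l i j : ℤ} (h1 : i < j) (h2 : simple m l j < simple m l i) :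
    Swappable m i j ∧ sw m i j = simple m l := by
  have hi := simple_near (m := m) l i
  have hj := simple_near (m := m) l j
  obtain rfl : j = i + 1 := by omega
  have hi' : simple m l i = i + 1 := by omega
  refine ⟨swappable_succ m i, sw_congr (swappable_succ m i) (swappable_succ m l) ?_⟩
  rw [sw_apply (swappable_succ m l)] at hi'
  rcases swapAt_cases m l (l + 1) i with ⟨γ, hγ, rfl⟩ | ⟨γ, hγ, rfl⟩ | ⟨h3, h4⟩
  · rw [swapAt_left hγ] at hi'
    exact (pairClass_eq_iff.2 ⟨γ, hγ, Or.inl ⟨rfl, hi'⟩⟩).symm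
  · rw [swapAt_right (swappable_succ m l) hγ] at hi'
    exact (pairClass_eq_iff.2 ⟨γ, hγ, Or.inr ⟨rfl, hi'⟩⟩).symm
  · rw [swapAt_other h3 h4] at hi'; omega

theorem cross_simple (l : ℤ) : (simple m l).cross = 1 := by
  have h : (simple m l).crossings = {pairClass m l (l + 1)} := by
    refine Set.Subset.antisymm ?_ (Set.singleton_subset_iff.2 (mem_crossings_iff.2
      (crossing_of_lt (by omega) (by rw [simple_left, simple_right]; omega))))
    have key : ∀ i j, i < j → simple m l j < simple m l i →
        pairClass m i j = pairClass m l (l + 1) := fun i j h1 h2 =>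
      have h3 := sw_eq_simple_of_crossing h1 h2
      pairClass_eq_of_sw_eq h3.1 (swappable_succ m l) h1.ne h3.2
    rintro _ ⟨i, j, h, rfl⟩
    rw [Set.mem_singleton_iff]
    rcases crossing_iff.1 h with h | h
    · exact key i j h.1 h.2
    · rw [← key j i h.1 h.2]
      exact pairClass_eq_iff.2 ⟨1, (wallGroup m).one_mem, Or.inr ⟨rfl, rfl⟩⟩
  rw [cross, h, Set.ncard_singleton]

theorem simple_mul_simple_mul (l : ℤ) (f : FullPerm m) : simple m l * (simple m l * f) = f := by
  rw [← mul_assoc, sw_mul_self, one_mul]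

theorem mul_simple_mul_simple (l : ℤ) (f : FullPerm m) : f * simple m l * simple m l = f := by
  rw [mul_assoc, sw_mul_self, mul_one]

theorem sw_mul_eq (f : FullPerm m) {i j : ℤ} (h : Swappable m i j) :
    sw m i j * f = f * sw m (f⁻¹ i) (f⁻¹ j) := by
  rw [mul_sw f (f⁻¹.swappable_map h), apply_inv_self, apply_inv_self]

theorem sw_apply_eq_iff {i j x y : ℤ} : sw m i j x = y ↔ x = sw m i j y := by
  constructor
  · rintro rfl; rw [sw_sw_apply]
  · rintro rfl; rw [sw_sw_apply]

theorem sw_mul_inv_apply (f : FullPerm m) (i j x : ℤ) :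
    (sw m i j * f)⁻¹ x = f⁻¹ (sw m i j x) := by
  rw [mul_inv_rev, sw_inv, mul_apply]

/-- The product is a resolution of f, so the length drops. It drops by at most one because the
length is subadditive and a simple reflection has length one. -/
theorem cross_simple_mul_of_gt (f : FullPerm m) {l : ℤ} (h : f⁻¹ (l + 1) < f⁻¹ l) :
    (simple m l * f).cross + 1 = f.cross := by
  have h1 : (simple m l * f).cross < f.cross := by
    rw [sw_mul_eq f (swappable_succ m l)]
    refine cross_mul_sw_lt (crossing_iff.2 (Or.inr ⟨h, ?_⟩))
    rw [apply_inv_self, apply_inv_self]; omega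
  have h2 := cross_mul (simple m l) (simple m l * f)
  rw [simple_mul_simple_mul, cross_simple] at h2
  omega

theorem cross_simple_mul_of_lt (f : FullPerm m) {l : ℤ} (h : f⁻¹ l < f⁻¹ (l + 1)) :
    (simple m l * f).cross = f.cross + 1 := by
  rw [← cross_simple_mul_of_gt (simple m l * f) (l := l), simple_mul_simple_mul]
  rwa [sw_mul_inv_apply, sw_mul_inv_apply, simple_left, simple_right]

theorem cross_simple_mul_cases (f : FullPerm m) (l : ℤ) :
    (f⁻¹ l < f⁻¹ (l + 1) ∧ (simple m l * f).cross = f.cross + 1) ∨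
    (f⁻¹ (l + 1) < f⁻¹ l ∧ (simple m l * f).cross + 1 = f.cross) := by
  rcases lt_trichotomy (f⁻¹ l) (f⁻¹ (l + 1)) with h | h | h
  · exact Or.inl ⟨h, cross_simple_mul_of_lt f h⟩
  · rw [apply_eq_iff] at h; omega
  · exact Or.inr ⟨h, cross_simple_mul_of_gt f h⟩

theorem inv_mul_simple (f : FullPerm m) (l : ℤ) : (f * simple m l)⁻¹ = simple m l * f⁻¹ := by
  rw [mul_inv_rev, sw_inv]

theorem cross_mul_simple_of_lt (f : FullPerm m) {l : ℤ} (h : f l < f (l + 1)) :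
    (f * simple m l).cross = f.cross + 1 := by
  rw [← cross_inv, inv_mul_simple, cross_simple_mul_of_lt, cross_inv]
  rwa [inv_inv]

/-- A full lifted permutation without left descents is the identity. -/
theorem exists_descent {f : FullPerm m} (hf : f ≠ 1) : ∃ l, f⁻¹ (l + 1) < f⁻¹ l := by
  by_contra! h
  -- Without descents the displacement of the inverse, `f⁻¹ x - x`, is nondecreasing in x.
  have h1 : ∀ l, f⁻¹ l + 1 ≤ f⁻¹ (l + 1) := fun l =>
    lt_of_le_of_ne (h l) fun e => by rw [apply_eq_iff] at e; omega
  have mono : ∀ x (k : ℕ), f⁻¹ x + k ≤ f⁻¹ (x + k) := by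
    intro x k
    induction k with
    | zero => simp
    | succ k ih => have := h1 (x + k); push_cast; rw [← add_assoc x]; omega
  have mono' : ∀ x y, x ≤ y → f⁻¹ x + (y - x) ≤ f⁻¹ y := by
    intro x y hxy
    have := mono x (y - x).toNat
    rw [Int.toNat_of_nonneg (by omega)] at this
    rwa [add_sub_cancel] at this
  have hm : 2 ≤ m := Nat.AtLeastTwo.prop
  refine hf (inv_injective (ext_apply fun x => ?_))
  rw [inv_one, one_apply]
  have hp : ∀ k : ℤ, f⁻¹ (1 - x + (2 * m - 2) * k) = 1 - f⁻¹ x + (2 * m - 2) * k := fun k => by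
    rw [apply_add_period, apply_reflect]
  have b1 : ∀ z : ℤ, z ≤ (2 * m - 2) * |z| := fun z => by
    nlinarith [le_abs_self z, abs_nonneg z]
  -- The displacement at any point congruent to 1 - x is the negative of that at x. Taking one such
  -- point to the right of x and one to the left forces it to be zero; the absolute values only
  -- guarantee these positions.
  have e1 := mono' x (1 - x + (2 * m - 2) * |2 * x|) (by have := b1 (2 * x); omega)
  have e2 := mono' (1 - x + (2 * m - 2) * (-|1 - 2 * x|)) x (by
    have := b1 (1 - 2 * x); rw [mul_neg]; omega)
  rw [hp] at e1 e2
  omega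

/-! ### Counting strands across a vertical line. -/

/-- The number of strands of `f` that cross the vertical line at `l + 1/2`. -/
noncomputable def across (f : FullPerm m) (l : ℤ) : ℕ := (f.strandsAcross l).ncard

theorem mem_strandsAcross {f : FullPerm m} {l i : ℤ} :
    i ∈ f.strandsAcross l ↔ (i ≤ l ∧ l < f i) ∨ (f i ≤ l ∧ l < i) :=
  ⟨fun h => h.2, fun h => ⟨f.mem_dom i, h⟩⟩

theorem across_one (l : ℤ) : (1 : FullPerm m).across l = 0 := by
  have : (1 : FullPerm m).strandsAcross l = ∅ := by
    refine Set.eq_empty_of_forall_notMem fun i hi => ?_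
    rw [mem_strandsAcross, one_apply] at hi
    omega
  rw [across, this, Set.ncard_empty]

theorem across_inv (f : FullPerm m) (l : ℤ) : f⁻¹.across l = f.across l := by
  have : f⁻¹.strandsAcross l = f '' f.strandsAcross l := by
    ext i
    rw [mem_strandsAcross]
    constructor
    · intro h
      refine ⟨f⁻¹ i, ?_, apply_inv_self f i⟩
      rw [mem_strandsAcross, apply_inv_self]
      omega
    · rintro ⟨j, hj, rfl⟩
      rw [mem_strandsAcross] at hj
      rw [inv_apply_self]
      omega
  rw [across, this, Set.ncard_image_of_injective _ f.bijective.1, across]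

theorem across_mul_of_le_iff (g f : FullPerm m) {l : ℤ} (h : ∀ x, g x ≤ l ↔ x ≤ l) :
    (g * f).across l = f.across l := by
  unfold across
  congr 1
  ext i
  rw [mem_strandsAcross, mem_strandsAcross, mul_apply]
  have := h (f i)
  omega

/-- Each comparison of strand counts below singles out two strands; this is the common count of the
rest plus those two. -/
theorem ncard_eq_of_two {S C : Set ℤ} (hC : C.Finite) {a b : ℤ} {p q : Prop} [Decidable p]
    [Decidable q] (ha : a ∉ C) (hb : b ∉ C) (hab : p → q → a ≠ b)
    (h : ∀ i, i ∈ S ↔ i ∈ C ∨ (p ∧ i = a) ∨ (q ∧ i = b)) :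
    S.ncard = C.ncard + (if p then 1 else 0) + (if q then 1 else 0) := by
  by_cases hp : p <;> by_cases hq : q
  · have : S = insert b (insert a C) := by
      ext i; rw [h]; simp only [hp, hq, true_and, Set.mem_insert_iff]; tauto
    rw [this, Set.ncard_insert_of_notMem _ (hC.insert a), Set.ncard_insert_of_notMem ha hC,
      if_pos hp, if_pos hq]
    rw [Set.mem_insert_iff, not_or]
    exact ⟨(hab hp hq).symm, hb⟩
  · have : S = insert a C := by
      ext i; rw [h]; simp only [hp, hq, true_and, false_and, Set.mem_insert_iff]; tauto
    rw [this, Set.ncard_insert_of_notMem ha hC, if_pos hp, if_neg hq]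
  · have : S = insert b C := by
      ext i; rw [h]; simp only [hp, hq, true_and, false_and, Set.mem_insert_iff]; tauto
    rw [this, Set.ncard_insert_of_notMem hb hC, if_neg hp, if_pos hq]
  · have : S = C := by
      ext i; rw [h]; simp only [hp, hq, false_and]; tauto
    rw [this, if_neg hp, if_neg hq, add_zero, add_zero]

/-- The strands that end at l and l + 1 are split off because they alone change sides of the line at
l + 1/2 under left multiplication by the reflection there. -/
theorem across_eq_targets (f : FullPerm m) (l : ℤ) : f.across l =
    {i | i ∈ f.strandsAcross l ∧ f i ≠ l ∧ f i ≠ l + 1}.ncard +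
      (if l < f⁻¹ l then 1 else 0) + (if f⁻¹ (l + 1) ≤ l then 1 else 0) := by
  refine ncard_eq_of_two ((f.strandsAcross_finite l).subset fun i hi => hi.1)
    (a := f⁻¹ l) (b := f⁻¹ (l + 1)) ?_ ?_ ?_ ?_
  · rintro ⟨-, h, -⟩; exact h (apply_inv_self f l)
  · rintro ⟨-, -, h⟩; exact h (apply_inv_self f _)
  · intro _ _ e; rw [apply_eq_iff] at e; omega
  · intro i
    rw [Set.mem_ofPred_eq, mem_strandsAcross, eq_comm (a := i), inv_apply_eq, eq_comm (a := i),
      inv_apply_eq]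
    have h1 : f i = l → f⁻¹ l = i := fun h => inv_apply_eq.2 h
    have h2 : f i = l + 1 → f⁻¹ (l + 1) = i := fun h => inv_apply_eq.2 h
    by_cases e1 : f i = l
    · rw [h1 e1]; omega
    · by_cases e2 : f i = l + 1
      · rw [h2 e2]; omega
      · omega

/-- After the multiplication the strands to l and l + 1 have exchanged their targets and all others
stay on their side. The balance is written additively to avoid subtraction of natural numbers. -/
theorem across_simple_mul (f : FullPerm m) (l : ℤ) :
    (simple m l * f).across l + (if l < f⁻¹ l then 1 else 0) + (if f⁻¹ (l + 1) ≤ l then 1 else 0) =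
    f.across l + (if l < f⁻¹ (l + 1) then 1 else 0) + (if f⁻¹ l ≤ l then 1 else 0) := by
  rw [across_eq_targets f, across_eq_targets (simple m l * f), sw_mul_inv_apply, sw_mul_inv_apply,
    simple_left, simple_right]
  have : {i | i ∈ (simple m l * f).strandsAcross l ∧ (simple m l * f) i ≠ l ∧
      (simple m l * f) i ≠ l + 1} = {i | i ∈ f.strandsAcross l ∧ f i ≠ l ∧ f i ≠ l + 1} := by
    ext i
    simp only [Set.mem_ofPred_eq, mem_strandsAcross, mul_apply]
    have h1 : simple m l (f i) = l ↔ f i = l + 1 := by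
      rw [sw_apply_eq_iff, simple_left]
    have h2 : simple m l (f i) = l + 1 ↔ f i = l := by
      rw [sw_apply_eq_iff, simple_right]
    have h3 := simple_near (m := m) l (f i)
    omega
  rw [this]
  omega

/-- A conservation law: moving the line past x affects only the strand that starts at x and the
strand that ends there. -/
theorem across_sub_one (f : FullPerm m) (x : ℤ) :
    f.across (x - 1) + (if x < f x then 1 else 0) + (if x < f⁻¹ x then 1 else 0) =
    f.across x + (if f x < x then 1 else 0) + (if f⁻¹ x < x then 1 else 0) := by
  have key : ∀ l, l = x ∨ l = x - 1 → f.across l =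
      {i | i ∈ f.strandsAcross l ∧ i ≠ x ∧ f i ≠ x}.ncard +
      (if (x ≤ l ∧ l < f x) ∨ (f x ≤ l ∧ l < x) then 1 else 0) +
      (if (f⁻¹ x ≤ l ∧ l < x) ∨ (x ≤ l ∧ l < f⁻¹ x) then 1 else 0) := by
    intro l hl
    refine ncard_eq_of_two ((f.strandsAcross_finite l).subset fun i hi => hi.1)
      (a := x) (b := f⁻¹ x) ?_ ?_ ?_ ?_
    · rintro ⟨-, h, -⟩; exact h rfl
    · rintro ⟨-, -, h⟩; exact h (apply_inv_self f _)
    · intro h _ e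
      rw [eq_comm, inv_apply_eq] at e
      omega
    · intro i
      rw [Set.mem_ofPred_eq, mem_strandsAcross]
      by_cases e1 : i = x
      · subst e1
        have : i = f⁻¹ i → f i = i := fun h => inv_apply_eq.1 h.symm
        omega
      · by_cases e2 : f i = x
        · rw [inv_apply_eq.2 e2, e2]; omega
        · have : i ≠ f⁻¹ x := fun h => e2 (inv_apply_eq.1 h.symm)
          omega
  have hC : {i | i ∈ f.strandsAcross (x - 1) ∧ i ≠ x ∧ f i ≠ x} =
      {i | i ∈ f.strandsAcross x ∧ i ≠ x ∧ f i ≠ x} := by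
    ext i
    simp only [Set.mem_ofPred_eq, mem_strandsAcross]
    omega
  rw [key x (Or.inl rfl), key (x - 1) (Or.inr rfl), hC]
  generalize Set.ncard _ = c
  split_ifs <;> omega

/-- This makes the weights integral. Multiplying by a descent shortens f, and changes each count by
0 or 2, down to the identity where all counts vanish. -/
theorem even_across (f : FullPerm m) (l : ℤ) : Even (f.across l) := by
  by_cases hf : f = 1
  · rw [hf, across_one]; exact ⟨0, rfl⟩
  · obtain ⟨x, hx⟩ := exists_descent hf
    have hc := cross_simple_mul_of_gt f hx
    have ih := even_across (simple m x * f) l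
    by_cases h1 : ∀ y, simple m x y ≤ l ↔ y ≤ l
    · rwa [across_mul_of_le_iff _ _ h1] at ih
    -- A line whose sides are mixed by the reflection at x is an image under G_m of the line at x +
    -- 1/2, so it defines the same reflection.
    · have h2 : simple m x = simple m l := by
        by_cases h3 : 2 * (m : ℤ) - 2 ∣ l - x
        · obtain ⟨n, hn⟩ := h3
          obtain ⟨γ, hγ, h⟩ := exists_translation m n
          refine (sw_congr (swappable_succ m _) (swappable_succ m _) (pairClass_eq_iff.2
            ⟨γ, hγ, Or.inl ⟨?_, ?_⟩⟩)) <;> rw [h, ← hn] <;> ring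
        · by_cases h4 : 2 * (m : ℤ) - 2 ∣ l + x
          · obtain ⟨n, hn⟩ := h4
            obtain ⟨γ, hγ, h⟩ := exists_reflection m n
            refine (sw_congr (swappable_succ m _) (swappable_succ m _) (pairClass_eq_iff.2
              ⟨γ, hγ, Or.inr ⟨?_, ?_⟩⟩)) <;> rw [h, ← hn] <;> ring
          · exact absurd (simple_le_iff h3 h4) h1
      rw [h2] at ih
      have := across_simple_mul f l
      have hp : ∀ a b : ℕ, Even a → (b = a ∨ b = a + 2 ∨ a = b + 2) → Even b := by
        intro a b ha h
        rw [Nat.even_iff] at *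
        omega
      refine hp _ _ ih ?_
      split_ifs at this <;> omega
termination_by f.cross

/-! ### Bruhat covers and the matchings given by simple reflections. -/

/-- `g` is the resolution of a crossing of `f`, and has exactly one crossing less than `f`. -/
def Cov (f g : FullPerm m) : Prop :=
  ∃ x y, f.IsLiftedCrossing x y ∧ g = f * sw m x y ∧ g.cross + 1 = f.cross

theorem across_mul_sw_le {f : FullPerm m} {x y : ℤ} (h : f.IsLiftedCrossing x y) (l : Fin m) :
    (f * sw m x y).across (l : ℕ) ≤ f.across (l : ℕ) := by
  obtain ⟨e, he⟩ := twiceWeight_resolve h l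
  rw [← resolve_eq h]
  change f.across (l : ℕ) = FullPerm.across (f.resolve x y h) (l : ℕ) + 2 * e at he
  omega

theorem Cov.across_le {f g : FullPerm m} (h : Cov f g) (l : Fin m) :
    g.across (l : ℕ) ≤ f.across (l : ℕ) := by
  obtain ⟨x, y, hc, rfl, -⟩ := h
  exact across_mul_sw_le hc l

theorem crossing_inv {f : FullPerm m} {x y : ℤ} (h : f.IsLiftedCrossing x y) :
    f⁻¹.IsLiftedCrossing (f x) (f y) := by
  rw [crossing_iff] at *
  rw [inv_apply_self, inv_apply_self]
  tauto

theorem inv_mul_sw (f : FullPerm m) {x y : ℤ} (h : Swappable m x y) :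
    (f * sw m x y)⁻¹ = f⁻¹ * sw m (f x) (f y) := by
  rw [mul_sw f h, mul_inv_rev, sw_inv]

theorem Cov.inv {f g : FullPerm m} (h : Cov f g) : Cov f⁻¹ g⁻¹ := by
  obtain ⟨x, y, hc, rfl, h1⟩ := h
  exact ⟨f x, f y, crossing_inv hc, inv_mul_sw f hc.swappable, by
    rw [cross_inv, cross_inv, h1]⟩

/-- The lifting property of the Bruhat order: on the targets of the two strands a simple reflection
preserves the order, unless it exchanges exactly these two targets, and then it is itself the
resolution. -/
theorem crossing_simple_mul (l : ℤ) {u : FullPerm m} {x y : ℤ} (h : u.IsLiftedCrossing x y) :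
    u * sw m x y = simple m l * u ∨ (simple m l * u).IsLiftedCrossing x y := by
  have hs := h.swappable
  wlog hxy : x < y generalizing x y
  · rcases this h.symm h.symm.swappable (by rw [crossing_iff] at h; omega) with h1 | h1
    · left; rw [sw_comm hs]; exact h1
    · exact Or.inr h1.symm
  have h' : u y < u x := by rw [crossing_iff] at h; omega
  by_cases hlt : simple m l (u x) < simple m l (u y)
  · left
    rw [mul_sw u hs, sw_comm (u.swappable_map hs), (sw_eq_simple_of_crossing h' hlt).2]
  · right
    refine crossing_of_lt hxy (lt_of_le_of_ne (not_lt.1 hlt) fun e => ?_)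
    rw [mul_apply, mul_apply, apply_eq_iff] at e
    omega

/-- The product on the left is either f itself or a resolution of the product with f, and a
resolution does not increase the strand counts. It follows that the sets left over by the
cancellations are closed upwards. -/
theorem Cov.across_simple_mul_le (j : ℤ) {f g : FullPerm m} (h : Cov f g) {l : Fin m} {K : ℕ}
    (hf : f.across (l : ℕ) ≤ K) (hsf : (simple m j * f).across (l : ℕ) ≤ K) :
    (simple m j * g).across (l : ℕ) ≤ K := by
  obtain ⟨x, y, hc, rfl, -⟩ := h
  rcases crossing_simple_mul j hc with h1 | h1
  · rwa [h1, simple_mul_simple_mul]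
  · rw [← mul_assoc]
    exact (across_mul_sw_le h1 l).trans hsf

theorem Cov.across_mul_simple_le (j : ℤ) {f g : FullPerm m} (h : Cov f g) {l : Fin m} {K : ℕ}
    (hf : f.across (l : ℕ) ≤ K) (hsf : (f * simple m j).across (l : ℕ) ≤ K) :
    (g * simple m j).across (l : ℕ) ≤ K := by
  have := h.inv.across_simple_mul_le j (l := l) (K := K)
  rw [across_inv, ← inv_mul_simple, ← inv_mul_simple, across_inv, across_inv] at this
  exact this hf hsf

/-- A perfect matching `τ` on `D` that pairs elements which differ by a resolution, such that a
matched upper element covers no lower element other than its partner. -/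
structure IsMatching (D : Set (FullPerm m)) (τ : FullPerm m → FullPerm m) : Prop where
  maps : ∀ f ∈ D, τ f ∈ D
  invol : ∀ f ∈ D, τ (τ f) = f
  cov : ∀ f ∈ D, (τ f).cross < f.cross → Cov f (τ f)
  cross_ne : ∀ f ∈ D, (τ f).cross ≠ f.cross
  rigid : ∀ u ∈ D, ∀ g ∈ D, Cov u g → (τ u).cross < u.cross → g = τ u ∨ (τ g).cross < g.cross

theorem Cov.simple_mul {f : FullPerm m} {l : ℤ} (h : (simple m l * f).cross < f.cross) :
    Cov f (simple m l * f) := by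
  rcases cross_simple_mul_cases f l with h1 | h1
  · omega
  · refine ⟨f⁻¹ l, f⁻¹ (l + 1), crossing_iff.2 (Or.inr ⟨h1.1, ?_⟩),
      sw_mul_eq f (swappable_succ m l), h1.2⟩
    rw [apply_inv_self, apply_inv_self]; omega

/-- The rigidity is the lifting property: if u is matched downwards and covers g other than its
partner, then the partner of g is a resolution of the partner of u, so g is matched downwards too.
-/
theorem isMatching_simple_mul {D : Set (FullPerm m)} {l : ℤ} (h : ∀ f ∈ D, simple m l * f ∈ D) :
    IsMatching D (simple m l * ·) where
  maps := h
  invol f _ := simple_mul_simple_mul l f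
  cov f _ hf := Cov.simple_mul hf
  cross_ne f _ := by
    rcases cross_simple_mul_cases f l with h1 | h1 <;> omega
  rigid u _ g _ hc hu := by
    obtain ⟨x, y, hxy, rfl, h1⟩ := hc
    rcases crossing_simple_mul l hxy with h2 | h2
    · exact Or.inl h2
    · right
      have := cross_mul_sw_lt h2
      rw [mul_assoc] at this
      omega

theorem IsMatching.inv {D : Set (FullPerm m)} {τ : FullPerm m → FullPerm m} (h : IsMatching D τ) :
    IsMatching {f | f⁻¹ ∈ D} (fun f => (τ f⁻¹)⁻¹) where
  maps f hf := by
    rw [Set.mem_ofPred_eq, inv_inv]; exact h.maps _ hf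
  invol f hf := by rw [inv_inv, h.invol _ hf, inv_inv]
  cov f hf hlt := by
    rw [cross_inv, ← cross_inv f] at hlt
    have := (h.cov _ hf hlt).inv
    rwa [inv_inv] at this
  cross_ne f hf := by
    rw [cross_inv, ← cross_inv f]
    exact h.cross_ne _ hf
  rigid u hu g hg hc hlt := by
    rw [cross_inv, ← cross_inv u] at hlt
    rw [cross_inv, ← cross_inv g]
    refine (h.rigid _ hu _ hg hc.inv hlt).imp_left fun e => ?_
    rw [← e, inv_inv]

theorem isMatching_mul_simple {D : Set (FullPerm m)} {l : ℤ} (h : ∀ f ∈ D, f * simple m l ∈ D) :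
    IsMatching D (· * simple m l) := by
  have h1 : IsMatching {f : FullPerm m | f⁻¹ ∈ D} (simple m l * ·) := isMatching_simple_mul fun f hf => by
    have := h _ hf
    rw [Set.mem_ofPred_eq, mul_inv_rev, sw_inv]; exact this
  have h2 := h1.inv
  have e1 : {f : FullPerm m | f⁻¹ ∈ {f : FullPerm m | f⁻¹ ∈ D}} = D := by
    ext f; rw [Set.mem_ofPred_eq, Set.mem_ofPred_eq, inv_inv]
  have e2 : (fun f : FullPerm m => (simple m l * f⁻¹)⁻¹) = (· * simple m l) := by
    funext f; rw [mul_inv_rev, inv_inv, sw_inv]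
  rwa [e1, e2] at h2

/-! ### Nonconstant weights: everything cancels. -/

/-- The local multiplicities of `f` are at most `w`. -/
def Bounded (w : Fin m → ℕ) (f : FullPerm m) : Prop := ∀ l : Fin m, f.across (l : ℕ) ≤ 2 * w l

theorem simple_le_iff_of_ne {i j : ℕ} (hi : i < m) (hj : j < m) (h : i ≠ j) (x : ℤ) :
    simple m i x ≤ j ↔ x ≤ j := by
  refine simple_le_iff ?_ ?_ x
  · intro hd
    have := eq_zero_of_period_dvd hd (by omega) (by omega)
    omega
  · intro hd
    have := eq_zero_of_period_dvd hd (by omega) (by omega)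
    omega

theorem across_simple_mul_of_ne (f : FullPerm m) {i j : ℕ} (hi : i < m) (hj : j < m) (h : i ≠ j) :
    (simple m i * f).across j = f.across j :=
  across_mul_of_le_iff _ _ (simple_le_iff_of_ne hi hj h)

theorem across_mul_simple_of_ne (f : FullPerm m) {i j : ℕ} (hi : i < m) (hj : j < m) (h : i ≠ j) :
    (f * simple m i).across j = f.across j := by
  rw [← across_inv, inv_mul_simple, across_simple_mul_of_ne _ hi hj h, across_inv]

/-- The count grows only when the strands ending at l and l + 1 both stay on their own side of the
line; then both are made to cross it. -/
theorem across_simple_mul_le_or (f : FullPerm m) (l : ℤ) :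
    ((simple m l * f).across l ≤ f.across l ∧ ¬ (f⁻¹ l ≤ l ∧ l + 1 ≤ f⁻¹ (l + 1))) ∨
      (f⁻¹ l ≤ l ∧ l + 1 ≤ f⁻¹ (l + 1) ∧ (simple m l * f).across l = f.across l + 2) := by
  have := across_simple_mul f l
  split_ifs at this <;> omega

theorem bounded_simple_mul {w : Fin m → ℕ} {f : FullPerm m} (hf : Bounded w f) {j : Fin m}
    (h : (simple m (j : ℕ) * f).across (j : ℕ) ≤ 2 * w j) : Bounded w (simple m (j : ℕ) * f) := by
  intro l
  by_cases e : l = j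
  · rw [e]; exact h
  · rw [across_simple_mul_of_ne f j.2 l.2 fun e' => e (Fin.ext e'.symm)]
    exact hf l

theorem bounded_inv {w : Fin m → ℕ} {f : FullPerm m} : Bounded w f⁻¹ ↔ Bounded w f := by
  unfold Bounded
  simp only [across_inv]

theorem bounded_mul_simple {w : Fin m → ℕ} {f : FullPerm m} (hf : Bounded w f) {j : Fin m}
    (h : (f * simple m (j : ℕ)).across (j : ℕ) ≤ 2 * w j) : Bounded w (f * simple m (j : ℕ)) := by
  rw [← bounded_inv, inv_mul_simple]
  refine bounded_simple_mul (bounded_inv.2 hf) ?_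
  rwa [← inv_mul_simple, across_inv]

/-- If the weight `w` is not constant, the complex of the elements of weight at most `w` is stable
under the left multiplication by some simple reflection. -/
theorem exists_simple_bounded {w : Fin m → ℕ} (hw : ¬ ∃ k, ∀ l, w l = k) :
    ∃ j : Fin m, ∀ f, Bounded w f → Bounded w (simple m (j : ℕ) * f) := by
  -- The reflection is taken at the larger one of two adjacent unequal bounds.
  obtain ⟨l, hl, hne⟩ : ∃ l : ℕ, ∃ hl : l + 1 < m, w ⟨l, by omega⟩ ≠ w ⟨l + 1, hl⟩ := by
    by_contra! h
    have h0 : 0 < m := by have := ‹m.AtLeastTwo›.prop; omega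
    refine hw ⟨w ⟨0, h0⟩, fun l => ?_⟩
    obtain ⟨l, hl⟩ := l
    induction l with
    | zero => rfl
    | succ l ih => rw [← h l hl]; exact ih _
  have key := fun f : FullPerm m => across_sub_one f (l + 1)
  rw [add_sub_cancel_right] at key
  rcases lt_or_gt_of_ne hne with h | h
  -- If the product violated the larger bound, f would attain this bound by parity, and the strand
  -- ending at l + 1 would not come from the right. The conservation law at l + 1 then gives at
  -- least as many strands over the neighbouring line, against the smaller bound there.
  · refine ⟨⟨l + 1, hl⟩, fun f hf => bounded_simple_mul hf ?_⟩
    have h1 := hf ⟨l, by omega⟩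
    have h2 := hf ⟨l + 1, hl⟩
    have h3 := key f
    have h4 := across_simple_mul_le_or f (l + 1)
    have h5 := even_across f (l + 1)
    have h6 : f (l + 1) = l + 1 ↔ f⁻¹ (l + 1) = l + 1 := inv_apply_eq.symm
    push_cast at h2 ⊢
    change f.across (l : ℤ) ≤ _ at h1
    rw [Nat.even_iff] at h5
    split_ifs at h3 <;> omega
  · refine ⟨⟨l, by omega⟩, fun f hf => bounded_simple_mul hf ?_⟩
    have h1 := hf ⟨l, by omega⟩
    have h2 := hf ⟨l + 1, hl⟩
    have h3 := key f
    have h4 := across_simple_mul_le_or f l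
    have h5 := even_across f l
    have h6 : f (l + 1) = l + 1 ↔ f⁻¹ (l + 1) = l + 1 := inv_apply_eq.symm
    push_cast at h2
    change f.across (l : ℤ) ≤ _ at h1
    change (simple m (l : ℤ) * f).across (l : ℤ) ≤ _
    rw [Nat.even_iff] at h5
    split_ifs at h3 <;> omega

theorem simple_apply_of_far {i j : ℕ} (hj : j < m) (h : i + 2 ≤ j ∨ j + 2 ≤ i) (hi : i < m) :
    simple m i j = j ∧ simple m i (j + 1) = j + 1 := by
  constructor <;> refine simple_apply_of_not_dvd ?_ ?_ ?_ ?_ <;> intro hd <;>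
    have := eq_zero_of_period_dvd hd (by omega) (by omega) <;> omega

theorem simple_commute {i j : ℕ} (hi : i < m) (hj : j < m) (h : i + 2 ≤ j ∨ j + 2 ≤ i) :
    simple m i * simple m j = simple m j * simple m i := by
  rw [mul_sw _ (swappable_succ m j)]
  rcases h with h | h
  · rw [(simple_apply_of_far hj (Or.inl h) hi).1, (simple_apply_of_far hj (Or.inl h) hi).2]
  · rw [(simple_apply_of_far hj (Or.inr h) hi).1, (simple_apply_of_far hj (Or.inr h) hi).2]

/-- `R` is what remains of the set `C` after a succession of cancellations along matchings, such that
all the remaining sets are closed upwards. -/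
inductive Collapses (C : Set (FullPerm m)) : Set (FullPerm m) → Prop
  | refl : Collapses C C
  | step {R R' : Set (FullPerm m)} (τ : FullPerm m → FullPerm m) : Collapses C R → R' ⊆ R →
      (∀ f ∈ C, ∀ g ∈ R', Cov f g → f ∈ R') → IsMatching (R \ R') τ → Collapses C R'

theorem collapses_empty {w : Fin m → ℕ} (hw : ¬ ∃ k, ∀ l, w l = k) :
    Collapses {f | Bounded w f} ∅ := by
  obtain ⟨j, hj⟩ := exists_simple_bounded hw
  refine .step (simple m (j : ℕ) * ·) .refl (Set.empty_subset _) (fun f _ g hg => absurd hg id) ?_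
  rw [Set.sdiff_empty]
  exact isMatching_simple_mul hj

/-! ### Constant weights: reduction to juggling permutations. -/

/-- Multiplication by the simple reflection at `j`, on the left or on the right according to the
parity of `j`. -/
noncomputable def bump (j : ℕ) (f : FullPerm m) : FullPerm m :=
  if Even j then simple m j * f else f * simple m j

theorem bump_bump (j : ℕ) (f : FullPerm m) : bump j (bump j f) = f := by
  unfold bump
  split_ifs
  · exact simple_mul_simple_mul _ _
  · exact mul_simple_mul_simple _ _

theorem across_bump_of_ne (f : FullPerm m) {i j : ℕ} (hi : i < m) (hj : j < m) (h : i ≠ j) :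
    (bump i f).across j = f.across j := by
  unfold bump
  split_ifs
  · exact across_simple_mul_of_ne f hi hj h
  · exact across_mul_simple_of_ne f hi hj h

/-- Indices of opposite parity act from opposite sides. Distinct indices of equal parity differ by
at least two, and then the simple reflections commute. -/
theorem bump_comm (f : FullPerm m) {i j : ℕ} (hi : i < m) (hj : j < m) (h : i ≠ j) :
    bump i (bump j f) = bump j (bump i f) := by
  unfold bump
  split_ifs with h1 h2 h2
  · rw [← mul_assoc, ← mul_assoc, simple_commute hi hj (by rw [Nat.even_iff] at *; omega)]
  · rw [mul_assoc]
  · rw [mul_assoc]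
  · rw [mul_assoc, mul_assoc, simple_commute hj hi (by rw [Nat.even_iff] at *; omega)]

theorem Cov.across_bump_le (j : Fin m) {f g : FullPerm m} (h : Cov f g) {K : ℕ}
    (hf : f.across (j : ℕ) ≤ K) (hsf : (bump (j : ℕ) f).across (j : ℕ) ≤ K) :
    (bump (j : ℕ) g).across (j : ℕ) ≤ K := by
  unfold bump at *
  split_ifs at *
  · exact h.across_simple_mul_le _ hf hsf
  · exact h.across_mul_simple_le _ hf hsf

theorem isMatching_bump {D : Set (FullPerm m)} {j : ℕ} (h : ∀ f ∈ D, bump j f ∈ D) :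
    IsMatching D (bump j) := by
  by_cases hj : Even j
  · have e : (bump j : FullPerm m → FullPerm m) = (simple m j * ·) := by
      funext f; exact if_pos hj
    rw [e] at h ⊢
    exact isMatching_simple_mul h
  · have e : (bump j : FullPerm m → FullPerm m) = (· * simple m j) := by
      funext f; exact if_neg hj
    rw [e] at h ⊢
    exact isMatching_mul_simple h

theorem bounded_bump {w : Fin m → ℕ} {f : FullPerm m} (hf : Bounded w f) {j : Fin m}
    (h : (bump (j : ℕ) f).across (j : ℕ) ≤ 2 * w j) : Bounded w (bump (j : ℕ) f) := by
  unfold bump at *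
  split_ifs at *
  · exact bounded_simple_mul hf h
  · exact bounded_mul_simple hf h

/-- At stage j the elements whose bump at j stays within the bound are matched by it. The bumps
commute and each affects only its own line, so the conditions from earlier stages are preserved. -/
theorem collapses_bump (k : ℕ) {j : ℕ} (hj : j ≤ m) :
    Collapses {f : FullPerm m | Bounded (fun _ => k) f}
      {f | Bounded (fun _ => k) f ∧ ∀ i < j, 2 * k < (bump i f).across i} := by
  induction j with
  | zero =>
    have e : {f : FullPerm m | Bounded (fun _ => k) f ∧ ∀ i < 0, 2 * k < (bump i f).across i} =
        {f | Bounded (fun _ => k) f} := by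
      ext f; simp
    rw [e]; exact .refl
  | succ j ih =>
    refine .step (bump j) (ih (by omega)) (fun f hf => ⟨hf.1, fun i hi => hf.2 i (by omega)⟩) ?_ ?_
    · intro f hf g hg hc
      refine ⟨hf, fun i hi => ?_⟩
      -- If the bump of f stayed within the bound, so would the bump of every element that f covers,
      -- in particular that of g.
      by_contra! hlt
      have := hc.across_bump_le ⟨i, by omega⟩ (hf ⟨i, by omega⟩) hlt
      have := hg.2 i hi
      change (bump i g).across (i : ℕ) ≤ 2 * k at *
      omega
    · refine isMatching_bump fun f hf => ?_
      obtain ⟨⟨h1, h2⟩, h3⟩ := hf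
      have h4 : (bump j f).across j ≤ 2 * k := by
        by_contra! h4
        refine h3 ⟨h1, fun i hi => ?_⟩
        rcases Nat.lt_succ_iff_lt_or_eq.1 hi with h5 | rfl
        · exact h2 i h5
        · exact h4
      refine ⟨⟨bounded_bump (j := ⟨j, hj⟩) h1 h4, fun i hi => ?_⟩, fun h => ?_⟩
      · rw [bump_comm f (by omega) hj (by omega), across_bump_of_ne _ hj (by omega) (by omega)]
        exact h2 i hi
      · have h5 := h.2 j (by omega)
        rw [bump_bump] at h5
        have := h1 ⟨j, hj⟩
        change f.across (j : ℕ) ≤ 2 * k at this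
        omega

theorem exists_fundamental {m : ℕ} (hm : 2 ≤ m) (x : ℤ) : ∃ y : ℤ, 1 ≤ y ∧ y ≤ m - 1 ∧
    (2 * (m : ℤ) - 2 ∣ x - y ∨ 2 * (m : ℤ) - 2 ∣ x - (1 - y)) := by
  have h1 := Int.emod_nonneg x (b := 2 * (m : ℤ) - 2) (by omega)
  have h2 := Int.emod_lt_of_pos x (b := 2 * (m : ℤ) - 2) (by omega)
  have h3 : 2 * (m : ℤ) - 2 ∣ x - x % (2 * (m : ℤ) - 2) := Int.dvd_self_sub_emod
  generalize x % (2 * (m : ℤ) - 2) = y at *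
  rcases lt_trichotomy y 0 with h | h | h
  · omega
  · exact ⟨1, by omega, by omega, Or.inr (by rw [h] at h3; simpa using h3)⟩
  · by_cases h' : y ≤ m - 1
    · exact ⟨y, by omega, h', Or.inl h3⟩
    · refine ⟨1 - y + (2 * m - 2), by omega, by omega, Or.inr ?_⟩
      rw [show x - (1 - (1 - y + (2 * (m : ℤ) - 2))) = x - y + (2 * m - 2) by ring]
      exact dvd_add h3 dvd_rfl

/-- `f` maps even numbers to larger even numbers (hence odd numbers to smaller odd numbers). -/
def Juggling {m : ℕ} (f : FullPerm m) : Prop := ∀ x, Even x → Even (f x) ∧ x ≤ f x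

theorem Juggling.odd {m : ℕ} {f : FullPerm m} (h : Juggling f) {x : ℤ} (hx : ¬ Even x) :
    ¬ Even (f x) ∧ f x ≤ x := by
  have := h (1 - x) (by rw [Int.even_iff] at *; omega)
  rw [apply_reflect, Int.even_iff] at this
  rw [Int.even_iff]
  omega

theorem Juggling.even_iff {m : ℕ} {f : FullPerm m} (h : Juggling f) {x : ℤ} : Even (f x) ↔ Even x :=
  ⟨fun h1 => by_contra fun h2 => (h.odd h2).1 h1, fun h1 => (h x h1).1⟩

theorem Juggling.inv {f : FullPerm m} (h : Juggling f) {x : ℤ} (hx : Even x) :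
    Even (f⁻¹ x) ∧ f⁻¹ x ≤ x := by
  have h1 : Even (f⁻¹ x) := by rwa [← h.even_iff, apply_inv_self]
  have := h _ h1
  rw [apply_inv_self] at this
  exact ⟨h1, this.2⟩

theorem Juggling.inv_odd {f : FullPerm m} (h : Juggling f) {x : ℤ} (hx : ¬ Even x) :
    ¬ Even (f⁻¹ x) ∧ x ≤ f⁻¹ x := by
  have h1 : ¬ Even (f⁻¹ x) := by rwa [← h.even_iff, apply_inv_self]
  have := h.odd h1
  rw [apply_inv_self] at this
  exact ⟨h1, this.2⟩

/-- The inequalities pass to all integers by equivariance, since a reflection changes both the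
parity and the direction. -/
theorem juggling_of_fundamental {f : FullPerm m} (h : ∀ x : ℤ, 1 ≤ x → x ≤ m - 1 →
    (Even x → x ≤ f x ∧ f⁻¹ x ≤ x) ∧ (¬ Even x → f x ≤ x ∧ x ≤ f⁻¹ x)) : Juggling f := by
  have key : ∀ x : ℤ, (Even x → x ≤ f x ∧ f⁻¹ x ≤ x) ∧ (¬ Even x → f x ≤ x ∧ x ≤ f⁻¹ x) := by
    intro x
    obtain ⟨y, hy1, hy2, hd⟩ := exists_fundamental ‹m.AtLeastTwo›.prop x
    have h0 := h y hy1 hy2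
    rw [Int.even_iff] at *
    rcases hd with hd | hd
    · rw [f.apply_sub_of_dvd hd, f⁻¹.apply_sub_of_dvd hd]
      have := even_of_period_dvd hd
      rw [Int.even_iff] at this
      omega
    · rw [f.apply_sub_of_dvd hd, f⁻¹.apply_sub_of_dvd hd, apply_reflect, apply_reflect]
      have := even_of_period_dvd hd
      rw [Int.even_iff] at this
      omega
  intro x hx
  -- Parity is preserved automatically: if `f x` were odd, its preimage x would be at least `f x`.
  -- But x is at most `f x`, so they would be equal and x would be odd.
  refine ⟨by_contra fun h1 => ?_, ((key x).1 hx).1⟩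
  have h2 := ((key (f x)).2 h1).2
  have h3 := ((key x).1 hx).1
  rw [inv_apply_self] at h2
  exact h1 (by rwa [le_antisymm h2 h3])

/-- Unless x is fixed, one strand arrives at x and another continues from x in the same direction,
so the conservation law gives equal counts on both sides of x. -/
theorem Juggling.across_eq {f : FullPerm m} (h : Juggling f) (l l' : ℤ) :
    f.across l = f.across l' := by
  have key : ∀ x, f.across (x - 1) = f.across x := by
    intro x
    have h1 := across_sub_one f x
    have h6 : f x = x ↔ f⁻¹ x = x := inv_apply_eq.symm
    by_cases hx : Even x
    · have h2 := h x hx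
      have h3 := h.inv hx
      split_ifs at h1 <;> omega
    · have h2 := h.odd hx
      have h3 := h.inv_odd hx
      split_ifs at h1 <;> omega
  have key' : ∀ (x : ℤ) (k : ℕ), f.across (x + k) = f.across x := by
    intro x k
    induction k with
    | zero => simp
    | succ k ih => rw [← key, ← ih]; congr 1; push_cast; ring
  rcases le_total l l' with hl | hl
  · obtain ⟨k, hk⟩ := Int.le.dest hl
    rw [← hk, key']
  · obtain ⟨k, hk⟩ := Int.le.dest hl
    rw [← hk, key']

/-- By parity of the counts, a bump leaves the bound exactly when the count is 2k and the two
strands at the line stay on their sides. For even lines these are the strands ending next to the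
line, for odd lines those starting there. -/
theorem bounded_and_bump_iff {k : ℕ} {f : FullPerm m} :
    (Bounded (fun _ => k) f ∧ ∀ i < m, 2 * k < (bump i f).across i) ↔
      Juggling f ∧ f.across (m - 1) = 2 * k := by
  have hm : 2 ≤ m := ‹m.AtLeastTwo›.prop
  have hb : ∀ j : ℕ, (Even j ∧ (bump j f).across j = (simple m j * f).across j) ∨
      (¬ Even j ∧ (bump j f).across j = (simple m j * f⁻¹).across j) := by
    intro j
    unfold bump
    split_ifs with h
    · exact Or.inl ⟨h, rfl⟩
    · right; rw [← inv_mul_simple, across_inv]; exact ⟨h, rfl⟩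
  constructor
  · rintro ⟨h1, h2⟩
    have hline : ∀ j : ℕ, j < m → f.across (j : ℤ) = 2 * k ∧
        (Even j → f⁻¹ j ≤ j ∧ j + 1 ≤ f⁻¹ (j + 1)) ∧ (¬ Even j → f j ≤ j ∧ j + 1 ≤ f (j + 1)) := by
      intro j hj
      have h3 := h1 ⟨j, hj⟩
      have h4 := h2 j hj
      change f.across (j : ℤ) ≤ 2 * k at h3
      have h5 := even_across f j
      rw [Nat.even_iff] at h5
      rcases hb j with ⟨h6, h7⟩ | ⟨h6, h7⟩
      · have h8 := across_simple_mul_le_or f j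
        refine ⟨by omega, fun _ => by omega, fun h => absurd h6 h⟩
      · have h8 := across_simple_mul_le_or f⁻¹ j
        rw [inv_inv, across_inv] at h8
        refine ⟨by omega, fun h => absurd h h6, fun _ => by omega⟩
    refine ⟨juggling_of_fundamental fun x hx1 hx2 => ?_, ?_⟩
    -- A number in the fundamental domain has a line of each parity beside it: one gives the
    -- condition on f and the other the condition on its inverse.
    · obtain ⟨j, rfl⟩ : ∃ j : ℕ, x = (j : ℤ) + 1 := ⟨(x - 1).toNat, by omega⟩
      have h3 := (hline j (by omega)).2
      have h4 := (hline (j + 1) (by omega)).2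
      push_cast at h4
      rw [Int.even_iff]
      rw [Nat.even_iff] at h3 h4
      omega
    · have := (hline (m - 1) (by omega)).1
      rwa [Nat.cast_sub (by omega), Nat.cast_one] at this
  · rintro ⟨h1, h2⟩
    refine ⟨fun l => ?_, fun j hj => ?_⟩
    · rw [h1.across_eq _ (m - 1), h2]
    · have h0 := h1.across_eq j (m - 1)
      have e0 : Even (j : ℤ) ↔ Even j := Int.even_coe_nat j
      have e1 : ¬ Even (j : ℤ) ↔ Even ((j : ℤ) + 1) := Int.even_add_one.symm
      rcases hb j with ⟨h6, h7⟩ | ⟨h6, h7⟩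
      · have h8 := across_simple_mul_le_or f j
        have h9 := h1.inv (e0.2 h6)
        have h10 := h1.inv_odd fun h => e1.2 h (e0.2 h6)
        omega
      · have h8 := across_simple_mul_le_or f⁻¹ j
        rw [inv_inv, across_inv] at h8
        have h9 := h1.odd fun h => h6 (e0.1 h)
        have h10 := h1 _ (e1.1 fun h => h6 (e0.1 h))
        omega

/-! ### Cancellation among the juggling permutations. -/

/-- The reflections in G_m change parity, so only translations relate even numbers. A juggling
permutation is thus determined by its action on the even numbers, where only congruence modulo the
period matters. -/
theorem sw_apply_even {x y e : ℤ} (hs : Swappable m x y) (hx : Even x) (hy : Even y)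
    (he : Even e) :
    (2 * (m : ℤ) - 2 ∣ e - x ∧ sw m x y e = e - x + y) ∨
    (2 * (m : ℤ) - 2 ∣ e - y ∧ sw m x y e = e - y + x) ∨
    (¬ 2 * (m : ℤ) - 2 ∣ e - x ∧ ¬ 2 * (m : ℤ) - 2 ∣ e - y ∧ sw m x y e = e) := by
  have h1 : ¬ 2 * (m : ℤ) - 2 ∣ e + x - 1 := fun h => by
    have := even_of_period_dvd h
    rw [Int.even_iff] at *; omega
  have h2 : ¬ 2 * (m : ℤ) - 2 ∣ e + y - 1 := fun h => by
    have := even_of_period_dvd h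
    rw [Int.even_iff] at *; omega
  rw [sw_apply hs, swapAt_apply hs, if_neg h1, if_neg h2]
  split_ifs with h3 h4
  · exact Or.inl ⟨h3, rfl⟩
  · exact Or.inr (Or.inl ⟨h4, rfl⟩)
  · exact Or.inr (Or.inr ⟨h3, h4, rfl⟩)

theorem _root_.Pong.LiftedPartialPerm.IsLiftedCrossing.reflect {f : FullPerm m} {x y : ℤ}
    (h : f.IsLiftedCrossing x y) :
    f.IsLiftedCrossing (1 - x) (1 - y) ∧ sw m (1 - x) (1 - y) = sw m x y := by
  obtain ⟨γ, hγ, e⟩ := exists_reflection m 0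
  have h1 := h.smul hγ
  rw [e, e, mul_zero, add_zero, add_zero] at h1
  refine ⟨h1, (sw_congr h.swappable h1.swappable (pairClass_eq_iff.2 ⟨γ, hγ, Or.inl ?_⟩)).symm⟩
  rw [e, e, mul_zero, add_zero, add_zero]; exact ⟨rfl, rfl⟩

/-- A resolution between two juggling permutations exchanges two even numbers. -/
theorem Cov.exists_even {f g : FullPerm m} (h : Cov f g) (hf : Juggling f) (hg : Juggling g) :
    ∃ x y, Even x ∧ Even y ∧ x < y ∧ f y < f x ∧ Swappable m x y ∧ g = f * sw m x y := by
  obtain ⟨x, y, hc, rfl, -⟩ := h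
  have hxy : Even x ↔ Even y := by
    have h1 := hg.even_iff (x := x)
    rw [mul_apply, sw_left hc.swappable, hf.even_iff] at h1
    exact h1.symm
  wlog hx : Even x generalizing x y
  · have h1 := hc.reflect
    rw [← h1.2]
    refine this (1 - x) (1 - y) h1.1 (by rwa [h1.2]) ?_ ?_ <;> rw [Int.even_iff] at * <;>
    rw [Int.even_iff] at * <;> omega
  wlog hlt : x < y generalizing x y
  · rw [sw_comm hc.swappable] at hg ⊢
    refine this y x hc.symm hg hxy.symm (hxy.1 hx) ?_
    rw [crossing_iff] at hc; omega
  refine ⟨x, y, hx, hxy.1 hx, hlt, ?_, hc.swappable, rfl⟩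
  rw [crossing_iff] at hc; omega

/-- Fixed even numbers stay fixed when a crossing is created. -/
theorem Cov.apply_eq_self {f g : FullPerm m} (h : Cov f g) (hf : Juggling f) (hg : Juggling g)
    {e : ℤ} (he : Even e) (hge : g e = e) : f e = e := by
  obtain ⟨x, y, hx, hy, hlt, hlt', hs, rfl⟩ := h.exists_even hf hg
  rw [mul_apply] at hge
  have h1 := hf x hx
  have h2 := hf y hy
  -- If e is congruent to x, then `g e = e` means `f y = x < y`, and f would move y to the left. If
  -- e is congruent to y, it means `f x = y`, and then `f y < f x` puts `f y` below y.
  rcases sw_apply_even hs hx hy he with ⟨h3, h4⟩ | ⟨h3, h4⟩ | ⟨-, -, h4⟩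
  · rw [h4] at hge
    have := f.apply_sub_of_dvd (x := y) (y := e - x + y) (by rwa [add_sub_cancel_right])
    omega
  · rw [h4] at hge
    have := f.apply_sub_of_dvd (x := x) (y := e - y + x) (by rwa [add_sub_cancel_right])
    omega
  · rwa [h4] at hge

/-- The smallest of the even numbers that are considered in the cancellation of the juggling
permutations. -/
def pivot (m : ℕ) : ℤ := 2 * ((3 - (m : ℤ)) / 2)

/-- The juggling permutations of weight `k` that fix all even numbers after `q`, up to the last
one which is not congruent to the pivot. -/
def rest (m k : ℕ) [m.AtLeastTwo] (q : ℤ) : Set (FullPerm m) :=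
  {f | (Juggling f ∧ f.across (m - 1) = 2 * k) ∧
    ∀ e, Even e → q < e → e ≤ pivot m + (2 * m - 4) → f e = e}

theorem swappable_two {m : ℕ} (hm : 3 ≤ m) (q : ℤ) : Swappable m (q - 2) q := by
  rw [swappable_iff]
  intro h
  rw [sub_sub_cancel] at h
  have := eq_zero_of_period_dvd h (by omega) (by omega)
  omega

theorem sw_two_apply (hm : 3 ≤ m) {q : ℤ} (hq : Even q) {e : ℤ} (he : Even e) :
    (2 * (m : ℤ) - 2 ∣ e - (q - 2) ∧ sw m (q - 2) q e = e + 2) ∨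
    (2 * (m : ℤ) - 2 ∣ e - q ∧ sw m (q - 2) q e = e - 2) ∨
    (¬ 2 * (m : ℤ) - 2 ∣ e - (q - 2) ∧ ¬ 2 * (m : ℤ) - 2 ∣ e - q ∧ sw m (q - 2) q e = e) := by
  have := sw_apply_even (swappable_two hm q) (by rw [Int.even_iff] at *; omega) hq he
  rw [show e - (q - 2) + q = e + 2 by ring, show e - q + (q - 2) = e - 2 by ring] at this
  exact this

/-- The exchange of two consecutive even numbers is the conjugate of one simple reflection by its
neighbour. The window from `pivot m` to `pivot m + (2 * m - 4)` contains one even number from each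
orbit, and inside it no wall comes between q - 2 and q, so q is fixed by the conjugating reflection.
-/
theorem sw_two_eq (hm : 3 ≤ m) {q : ℤ} (h1 : pivot m + 2 ≤ q)
    (h2 : q ≤ pivot m + (2 * m - 4)) (hq : Even q) :
    sw m (q - 2) q = simple m (q - 2) * (simple m (q - 1) * simple m (q - 2)) ∧
      simple m (q - 2) q = q := by
  unfold pivot at h1 h2
  rw [Int.even_iff] at hq
  have h3 : simple m (q - 2) q = q := by
    refine simple_apply_of_not_dvd ?_ ?_ ?_ ?_ <;> intro hd
    · have := eq_zero_of_period_dvd hd (by omega) (by omega); omega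
    · have := even_of_period_dvd hd
      rw [Int.even_iff] at this; omega
    · have := even_of_period_dvd hd
      rw [Int.even_iff] at this; omega
    -- The sum of q and q - 2 is 2(q - 1). It is smaller in absolute value than the period and
    -- nonzero because q is even.
    · obtain ⟨n, hn⟩ := hd
      have hd' : 2 * (m : ℤ) - 2 ∣ 2 * (q - 1) := ⟨n, by rw [← hn]; ring⟩
      have := eq_zero_of_period_dvd hd' (by omega) (by omega)
      omega
  refine ⟨?_, h3⟩
  have h4 := mul_sw (simple m (q - 2)) (swappable_succ m (q - 1))
  have h5 := simple_right (m := m) (q - 2)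
  rw [show q - 2 + 1 = q - 1 by ring] at h5
  rw [sub_add_cancel, h5, h3] at h4
  have h6 : simple m (q - 1) = sw m (q - 1) q := by rw [simple, sub_add_cancel]
  rw [h6, ← mul_assoc, h4, mul_simple_mul_simple]

/-- The window lies in the strip from 2 - m to m - 1, which has the length of one period and ends at
the line considered. Neither the exchange nor its translates or reflections leave a strip. -/
theorem sw_two_le_iff (hm : 3 ≤ m) {q : ℤ} (h1 : pivot m + 2 ≤ q)
    (h2 : q ≤ pivot m + (2 * m - 4)) (x : ℤ) : sw m (q - 2) q x ≤ m - 1 ↔ x ≤ m - 1 := by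
  unfold pivot at h1 h2
  have key : ∀ a b c : ℤ, 2 * (m : ℤ) - 2 ∣ a - b → (2 - m ≤ b ∧ b ≤ m - 1) → 
      (2 - m ≤ b + c ∧ b + c ≤ m - 1) → (a + c ≤ m - 1 ↔ a ≤ m - 1) := by
    rintro a b c ⟨n, hn⟩ hb hc
    rcases le_or_gt n 0 with h | h
    · have : (2 * (m : ℤ) - 2) * n ≤ 0 := mul_nonpos_of_nonneg_of_nonpos (by omega) h
      omega
    · have : (2 * (m : ℤ) - 2) * 1 ≤ (2 * (m : ℤ) - 2) * n :=
        mul_le_mul_of_nonneg_left (by omega) (by omega)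
      omega
  rw [sw_apply (swappable_two hm q), swapAt_apply (swappable_two hm q)]
  split_ifs with c1 c2 c3 c4
  · rw [show x - (q - 2) + q = x + 2 by ring]
    exact key _ (q - 2) _ c1 (by omega) (by omega)
  · rw [show x + (q - 2) - q = x + (-2) by ring]
    exact key _ (3 - q) _ (by rwa [show x - (3 - q) = x + (q - 2) - 1 by ring]) (by omega)
      (by omega)
  · rw [show x - q + (q - 2) = x + (-2) by ring]
    exact key _ q _ c3 (by omega) (by omega)
  · rw [show x + q - (q - 2) = x + 2 by ring]
    exact key _ (1 - q) _ (by rwa [show x - (1 - q) = x + q - 1 by ring]) (by omega)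
      (by omega)
  · rfl

/-- Only a target congruent to q is lowered, and only by 2. This would break the juggling condition
just for a fixed number congruent to q, that is, if q itself were fixed. -/
theorem Juggling.sw_two_mul (hm : 3 ≤ m) {q : ℤ} (hq : Even q) {f : FullPerm m}
    (hf : Juggling f) (h : f q ≠ q) : Juggling (sw m (q - 2) q * f) := by
  intro x hx
  have h1 := hf x hx
  rw [mul_apply]
  rcases sw_two_apply hm hq h1.1 with ⟨-, h3⟩ | ⟨h2, h3⟩ | ⟨-, -, h3⟩ <;> rw [h3]
  · rw [Int.even_iff] at *; omega
  · refine ⟨by rw [Int.even_iff] at *; omega, ?_⟩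
    by_contra! hlt
    have hfx : f x = x := by rw [Int.even_iff] at *; omega
    rw [hfx, dvd_sub_comm] at h2
    have := f.apply_sub_of_dvd h2
    omega
  · exact h1

/-- Of the three simple reflections the first lengthens f, because of the juggling inequalities at q
- 2 and q - 1, and the second shortens it. As the total is a resolution, the third must shorten it
too. -/
theorem cross_sw_two_mul (hm : 3 ≤ m) {q : ℤ} (h1 : pivot m + 2 ≤ q)
    (h2 : q ≤ pivot m + (2 * m - 4)) (hq : Even q) {f : FullPerm m} (hf : Juggling f)
    (hlt : f⁻¹ q < f⁻¹ (q - 2)) : (sw m (q - 2) q * f).cross + 1 = f.cross := by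
  obtain ⟨h3, h4⟩ := sw_two_eq hm h1 h2 hq
  have h5 : (sw m (q - 2) q * f).cross < f.cross := by
    rw [sw_mul_eq f (swappable_two hm q)]
    refine cross_mul_sw_lt (crossing_iff.2 (Or.inr ⟨hlt, ?_⟩))
    rw [apply_inv_self, apply_inv_self]; omega
  have h6 := hf.inv (x := q - 2) (by rw [Int.even_iff] at *; omega)
  have h7 := hf.inv_odd (x := q - 1) (by rw [Int.even_iff] at *; omega)
  have h8 := cross_simple_mul_of_lt f (l := q - 2) (by rw [show q - 2 + 1 = q - 1 by ring]; omega)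
  have h9 := cross_simple_mul_of_gt (simple m (q - 2) * f) (l := q - 1) (by
    rw [sw_mul_inv_apply, sw_mul_inv_apply]
    have h5 := simple_right (m := m) (q - 2)
    rw [show q - 2 + 1 = q - 1 by ring] at h5
    rwa [sub_add_cancel, h4, h5])
  have h10 := cross_simple_mul_cases (simple m (q - 1) * (simple m (q - 2) * f)) (q - 2)
  rw [h3, mul_assoc, mul_assoc] at h5 ⊢
  omega

theorem cross_sw_two_mul_cases (hm : 3 ≤ m) {q : ℤ} (h1 : pivot m + 2 ≤ q)
    (h2 : q ≤ pivot m + (2 * m - 4)) (hq : Even q) {f : FullPerm m} (hf : Juggling f)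
    (h : f q ≠ q) :
    (f⁻¹ q < f⁻¹ (q - 2) ∧ (sw m (q - 2) q * f).cross + 1 = f.cross) ∨
    (f⁻¹ (q - 2) < f⁻¹ q ∧ (sw m (q - 2) q * f).cross = f.cross + 1) := by
  rcases lt_trichotomy (f⁻¹ q) (f⁻¹ (q - 2)) with h3 | h3 | h3
  · exact Or.inl ⟨h3, cross_sw_two_mul hm h1 h2 hq hf h3⟩
  · rw [apply_eq_iff] at h3; omega
  · right
    refine ⟨h3, ?_⟩
    have h4 := cross_sw_two_mul hm h1 h2 hq (hf.sw_two_mul hm hq h) (by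
      rw [sw_mul_inv_apply, sw_mul_inv_apply, sw_right (swappable_two hm q),
        sw_left (swappable_two hm q)]
      exact h3)
    rw [← mul_assoc, sw_mul_self, one_mul] at h4
    exact h4.symm

/-- The elements that remain are those that fix q. On the others the exchange preserves the weight,
the juggling condition and the later fixed points, and it changes the length by one. -/
theorem isMatching_rest (hm : 3 ≤ m) (k : ℕ) {q : ℤ} (h1 : pivot m + 2 ≤ q)
    (h2 : q ≤ pivot m + (2 * m - 4)) (hq : Even q) :
    IsMatching (rest m k q \ rest m k (q - 2)) (sw m (q - 2) q * ·) := by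
  have hs := swappable_two hm q
  have hne : ∀ f ∈ rest m k q \ rest m k (q - 2), f q ≠ q := fun f hf h =>
    hf.2 ⟨hf.1.1, fun e he h3 h4 => by
      rcases lt_or_ge q e with h5 | h5
      · exact hf.1.2 e he h5 h4
      · rw [Int.even_iff] at *
        rw [show e = q by omega, h]⟩
  have hcases := fun f (hf : f ∈ rest m k q \ rest m k (q - 2)) =>
    cross_sw_two_mul_cases hm h1 h2 hq hf.1.1.1 (hne f hf)
  refine ⟨fun f hf => ⟨⟨⟨hf.1.1.1.sw_two_mul hm hq (hne f hf), ?_⟩, fun e he h3 h4 => ?_⟩,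
    fun h => ?_⟩, fun f hf => ?_, fun f hf hlt => ?_, fun f hf => ?_, fun u hu g hg hc hlt => ?_⟩
  · rw [across_mul_of_le_iff _ _ (sw_two_le_iff hm h1 h2)]
    exact hf.1.1.2
  · rw [mul_apply, hf.1.2 e he h3 h4]
    unfold pivot at *
    rcases sw_two_apply hm hq he with ⟨h5, h6⟩ | ⟨h5, h6⟩ | ⟨-, -, h6⟩
    · have := eq_zero_of_period_dvd h5 (by omega) (by omega); omega
    · have := eq_zero_of_period_dvd h5 (by omega) (by omega); omega
    · exact h6
  -- If the product fixed q, then f would send q to q - 2, against the juggling condition.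
  · have h3 := h.2 q hq (by omega) h2
    rw [mul_apply, sw_apply_eq_iff, sw_right hs] at h3
    have := (hf.1.1.1 q hq).2
    omega
  · rw [← mul_assoc, sw_mul_self, one_mul]
  · rcases hcases f hf with ⟨h3, h4⟩ | ⟨h3, h4⟩
    · refine ⟨f⁻¹ (q - 2), f⁻¹ q, crossing_iff.2 (Or.inr ⟨h3, ?_⟩), sw_mul_eq f hs, h4⟩
      rw [apply_inv_self, apply_inv_self]; omega
    · omega
  · rcases hcases f hf with ⟨h3, h4⟩ | ⟨h3, h4⟩ <;> omega
  · have hcov := hc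
    obtain ⟨x, y, hx, hy, hxy, hxy', hs', rfl⟩ := hc.exists_even hu.1.1.1 hg.1.1.1
    have hux := (hu.1.1.1 x hx).1
    have huy := (hu.1.1.1 y hy).1
    -- The exchange moves even targets by at most 2, so among the pairs of even targets it reverses
    -- only the translates of (q - 2, q). In that case the resolution is the partner itself.
    by_cases he : 2 * (m : ℤ) - 2 ∣ u y - (q - 2) ∧ u x = u y + 2
    · left
      have he' := he.1
      rw [dvd_sub_comm] at he'
      obtain ⟨n, hn⟩ := he'
      obtain ⟨γ, hγ, h⟩ := exists_translation m n
      rw [mul_sw u hs', sw_congr (u.swappable_map hs') hs]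
      refine pairClass_eq_iff.2 ⟨γ, hγ, Or.inr ?_⟩
      rw [h, h, ← hn, he.2]
      constructor <;> ring
    · right
      -- Otherwise the pair still crosses after the exchange, and resolving it there shows that the
      -- partner of the covered element is shorter than that element.
      have h3 : sw m (q - 2) q (u y) < sw m (q - 2) q (u x) := by
        refine lt_of_le_of_ne ?_ fun e => by rw [apply_eq_iff] at e; omega
        rw [Int.even_iff] at *
        have h4 := sw_two_apply hm (Int.even_iff.2 hq) (Int.even_iff.2 hux)
        have h5 := sw_two_apply hm (Int.even_iff.2 hq) (Int.even_iff.2 huy)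
        by_cases h6 : u x = u y + 2
        · have h7 : ¬ 2 * (m : ℤ) - 2 ∣ u y - (q - 2) := fun h => he ⟨h, h6⟩
          have h8 : ¬ 2 * (m : ℤ) - 2 ∣ u x - q := by
            rwa [h6, show u y + 2 - q = u y - (q - 2) by ring]
          omega
        · omega
      have h4 := cross_mul_sw_lt (crossing_of_lt (f := sw m (q - 2) q * u) hxy h3)
      obtain ⟨-, -, -, -, h5⟩ := hcov
      rw [mul_assoc] at h4
      rcases hcases u hu with ⟨h6, h7⟩ | ⟨h6, h7⟩ <;> omega

/-- Each step fixes one more class of even numbers, from the right end of the window towards the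
pivot. The remaining sets are closed upwards because fixed even numbers stay fixed under taking
covers upwards. -/
theorem collapses_rest (hm : 3 ≤ m) (k : ℕ) {r : ℕ} (hr : r ≤ m - 2) :
    Collapses {f : FullPerm m | Bounded (fun _ => k) f}
      (rest m k (pivot m + (2 * m - 4) - 2 * r)) := by
  induction r with
  | zero =>
    have := collapses_bump (m := m) k le_rfl
    simp only [bounded_and_bump_iff] at this
    have e : rest m k (pivot m + (2 * m - 4) - 2 * (0 : ℕ)) =
        {f | Juggling f ∧ f.across (m - 1) = 2 * k} := by
      ext f
      refine ⟨fun h => h.1, fun h => ⟨h, fun e _ h1 h2 => ?_⟩⟩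
      push_cast at h1; omega
    rwa [e]
  | succ r ih =>
    have hq : Even (pivot m + (2 * m - 4) - 2 * (r : ℤ)) := by
      unfold pivot
      rw [Int.even_iff]; omega
    have := isMatching_rest hm k (q := pivot m + (2 * m - 4) - 2 * r) (by omega) (by omega) hq
    rw [show pivot m + (2 * m - 4) - 2 * (r : ℤ) - 2 =
      pivot m + (2 * m - 4) - 2 * (r + 1 : ℕ) by push_cast; ring] at this
    refine .step _ (ih (by omega)) ?_ ?_ this
    · exact fun f hf => ⟨hf.1, fun e he h1 => hf.2 e he (by push_cast; omega)⟩
    · intro f hf g hg hc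
      have hf' : Juggling f ∧ f.across (m - 1) = 2 * k := by
        rw [← bounded_and_bump_iff]
        refine ⟨hf, fun i hi => ?_⟩
        by_contra! hlt
        have h1 := hc.across_bump_le ⟨i, by omega⟩ (hf ⟨i, by omega⟩) hlt
        have h2 := (bounded_and_bump_iff.2 hg.1).2 i hi
        change (bump i g).across (i : ℕ) ≤ 2 * k at h1
        omega
      exact ⟨hf', fun e he h1 h2 => hc.apply_eq_self hf'.1 hg.1.1 he (hg.2 e he h1 h2)⟩

/-! ### Aligned products and translations. -/

/-- No strand that is moved by `f` is moved back by `g`, and `g` fixes the fixed points of `f`,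
while all strands moved to the right by `f` have the same displacement. -/
structure Aligned {m : ℕ} (g f : FullPerm m) : Prop where
  up : ∀ i, i < f i → f i ≤ g (f i)
  fixed : ∀ i, f i = i → g i = i
  rigid : ∀ i j, i < f i → j < f j → f i - i = f j - j

theorem Aligned.down {m : ℕ} {g f : FullPerm m} (h : Aligned g f) (i : ℤ) (hi : f i < i) :
    g (f i) ≤ f i := by
  have := h.up (1 - i) (by rw [apply_reflect]; omega)
  rw [apply_reflect, apply_reflect] at this
  omega

theorem Aligned.rigid_down {m : ℕ} {g f : FullPerm m} (h : Aligned g f) {i j : ℤ} (hi : f i < i)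
    (hj : f j < j) : f i - i = f j - j := by
  have := h.rigid (1 - i) (1 - j) (by rw [apply_reflect]; omega) (by rw [apply_reflect]; omega)
  rw [apply_reflect, apply_reflect] at this
  omega

/-- By rigidity two crossing strands of f do not move in the same direction, and g only carries them
further apart, so no crossing is undone. -/
theorem Aligned.cross {g f : FullPerm m} (h : Aligned g f) :
    (g * f).cross = g.cross + f.cross := by
  rw [cross_mul]
  have : f.crossings ∩ pulledCrossings g f = ∅ := by
    refine Set.eq_empty_of_forall_notMem fun c ⟨hc, hc'⟩ => ?_
    obtain ⟨i, j, rfl⟩ := pairClass_cases c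
    replace hc := mem_crossings_iff.1 hc
    replace hc' := mem_pulledCrossings'.1 hc'
    clear * - h hc hc'
    wlog hij : i < j generalizing i j
    · exact this j i hc.symm hc'.symm (by rw [crossing_iff] at hc; omega)
    rw [crossing_iff] at hc hc'
    have h1 := h.up i
    have h2 := h.up j
    have h3 := h.down i
    have h4 := h.down j
    have h5 := h.rigid i j
    have h6 := @Aligned.rigid_down _ _ _ h i j
    have h7 : f i = i → g (f i) = f i := fun e => by rw [e, h.fixed i e]
    have h8 : f j = j → g (f j) = f j := fun e => by rw [e, h.fixed j e]
    omega
  rw [this, Set.ncard_empty]; omega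

/-- A strand continues in the direction in which it started, so it crosses the line during at most
one of the two motions, and is then across it in the product. -/
theorem Aligned.across {g f : FullPerm m} (h : Aligned g f) (l : ℤ) :
    (g * f).across l = g.across l + f.across l := by
  have e : g.across l = (f ⁻¹' g.strandsAcross l).ncard := by
    unfold FullPerm.across
    rw [← Set.ncard_image_of_injective (f ⁻¹' g.strandsAcross l) f.bijective.1,
      Set.image_preimage_eq _ f.bijective.2]
  have fin : (f ⁻¹' g.strandsAcross l).Finite :=
    (g.strandsAcross_finite l).preimage f.bijective.1.injOn
  rw [e, FullPerm.across, FullPerm.across, ← Set.ncard_union_eq _ fin (f.strandsAcross_finite l)]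
  · congr 1
    ext i
    rw [Set.mem_union, Set.mem_preimage, mem_strandsAcross, mem_strandsAcross, mem_strandsAcross,
      mul_apply]
    have h1 := h.up i
    have h3 := h.down i
    have h7 : f i = i → g (f i) = f i := fun e => by rw [e, h.fixed i e]
    omega
  · rw [Set.disjoint_left]
    intro i hi
    rw [Set.mem_preimage, mem_strandsAcross] at hi
    rw [mem_strandsAcross]
    have h1 := h.up i
    have h3 := h.down i
    omega

theorem dvd_apply_sub_apply_iff (f : FullPerm m) {x y : ℤ} :
    2 * (m : ℤ) - 2 ∣ f y - f x ↔ 2 * (m : ℤ) - 2 ∣ y - x := by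
  constructor
  · intro h
    have := f⁻¹.apply_sub_of_dvd h
    rw [inv_apply_self, inv_apply_self] at this
    rwa [this, add_sub_cancel_left]
  · intro h
    rwa [f.apply_sub_of_dvd h, add_sub_cancel_left]

theorem dvd_apply_add_apply_iff (f : FullPerm m) {x y : ℤ} :
    2 * (m : ℤ) - 2 ∣ f y + f x - 1 ↔ 2 * (m : ℤ) - 2 ∣ y + x - 1 := by
  rw [show f y + f x - 1 = f y - f (1 - x) by rw [apply_reflect]; ring,
    dvd_apply_sub_apply_iff, show y - (1 - x) = y + x - 1 by ring]

/-- The translation of the strands at the orbit of `x`: the numbers that are congruent to `x` are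
increased by one period. -/
noncomputable def trans (m : ℕ) [m.AtLeastTwo] (x : ℤ) : FullPerm m :=
  sw m (1 - x) x * sw m x (2 * m - 1 - x)

theorem not_dvd_and_dvd {m : ℕ} {x y : ℤ} (h : 2 * (m : ℤ) - 2 ∣ y - x) :
    ¬ 2 * (m : ℤ) - 2 ∣ y + x - 1 := by
  intro h'
  have h1 := even_of_period_dvd h
  have h2 := even_of_period_dvd h'
  rw [Int.even_iff] at *
  omega

theorem trans_apply (x y : ℤ) : trans m x y =
    if 2 * (m : ℤ) - 2 ∣ y - x then y + (2 * m - 2) else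
    if 2 * (m : ℤ) - 2 ∣ y + x - 1 then y - (2 * m - 2) else y := by
  have hs1 : Swappable m (1 - x) x := swappable_of_odd ⟨x - 1, by ring⟩
  have hs2 : Swappable m x (2 * m - 1 - x) := swappable_of_odd ⟨m - 1 - x, by ring⟩
  have aux : ∀ z : ℤ, (2 * (m : ℤ) - 2 ∣ z + (2 * m - 2) ↔ 2 * (m : ℤ) - 2 ∣ z) ∧
      (2 * (m : ℤ) - 2 ∣ z - (2 * m - 2) ↔ 2 * (m : ℤ) - 2 ∣ z) :=
    fun z => ⟨dvd_add_self_right, dvd_sub_self_right⟩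
  rw [trans, mul_apply, sw_apply hs2, swapAt_apply hs2]
  by_cases h1 : 2 * (m : ℤ) - 2 ∣ y - x
  · have h2 : 2 * (m : ℤ) - 2 ∣ y - x + (2 * m - 1 - x) - (1 - x) := by
      rw [show y - x + (2 * m - 1 - x) - (1 - x) = y - x + (2 * (m : ℤ) - 2) by ring, (aux _).1]
      exact h1
    rw [if_pos h1, if_pos h1, sw_apply hs1, swapAt_apply hs1, if_pos h2]
    ring
  by_cases h3 : 2 * (m : ℤ) - 2 ∣ y + x - 1
  · have h2 : 2 * (m : ℤ) - 2 ∣ y + x - (2 * m - 1 - x) - x := by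
      rw [show y + x - (2 * m - 1 - x) - x = y + x - 1 - (2 * (m : ℤ) - 2) by ring, (aux _).2]
      exact h3
    have h4 : ¬ 2 * (m : ℤ) - 2 ∣ y + x - (2 * m - 1 - x) - (1 - x) := by
      intro h4
      have h5 := even_of_period_dvd h4
      have h6 := even_of_period_dvd h2
      rw [Int.even_iff] at *
      omega
    rw [if_neg h1, if_pos h3, if_neg h1, if_pos h3, sw_apply hs1, swapAt_apply hs1, if_neg h4]
    split_ifs with h5
    · ring
    · exact (h5 (by convert h2 using 1; ring)).elim
  · have h4 : ¬ 2 * (m : ℤ) - 2 ∣ y - (2 * m - 1 - x) := by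
      rwa [show y - (2 * m - 1 - x) = y + x - 1 - (2 * (m : ℤ) - 2) by ring, (aux _).2]
    have h5 : ¬ 2 * (m : ℤ) - 2 ∣ y + (2 * m - 1 - x) - 1 := by
      rwa [show y + (2 * m - 1 - x) - 1 = y - x + (2 * (m : ℤ) - 2) by ring, (aux _).1]
    rw [if_neg h1, if_neg h3, if_neg h1, if_neg h3, if_neg h4, if_neg h5, sw_apply hs1,
      swapAt_apply hs1]
    rw [show y - (1 - x) = y + x - 1 by ring, show y + (1 - x) - 1 = y - x by ring, if_neg h3,
      if_neg h1, if_neg h1, if_neg h3]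

theorem trans_self (x : ℤ) : trans m x x = x + (2 * m - 2) := by
  rw [trans_apply, if_pos (by simp)]

theorem trans_pow_apply (x y : ℤ) (k : ℕ) : (trans m x ^ k) y =
    if 2 * (m : ℤ) - 2 ∣ y - x then y + (2 * m - 2) * k else
    if 2 * (m : ℤ) - 2 ∣ y + x - 1 then y - (2 * m - 2) * k else y := by
  induction k with
  | zero => rw [pow_zero, one_apply]; simp
  | succ k ih =>
    rw [pow_succ', mul_apply, ih, trans_apply]
    by_cases h1 : 2 * (m : ℤ) - 2 ∣ y - x
    · rw [if_pos h1, if_pos h1, if_pos]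
      · push_cast; ring
      · rw [show y + (2 * (m : ℤ) - 2) * k - x = y - x + (2 * m - 2) * k by ring]
        exact dvd_add h1 (dvd_mul_right _ _)
    by_cases h2 : 2 * (m : ℤ) - 2 ∣ y + x - 1
    · have h3 : 2 * (m : ℤ) - 2 ∣ y - (2 * (m : ℤ) - 2) * k + x - 1 := by
        rw [show y - (2 * (m : ℤ) - 2) * k + x - 1 = y + x - 1 - (2 * m - 2) * k by ring]
        exact dvd_sub h2 (dvd_mul_right _ _)
      have h4 : ¬ 2 * (m : ℤ) - 2 ∣ y - (2 * (m : ℤ) - 2) * k - x := fun h => not_dvd_and_dvd h h3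
      rw [if_neg h1, if_pos h2, if_neg h4, if_pos h3, if_neg h1, if_pos h2]
      push_cast; ring
    · simp only [if_neg h1, if_neg h2]

theorem mul_trans (f : FullPerm m) (x : ℤ) : f * trans m x = trans m (f x) * f := by
  refine ext_apply fun y => ?_
  rw [mul_apply, mul_apply, trans_apply, trans_apply]
  simp only [dvd_apply_sub_apply_iff, dvd_apply_add_apply_iff]
  split_ifs with h1 h2
  · have := f.apply_add_period y 1
    rwa [mul_one] at this
  · have := f.apply_add_period y (-1)
    rwa [mul_neg, mul_one, ← sub_eq_add_neg, ← sub_eq_add_neg] at this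
  · rfl

theorem period_pos : 0 < 2 * (m : ℤ) - 2 := by
  have := ‹m.AtLeastTwo›.prop
  omega

theorem trans_eq_iff {x y : ℤ} : trans m x = trans m y ↔ 2 * (m : ℤ) - 2 ∣ y - x := by
  have hp := period_pos (m := m)
  constructor
  · intro h
    have h1 := trans_self (m := m) y
    rw [← h, trans_apply] at h1
    split_ifs at h1 with h2
    · exact h2
    · omega
    · omega
  · intro h
    refine ext_apply fun z => ?_
    rw [trans_apply, trans_apply]
    have e1 : 2 * (m : ℤ) - 2 ∣ z - x ↔ 2 * (m : ℤ) - 2 ∣ z - y := by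
      rw [← dvd_sub_left h, show z - x - (y - x) = z - y by ring]
    have e2 : 2 * (m : ℤ) - 2 ∣ z + x - 1 ↔ 2 * (m : ℤ) - 2 ∣ z + y - 1 := by
      rw [← dvd_add_left h, show z + x - 1 + (y - x) = z + y - 1 by ring]
    simp only [e1, e2]

theorem trans_reflect_apply (x y : ℤ) : trans m (1 - x) y =
    if 2 * (m : ℤ) - 2 ∣ y - x then y - (2 * m - 2) else
    if 2 * (m : ℤ) - 2 ∣ y + x - 1 then y + (2 * m - 2) else y := by
  rw [trans_apply, show y - (1 - x) = y + x - 1 by ring, show y + (1 - x) - 1 = y - x by ring]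
  split_ifs with h1 h2
  · exact absurd h1 (not_dvd_and_dvd h2)
  all_goals rfl

theorem inv_trans (x : ℤ) : (trans m x)⁻¹ = trans m (1 - x) := by
  refine inv_eq_of_mul_eq_one_left (ext_apply fun y => ?_)
  have h1 := (trans m (1 - x)).apply_add_period y 1
  have h2 := (trans m (1 - x)).apply_add_period y (-1)
  rw [mul_apply, one_apply, trans_apply x]
  rw [mul_one] at h1
  rw [mul_neg, mul_one, ← sub_eq_add_neg, ← sub_eq_add_neg] at h2
  split_ifs with h3 h4
  · rw [h1, trans_reflect_apply, if_pos h3, sub_add_cancel]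
  · rw [h2, trans_reflect_apply, if_neg fun h => not_dvd_and_dvd h h4, if_pos h4,
      add_sub_cancel_right]
  · rw [trans_reflect_apply, if_neg h3, if_neg h4]

/-- The reflection at x conjugates one translation into the other, and multiplying it to the first
on the left or to the second on the right lengthens by one. Both give the same product. -/
theorem cross_trans_add_one (x : ℤ) : (trans m (x + 1)).cross = (trans m x).cross := by
  have hp := period_pos (m := m)
  have h1 := mul_trans (simple m x) x
  rw [simple_left] at h1
  have hne : ¬ 2 * (m : ℤ) - 2 ∣ x + 1 - x := fun h => by
    have := even_of_period_dvd h
    rw [Int.even_iff] at this; omega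
  have h2 := cross_simple_mul_of_lt (trans m x) (l := x) (by
    rw [inv_trans, trans_reflect_apply x x, trans_reflect_apply x (x + 1), if_neg hne,
      if_pos (by simp)]
    split_ifs <;> omega)
  have h3 := cross_mul_simple_of_lt (trans m (x + 1)) (l := x) (by
    have hne' : ¬ 2 * (m : ℤ) - 2 ∣ x - (x + 1) := by rwa [dvd_sub_comm]
    rw [trans_self, trans_apply, if_neg hne']
    split_ifs <;> omega)
  rw [h1] at h2
  omega

theorem cross_trans (x y : ℤ) : (trans m x).cross = (trans m y).cross := by
  have key : ∀ (x : ℤ) (k : ℕ), (trans m (x + k)).cross = (trans m x).cross := by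
    intro x k
    induction k with
    | zero => simp
    | succ k ih => rw [Nat.cast_succ, ← add_assoc, cross_trans_add_one, ih]
  rcases le_total x y with h | h <;> obtain ⟨k, hk⟩ := Int.le.dest h <;> rw [← hk, key]

theorem juggling_trans {x : ℤ} (hx : Even x) : Juggling (trans m x) := by
  have hp := period_pos (m := m)
  intro y hy
  have h : ¬ 2 * (m : ℤ) - 2 ∣ y + x - 1 := fun h => by
    have := even_of_period_dvd h
    rw [Int.even_iff] at *; omega
  rw [trans_apply, if_neg h]
  rw [Int.even_iff] at *
  split_ifs <;> omega

theorem across_trans (x l : ℤ) : (trans m x).across l = 2 := by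
  have hm : 2 ≤ m := ‹m.AtLeastTwo›.prop
  have h1 : ∀ l', (trans m x).across l = (trans m x).across l' := by
    intro l'
    by_cases hx : Even x
    · exact (juggling_trans hx).across_eq _ _
    · rw [← across_inv, ← across_inv _ l', inv_trans]
      exact (juggling_trans (by rw [Int.even_iff] at *; omega)).across_eq _ _
  have h2 : ∀ y l : ℤ, 1 ≤ y → y ≤ m - 1 → (trans m y).across y = 2 := by
    intro y l hy1 hy2
    -- By the juggling property, of the translation or of its inverse, all lines have the same
    -- count. So one line suffices: here one strand crosses to the right and one to the left.
    have e : (trans m y).strandsAcross y = {y, 1 - y + (2 * m - 2)} := by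
      ext i
      rw [mem_strandsAcross, trans_apply, Set.mem_insert_iff, Set.mem_singleton_iff]
      split_ifs with h3 h4
      · constructor
        · intro h
          left
          have := eq_zero_of_period_dvd h3 (by omega) (by omega)
          omega
        · rintro (rfl | rfl)
          · left; omega
          · have h5 := even_of_period_dvd h3
            rw [Int.even_iff] at h5
            omega
      · constructor
        · intro h
          right
          have := eq_zero_of_period_dvd (z := i + y - 1 - (2 * m - 2)) (dvd_sub_self_right.2 h4)
            (by omega) (by omega)
          omega
        · rintro (rfl | rfl)
          · exact absurd (by simp) h3
          · right; omega
      · constructor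
        · intro h; omega
        · rintro (rfl | rfl)
          · exact absurd (by simp) h3
          · exact absurd (by rw [show 1 - y + (2 * (m : ℤ) - 2) + y - 1 = 2 * m - 2 by ring]) h4
    rw [FullPerm.across, e, Set.ncard_pair]
    omega
  obtain ⟨y, hy1, hy2, h3 | h3⟩ := exists_fundamental hm x
  · rw [h1 y, trans_eq_iff.2 (by rwa [dvd_sub_comm]), h2 y 0 hy1 hy2]
  · rw [h1 y, trans_eq_iff.2 (by rwa [dvd_sub_comm]), ← inv_trans, across_inv, h2 y 0 hy1 hy2]

theorem aligned_trans (x : ℤ) (k : ℕ) : Aligned (trans m x ^ k) (trans m x) := by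
  have hp := period_pos (m := m)
  have hk : 0 ≤ (2 * (m : ℤ) - 2) * k := by positivity
  refine ⟨fun i h => ?_, fun i h => ?_, fun i j hi hj => ?_⟩
  · rw [← mul_apply, ← pow_succ, trans_pow_apply]
    rw [trans_apply] at h ⊢
    push_cast
    split_ifs at * <;> linarith
  · rw [trans_pow_apply]
    rw [trans_apply] at h
    split_ifs at * <;> omega
  · rw [trans_apply x i] at *
    rw [trans_apply x j] at *
    split_ifs at * <;> omega

theorem across_trans_pow (x l : ℤ) (k : ℕ) : (trans m x ^ k).across l = 2 * k := by
  induction k with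
  | zero => rw [pow_zero, across_one]
  | succ k ih => rw [pow_succ, (aligned_trans x k).across, ih, across_trans]; ring

/-- The two bounces of a strand at `x` are aligned. -/
theorem aligned_bounce {x : ℤ} (h1 : 1 ≤ x) (h2 : x ≤ m - 1) :
    Aligned (sw m (1 - x) x) (sw m x (2 * m - 1 - x)) ∧
      Aligned (sw m x (2 * m - 1 - x)) (sw m (1 - x) x) := by
  have hs1 : Swappable m (1 - x) x := swappable_of_odd ⟨x - 1, by ring⟩
  have hs2 : Swappable m x (2 * m - 1 - x) := swappable_of_odd ⟨m - 1 - x, by ring⟩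
  have aux : ∀ z : ℤ, (2 * (m : ℤ) - 2 ∣ z + (2 * m - 2) ↔ 2 * (m : ℤ) - 2 ∣ z) ∧
      (2 * (m : ℤ) - 2 ∣ z - (2 * m - 2) ↔ 2 * (m : ℤ) - 2 ∣ z) :=
    fun z => ⟨dvd_add_self_right, dvd_sub_self_right⟩
  have e2 : ∀ y, sw m x (2 * m - 1 - x) y =
      if 2 * (m : ℤ) - 2 ∣ y - x then y + (2 * m - 1 - 2 * x) else
      if 2 * (m : ℤ) - 2 ∣ y + x - 1 then y - (2 * m - 1 - 2 * x) else y := by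
    intro y
    have h3 : 2 * (m : ℤ) - 2 ∣ y - (2 * m - 1 - x) ↔ 2 * (m : ℤ) - 2 ∣ y + x - 1 := by
      rw [show y - (2 * m - 1 - x) = y + x - 1 - (2 * (m : ℤ) - 2) by ring, (aux _).2]
    have h4 : 2 * (m : ℤ) - 2 ∣ y + (2 * m - 1 - x) - 1 ↔ 2 * (m : ℤ) - 2 ∣ y - x := by
      rw [show y + (2 * m - 1 - x) - 1 = y - x + (2 * (m : ℤ) - 2) by ring, (aux _).1]
    rw [sw_apply hs2, swapAt_apply hs2]
    simp only [h3, h4]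
    split_ifs <;> ring
  have e1 : ∀ y, sw m (1 - x) x y =
      if 2 * (m : ℤ) - 2 ∣ y - x then y - (2 * x - 1) else
      if 2 * (m : ℤ) - 2 ∣ y + x - 1 then y + (2 * x - 1) else y := by
    intro y
    rw [sw_apply hs1, swapAt_apply hs1, show y - (1 - x) = y + x - 1 by ring,
      show y + (1 - x) - 1 = y - x by ring]
    split_ifs with h3 h4
    · exact absurd h3 (not_dvd_and_dvd h4)
    all_goals ring
  have d1 : ∀ y, 2 * (m : ℤ) - 2 ∣ y - x → 2 * (m : ℤ) - 2 ∣ y + (2 * m - 1 - 2 * x) + x - 1 := by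
    intro y h
    rwa [show y + (2 * m - 1 - 2 * x) + x - 1 = y - x + (2 * (m : ℤ) - 2) by ring, (aux _).1]
  have d2 : ∀ y, 2 * (m : ℤ) - 2 ∣ y + x - 1 → 2 * (m : ℤ) - 2 ∣ y + (2 * x - 1) - x := by
    intro y h
    rwa [show y + (2 * x - 1) - x = y + x - 1 by ring]
  refine ⟨⟨fun i h => ?_, fun i h => ?_, fun i j hi hj => ?_⟩,
    ⟨fun i h => ?_, fun i h => ?_, fun i j hi hj => ?_⟩⟩
  · rw [e2] at h ⊢
    split_ifs at h ⊢ with h3 h4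
    · rw [e1, if_neg fun h => not_dvd_and_dvd h (d1 i h3), if_pos (d1 i h3)]; omega
    · omega
    · omega
  · rw [e2] at h
    rw [e1]
    split_ifs at h ⊢ <;> omega
  · rw [e2 i] at *
    rw [e2 j] at *
    split_ifs at * <;> omega
  · rw [e1] at h ⊢
    split_ifs at h ⊢ with h3 h4
    · omega
    · rw [e2, if_pos (d2 i h4)]; omega
    · omega
  · rw [e1] at h
    rw [e2]
    split_ifs at h ⊢ <;> omega
  · rw [e1 i] at *
    rw [e1 j] at *
    split_ifs at * <;> omega

theorem sw_mul_sw_reflect (x : ℤ) : sw m x (2 * m - 1 - x) * sw m (1 - x) x = trans m (1 - x) := by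
  rw [← inv_trans, trans, mul_inv_rev, sw_inv, sw_inv]

theorem ext_of_even {f g : FullPerm m} (h : ∀ y, Even y → f y = g y) : f = g := by
  refine ext_apply fun y => ?_
  by_cases hy : Even y
  · exact h y hy
  · have := h (1 - y) (by rw [Int.even_iff] at *; omega)
    rw [apply_reflect, apply_reflect] at this
    omega

/-- All even classes but that of the pivot are fixed, so this class is preserved too and can only be
translated, to the right by the juggling condition. The number of strands determines the exponent.
-/
theorem rest_pivot (k : ℕ) : rest m k (pivot m) = {trans m (pivot m) ^ k} := by
  have hpiv : Even (pivot m) := even_two_mul _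
  have hp := period_pos (m := m)
  have hpow : ∀ (k : ℕ) (y : ℤ), Even y → (trans m (pivot m) ^ k) y =
      if 2 * (m : ℤ) - 2 ∣ y - pivot m then y + (2 * m - 2) * k else y := by
    intro k y hy
    have h : ¬ 2 * (m : ℤ) - 2 ∣ y + pivot m - 1 := fun h => by
      have := even_of_period_dvd h
      rw [Int.even_iff] at *; omega
    rw [trans_pow_apply, if_neg h]
  ext f
  rw [Set.mem_singleton_iff]
  constructor
  · rintro ⟨⟨h1, h2⟩, h3⟩
    have hfix : ∀ y, Even y → ¬ 2 * (m : ℤ) - 2 ∣ y - pivot m → f y = y := by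
      intro y hy hd
      have e1 := Int.emod_nonneg (y - pivot m) hp.ne'
      have e2 := Int.emod_lt_of_pos (y - pivot m) hp
      have e3 : 2 * (m : ℤ) - 2 ∣ y - pivot m - (y - pivot m) % (2 * (m : ℤ) - 2) :=
        Int.dvd_self_sub_emod
      rw [Int.dvd_iff_emod_eq_zero] at hd
      generalize (y - pivot m) % (2 * (m : ℤ) - 2) = r at *
      have e4 := even_of_period_dvd e3
      have e5 : Even r := by rw [Int.even_iff] at *; omega
      have e6 := h3 (pivot m + r) (hpiv.add e5) (by omega) (by rw [Int.even_iff] at e5; omega)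
      rw [sub_sub] at e3
      have := f.apply_sub_of_dvd e3
      omega
    obtain ⟨a, ha⟩ : 2 * (m : ℤ) - 2 ∣ f (pivot m) - pivot m := by
      by_contra hd
      have h4 := hfix _ (h1 _ hpiv).1 hd
      rw [apply_eq_iff] at h4
      rw [h4, sub_self] at hd
      exact hd (dvd_zero _)
    have ha0 : 0 ≤ a := by
      have := (h1 _ hpiv).2
      exact nonneg_of_mul_nonneg_right (by omega : 0 ≤ (2 * (m : ℤ) - 2) * a) hp
    obtain ⟨k', rfl⟩ := Int.eq_ofNat_of_zero_le ha0
    have hf : f = trans m (pivot m) ^ k' := by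
      refine ext_of_even fun y hy => ?_
      rw [hpow _ _ hy]
      split_ifs with h
      · rw [f.apply_sub_of_dvd h]; omega
      · exact hfix y hy h
    rw [hf, across_trans_pow] at h2
    rw [hf]
    congr 1
    omega
  · rintro rfl
    refine ⟨⟨fun y hy => ?_, across_trans_pow _ _ _⟩, fun e he h1 h2 => ?_⟩
    · have h0 : 0 ≤ (2 * (m : ℤ) - 2) * k := by positivity
      have h1 : Even ((2 * (m : ℤ) - 2) * k) := even_of_period_dvd (dvd_mul_right _ _)
      rw [hpow _ _ hy]
      split_ifs
      · exact ⟨hy.add h1, by omega⟩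
      · exact ⟨hy, le_rfl⟩
    · rw [hpow _ _ he, if_neg]
      intro h
      have := eq_zero_of_period_dvd h (by omega) (by omega)
      omega

/-- The complex of the elements of constant weight `k` collapses to a single element. -/
theorem collapses_singleton (hm : 3 ≤ m) (k : ℕ) :
    Collapses {f : FullPerm m | Bounded (fun _ => k) f} {trans m (pivot m) ^ k} := by
  have := collapses_rest hm k (r := m - 2) le_rfl
  rwa [show pivot m + (2 * (m : ℤ) - 4) - 2 * (m - 2 : ℕ) = pivot m by
    rw [Nat.cast_sub (by omega)]; push_cast; ring, rest_pivot] at this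

end FullPerm

/-! ### The differential as a sum over covers, and the central cycle Ω. -/

namespace FullPerm

open LiftedPartialPerm PongAlgebra

variable {m : ℕ} [m.AtLeastTwo]

theorem cov_iff {f g : FullPerm m} : Cov f g ↔ ∃ c : f.crossings, f.resolveAt c = g ∧ g.cross + 1 = f.cross := by
  constructor
  · rintro ⟨x, y, h, rfl, h1⟩
    refine ⟨⟨pairClass m x y, mem_crossings_iff.2 h⟩, ?_, h1⟩
    rw [resolveAt_eq, resolve_eq]
  · rintro ⟨⟨c, hc⟩, rfl, h1⟩
    obtain ⟨x, y, rfl⟩ := pairClass_cases c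
    refine ⟨x, y, mem_crossings_iff.1 hc, ?_, h1⟩
    rw [resolveAt_eq, resolve_eq]

/-- Hence no two terms of the differential cancel modulo 2, and its coefficients can be read off
from the cover relation. -/
theorem resolveAt_injective (f : FullPerm m) : Function.Injective f.resolveAt := by
  rintro ⟨c, hc⟩ ⟨c', hc'⟩ h
  obtain ⟨x, y, rfl⟩ := pairClass_cases c
  obtain ⟨x', y', rfl⟩ := pairClass_cases c'
  rw [resolveAt_eq, resolveAt_eq, resolve_eq, resolve_eq, mul_right_inj] at h
  have h1 := mem_crossings_iff.1 hc
  refine Subtype.ext (pairClass_eq_of_sw_eq h1.swappable (mem_crossings_iff.1 hc').swappable ?_ h)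
  rintro rfl
  rw [crossing_iff] at h1
  omega

theorem finite_cov (f : FullPerm m) : {g | Cov f g}.Finite := by
  refine (Set.finite_range f.resolveAt).subset fun g hg => ?_
  obtain ⟨c, hc, -⟩ := cov_iff.1 hg
  exact ⟨c, hc⟩

/-- The finite set of the resolutions of `f` that occur in the differential. -/
noncomputable def covers (f : FullPerm m) : Finset (FullPerm m) := (finite_cov f).toFinset

theorem mem_covers {f g : FullPerm m} : g ∈ covers f ↔ Cov f g := Set.Finite.mem_toFinset _

theorem d_pure_eq_sum (f : FullPerm m) : d (pure f) =
    ∑ g ∈ covers f, weightMonomial f.twiceWeight g.twiceWeight • pure g := by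
  classical
  rw [d_pure, pureD]
  simp only [term]
  rw [← Finset.sum_filter]
  refine Finset.sum_bij (fun c _ => f.resolveAt c) ?_ (fun c _ c' _ h => resolveAt_injective f h) ?_
    fun _ _ => rfl
  · intro c hc
    have h1 := (Finset.mem_filter.1 hc).2
    have h2 := cross_resolveAt f c
    exact mem_covers.2 (cov_iff.2 ⟨c, rfl, by omega⟩)
  · intro g hg
    obtain ⟨c, rfl, h⟩ := cov_iff.1 (mem_covers.1 hg)
    exact ⟨c, Finset.mem_filter.2 ⟨Finset.mem_univ _, by omega⟩, rfl⟩

theorem pure_mul_pure_eq (g f : FullPerm m) : pure g * pure f =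
    term (g.twiceWeight + f.twiceWeight) (g.cross + f.cross) (g * f) := by
  rw [pure_mul_pure, pureMul, dif_pos (composable g f), comp_eq_mul]

theorem isIdempotent_iff (e : FullPerm m) : e.IsIdempotent ↔ e = 1 :=
  ⟨fun h => ext_apply h, fun h => h ▸ fun _ => rfl⟩

theorem pure_one : (pure 1 : PongAlgebra m (m - 1)) = 1 := by
  rw [one_def]
  have : (finite_idempotents m (m - 1)).toFinset = {(1 : FullPerm m)} := by
    ext e
    rw [Set.Finite.mem_toFinset, Finset.mem_singleton]
    exact isIdempotent_iff e
  rw [this, Finset.sum_singleton]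

theorem twiceWeight_apply {m : ℕ} (f : FullPerm m) (l : Fin m) : f.twiceWeight l = f.across (l : ℕ) := rfl

theorem smul_eq_zero_iff {k : ℕ} (r : BaseRing m) (z : PongAlgebra m k) : r • z = 0 ↔ r = 0 ∨ z = 0 :=
  smul_eq_zero (R := BaseRing m) (M := LiftedPartialPerm m k →₀ BaseRing m)

theorem weightMonomial_eq {m : ℕ} (w w' : Fin m → ℕ) : weightMonomial w w' =
    MvPolynomial.monomial (Finsupp.equivFunOnFinite.symm fun l => (w l - w' l) / 2) 1 := by
  rw [weightMonomial, MvPolynomial.monomial_eq, Finsupp.prod_fintype _ _ fun i => pow_zero _]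
  simp

theorem weightMonomial_ne_zero {m : ℕ} (w w' : Fin m → ℕ) : weightMonomial w w' ≠ 0 := by
  rw [weightMonomial_eq, Ne, MvPolynomial.monomial_eq_zero]
  exact one_ne_zero

theorem d_one {k : ℕ} : d (1 : PongAlgebra m k) = 0 := by
  have := d_mul (1 : PongAlgebra m k) 1
  rwa [mul_one, one_mul, mul_one, left_eq_add] at this

theorem d_d_mul {k : ℕ} (a b : PongAlgebra m k) : d (d (a * b)) = d (d a) * b + a * d (d b) := by
  rw [d_mul, LinearMap.map_add, d_mul, d_mul]
  have := add_self (d a * d b)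
  calc _ = d (d a) * b + a * d (d b) + (d a * d b + d a * d b) := by abel
    _ = _ := by rw [this, add_zero]

theorem covers_simple (l : ℤ) : covers (simple m l) = {1} := by
  ext g
  rw [mem_covers, Finset.mem_singleton]
  constructor
  · rintro ⟨x, y, h, rfl, h1⟩
    by_contra hne
    obtain ⟨j, hj⟩ := exists_descent hne
    have := cross_simple_mul_of_gt _ hj
    rw [cross_simple] at h1
    omega
  · rintro rfl
    refine ⟨l, l + 1, crossing_of_lt (by omega) ?_, ?_, ?_⟩
    · rw [simple_left, simple_right]; omega
    · rw [sw_mul_self]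
    · rw [cross_one, cross_simple]

theorem d_simple (l : ℤ) : d (pure (simple m l)) =
    weightMonomial (simple m l).twiceWeight (1 : FullPerm m).twiceWeight •
      (1 : PongAlgebra m (m - 1)) := by
  rw [d_pure_eq_sum, covers_simple, Finset.sum_singleton, pure_one]

/-- Induction on the length: a descent writes f, up to a nonzero monomial, as the product of a
simple reflection and a shorter element. In characteristic two the square of d is again a derivation
and vanishes on both factors, and the monomial can be cancelled because the module is free. -/
theorem d_d (z : PongAlgebra m (m - 1)) : d (d z) = 0 := by
  have key : ∀ (n : ℕ) (f : FullPerm m), f.cross = n → d (d (pure f)) = 0 := by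
    intro n
    induction n with
    | zero =>
      intro f hf
      rw [d_pure_eq_sum, Finset.sum_eq_zero, LinearMap.map_zero]
      intro g hg
      obtain ⟨-, -, -, -, h⟩ := mem_covers.1 hg
      omega
    | succ n ih =>
      intro f hf
      have hne : f ≠ 1 := by
        rintro rfl
        rw [cross_one] at hf
        omega
      obtain ⟨l, hl⟩ := exists_descent hne
      have h1 := cross_simple_mul_of_gt f hl
      have h2 := d_d_mul (pure (simple m l)) (pure (simple m l * f))
      rw [ih (simple m l * f) (by omega), d_simple, LinearMap.map_smul, d_one, smul_zero, zero_mul, mul_zero,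
        add_zero, pure_mul_pure_eq, simple_mul_simple_mul, term, if_pos (by rw [cross_simple]; omega),
        LinearMap.map_smul, LinearMap.map_smul, smul_eq_zero_iff] at h2
      exact h2.resolve_left (weightMonomial_ne_zero _ _)
  induction z using PongAlgebra.induction with
  | zero => rw [LinearMap.map_zero, LinearMap.map_zero]
  | add a b ha hb => rw [LinearMap.map_add, LinearMap.map_add, ha, hb, add_zero]
  | smul r f => rw [LinearMap.map_smul, LinearMap.map_smul, key _ f rfl, smul_zero]

theorem twiceWeight_one : (1 : FullPerm m).twiceWeight = 0 := by
  funext l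
  rw [twiceWeight_apply, across_one]; rfl

theorem across_simple (l : ℤ) : (simple m l).across l = 2 := by
  have h := across_simple_mul (1 : FullPerm m) l
  rw [mul_one, inv_one, across_one, one_apply, one_apply] at h
  split_ifs at h <;> omega

theorem twiceWeight_simple (l : Fin m) :
    (simple m (l : ℕ)).twiceWeight = Pi.single l 2 := by
  funext j
  rw [twiceWeight_apply]
  by_cases h : j = l
  · subst h; rw [across_simple, Pi.single_eq_same]
  · rw [Pi.single_eq_of_ne h, ← mul_one (simple m (l : ℕ)),
      across_simple_mul_of_ne _ l.2 j.2 fun e => h (Fin.ext e.symm), across_one]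

/-- The source of the exterior generators: X_l bounds v_l, which becomes zero in Q(m, m-1). -/
theorem d_simple_fin (l : Fin m) : d (pure (simple m (l : ℕ))) =
    (MvPolynomial.X l : BaseRing m) • (1 : PongAlgebra m (m - 1)) := by
  rw [d_simple, twiceWeight_simple, twiceWeight_one]
  congr 1
  rw [weightMonomial, Finset.prod_eq_single l]
  · rw [Pi.single_eq_same]; norm_num
  · intro j _ hj
    rw [Pi.single_eq_of_ne hj]; norm_num
  · intro h; exact absurd (Finset.mem_univ _) h

/-- The set of all the translations of one orbit of strands. -/
noncomputable def transSet (m : ℕ) [m.AtLeastTwo] : Finset (FullPerm m) := by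
  classical exact (Finset.Icc (2 - m : ℤ) (m - 1)).image (trans m)

theorem mem_transSet {f : FullPerm m} : f ∈ transSet m ↔ ∃ x, f = trans m x := by
  classical
  rw [transSet, Finset.mem_image]
  constructor
  · rintro ⟨x, -, rfl⟩; exact ⟨x, rfl⟩
  · rintro ⟨x, rfl⟩
    obtain ⟨y, hy1, hy2, h | h⟩ := exists_fundamental ‹m.AtLeastTwo›.prop x
    · exact ⟨y, Finset.mem_Icc.2 ⟨by omega, hy2⟩, trans_eq_iff.2 h⟩
    · exact ⟨1 - y, Finset.mem_Icc.2 ⟨by omega, by omega⟩, trans_eq_iff.2 h⟩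

/-- The lift of `Ω` to the pong algebra. -/
noncomputable def omega (m : ℕ) [m.AtLeastTwo] : PongAlgebra m (m - 1) :=
  ∑ f ∈ transSet m, pure f

theorem omega_eq_sum : omega m = ∑ x ∈ Finset.Icc (2 - m : ℤ) (m - 1), pure (trans m x) := by
  classical
  rw [omega, transSet, Finset.sum_image]
  intro x hx y hy h
  rw [Finset.mem_coe, Finset.mem_Icc] at hx hy
  have := eq_zero_of_period_dvd (trans_eq_iff.1 h) (by omega) (by omega)
  omega

theorem pure_mul_pure_of_aligned {g f : FullPerm m} (h : Aligned g f) :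
    pure g * pure f = pure (g * f) := by
  have hw : g.twiceWeight + f.twiceWeight = (g * f).twiceWeight := by
    funext l
    exact (h.across _).symm
  rw [pure_mul_pure_eq, term, if_pos h.cross, hw, weightMonomial_self, one_smul]

/-- A strand that bounces off both walls returns translated by one period. The order of the bounces
decides the direction, so the two products are mutually inverse translations; no variable appears
because both products are aligned. -/
theorem bounce_commutator {x : ℤ} (h1 : 1 ≤ x) (h2 : x ≤ m - 1) :
    leftBounce m x * rightBounce m x - rightBounce m x * leftBounce m x =
      pure (trans m x) + pure (trans m (1 - x)) := by
  have e1 : leftBounce m x = pure (sw m (1 - x) x) := congrArg pure (exchange_eq_sw _ _ _)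
  have e2 : rightBounce m x = pure (sw m x (2 * m - 1 - x)) := congrArg pure (exchange_eq_sw _ _ _)
  rw [e1, e2, pure_mul_pure_of_aligned (aligned_bounce h1 h2).1,
    pure_mul_pure_of_aligned (aligned_bounce h1 h2).2, sw_mul_sw_reflect, sub_eq_iff_eq_add,
    add_assoc, add_self, add_zero]
  rfl

theorem omega_eq_commutators : omega m = ∑ i ∈ Finset.Ioo (0 : ℤ) m,
    (leftBounce m i * rightBounce m i - rightBounce m i * leftBounce m i) := by
  rw [Finset.sum_congr rfl fun i hi => bounce_commutator (by rw [Finset.mem_Ioo] at hi; omega)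
    (by rw [Finset.mem_Ioo] at hi; omega), Finset.sum_add_distrib, omega_eq_sum]
  have e : Finset.Icc (2 - m : ℤ) (m - 1) = Finset.Ioo (0 : ℤ) m ∪ Finset.Icc (2 - m : ℤ) 0 := by
    ext x
    have := ‹m.AtLeastTwo›.prop
    rw [Finset.mem_union, Finset.mem_Icc, Finset.mem_Icc, Finset.mem_Ioo]
    omega
  rw [e, Finset.sum_union]
  · congr 1
    refine Finset.sum_nbij' (fun x => 1 - x) (fun x => 1 - x) ?_ ?_ ?_ ?_ ?_
    · intro x hx; rw [Finset.mem_Icc] at hx; rw [Finset.mem_Ioo]; omega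
    · intro x hx; rw [Finset.mem_Ioo] at hx; rw [Finset.mem_Icc]; omega
    · intro x _; ring
    · intro x _; ring
    · intro x _; rw [sub_sub_cancel]
  · rw [Finset.disjoint_left]
    intro x hx hx'
    rw [Finset.mem_Icc] at hx'; rw [Finset.mem_Ioo] at hx; omega

theorem twiceWeight_trans (x : ℤ) : (trans m x).twiceWeight = fun _ => 2 :=
  funext fun _ => across_trans x _

/-- Conjugation by f permutes the translations. They all have the same length and weight, so
corresponding products carry the same coefficient. -/
theorem omega_mul_pure (f : FullPerm m) : omega m * pure f = pure f * omega m := by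
  rw [omega, Finset.sum_mul, Finset.mul_sum]
  symm
  refine Finset.sum_nbij' (fun t => f * t * f⁻¹) (fun t => f⁻¹ * t * f) ?_ ?_ ?_ ?_ ?_
  · intro t ht
    obtain ⟨x, rfl⟩ := mem_transSet.1 ht
    rw [mem_transSet, mul_trans, mul_inv_cancel_right]
    exact ⟨_, rfl⟩
  · intro t ht
    obtain ⟨x, rfl⟩ := mem_transSet.1 ht
    rw [mem_transSet, mul_trans, inv_mul_cancel_right]
    exact ⟨_, rfl⟩
  · intro t _; group
  · intro t _; group
  · intro t ht
    obtain ⟨x, rfl⟩ := mem_transSet.1 ht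
    rw [pure_mul_pure_eq, pure_mul_pure_eq, mul_trans, mul_inv_cancel_right, twiceWeight_trans,
      twiceWeight_trans, cross_trans x (f x), add_comm, add_comm f.cross]

theorem omega_mul (z : PongAlgebra m (m - 1)) : omega m * z = z * omega m := by
  induction z using PongAlgebra.induction with
  | zero => rw [mul_zero, zero_mul]
  | add a b ha hb => rw [mul_add, add_mul, ha, hb]
  | smul r f => rw [PongAlgebra.mul_smul, PongAlgebra.smul_mul, omega_mul_pure]

theorem crossing_of_cross_mul_sw_lt {f : FullPerm m} {x y : ℤ} (hs : Swappable m x y)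
    (h : (f * sw m x y).cross < f.cross) : f.IsLiftedCrossing x y := by
  by_contra hc
  have hxy : x ≠ y := by
    rintro rfl
    have : sw m x x = 1 := ext_apply fun z => by
      rw [sw_apply hs, swapAt_apply hs, one_apply]
      split_ifs <;> ring
    rw [this, mul_one] at h
    omega
  have hf : f x ≠ f y := fun e => hxy (f.apply_eq_iff.1 e)
  have h1 : (f * sw m x y).IsLiftedCrossing x y := by
    rw [crossing_iff] at hc ⊢
    rw [mul_apply, mul_apply, sw_left hs, sw_right hs]
    omega
  have := cross_mul_sw_lt h1
  rw [mul_assoc, sw_mul_self, mul_one] at this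
  omega

/-- Resolving a crossing of the strands x and b makes them exchange their classes modulo the period.
-/
theorem Cov.trans_square {x : ℤ} {g : FullPerm m} (h : Cov (trans m x) g) :
    2 * (m : ℤ) - 2 ∣ g (g x) - x ∧ ¬ 2 * (m : ℤ) - 2 ∣ g x - x := by
  obtain ⟨a, b, hc, rfl, -⟩ := h
  wlog hax : 2 * (m : ℤ) - 2 ∣ a - x generalizing a b with ih
  · wlog hab : a < b generalizing a b with ih'
    · by_cases hbx : 2 * (m : ℤ) - 2 ∣ b - x
      · have := ih b a hc.symm hbx
        rwa [sw_comm hc.symm.swappable] at this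
      · have hab' : b < a := by rw [crossing_iff] at hc; omega
        have := ih' b a hc.symm hbx hab'
        rwa [sw_comm hc.symm.swappable] at this
    -- A crossing of a translation needs a left strand that moves to the right or a right strand
    -- that moves to the left. Here only the second is possible, and a reflection turns it into the
    -- first.
    have hb : 2 * (m : ℤ) - 2 ∣ b + x - 1 := by
      by_contra hb
      have hp := period_pos (m := m)
      rw [crossing_iff, trans_apply, trans_apply, if_neg hax, if_neg hb] at hc
      split_ifs at hc <;> omega
    have h1 := hc.reflect
    have := ih (1 - b) (1 - a) h1.1.symm
      (by rwa [← dvd_neg, show -(1 - b - x) = b + x - 1 by ring])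
    rwa [sw_comm h1.1.symm.swappable, h1.2] at this
  have hs := hc.swappable
  have hne : a ≠ b := by
    rintro rfl
    rw [crossing_iff] at hc; omega
  have tdvd : ∀ z, 2 * (m : ℤ) - 2 ∣ trans m x z - z := by
    intro z
    rw [trans_apply]
    split_ifs
    · rw [add_sub_cancel_left]
    · rw [sub_sub_cancel_left, dvd_neg]
    · rw [sub_self]; exact dvd_zero _
  have h1 : 2 * (m : ℤ) - 2 ∣ (trans m x * sw m a b) x - b := by
    have e1 := (dvd_apply_sub_apply_iff (trans m x * sw m a b) (x := a) (y := x)).2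
      (by rwa [dvd_sub_comm])
    have e2 : (trans m x * sw m a b) a = trans m x b := by rw [mul_apply, sw_left hs]
    have := dvd_add e1 (tdvd b)
    rwa [e2, sub_add_sub_cancel] at this
  refine ⟨?_, fun h => ?_⟩
  · have e1 := (dvd_apply_sub_apply_iff (trans m x * sw m a b)).2 h1
    have e2 : (trans m x * sw m a b) b = trans m x a := by rw [mul_apply, sw_right hs]
    have := dvd_add (dvd_add e1 (e2 ▸ tdvd a)) hax
    rwa [sub_add_sub_cancel, sub_add_sub_cancel] at this
  · rw [swappable_iff] at hs
    refine hne (hs ?_)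
    have := dvd_sub (dvd_sub h h1) hax
    rwa [show (trans m x * sw m a b) x - x - ((trans m x * sw m a b) x - b) - (a - x) = b - a by
      ring] at this

/-- Conjugating the factorization of g by g itself fixes g, and the conjugate translation has the
same length. -/
theorem Cov.conj {x : ℤ} {g : FullPerm m} (h : Cov (trans m x) g) : Cov (trans m (g x)) g := by
  obtain ⟨a, b, hc, e, h1⟩ := h
  have hs := g.swappable_map hc.swappable
  have e1 : trans m (g x) * sw m (g a) (g b) = g := by
    have : trans m (g x) * sw m (g a) (g b) * g = g * g := by
      rw [mul_assoc, ← mul_sw g hc.swappable, ← mul_assoc, ← mul_trans, mul_assoc, ← e]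
    exact mul_right_cancel this
  have e2 : g.cross + 1 = (trans m (g x)).cross := by rw [h1, cross_trans]
  exact ⟨g a, g b, crossing_of_cross_mul_sw_lt hs (by rw [e1]; omega), e1.symm, e2⟩

/-- For fixed g, the translations that cover g are paired by conjugation with g. By
`Cov.trans_square` this has order two and no fixed points, and the paired terms are equal. -/
theorem d_omega : d (omega m) = 0 := by
  classical
  have e : d (omega m) = ∑ f ∈ transSet m, ∑ g ∈ covers f,
      weightMonomial (fun _ => 2) g.twiceWeight • pure g := by
    rw [omega, map_sum]
    refine Finset.sum_congr rfl fun f hf => ?_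
    obtain ⟨x, rfl⟩ := mem_transSet.1 hf
    rw [d_pure_eq_sum, twiceWeight_trans]
  rw [e, Finset.sum_comm' (t' := (transSet m).biUnion covers)
    (s' := fun g => (transSet m).filter fun f => Cov f g)]
  · refine Finset.sum_eq_zero fun g _ => ?_
    refine Finset.sum_involution (fun f _ => g * f * g⁻¹) (fun f _ => add_self _) ?_ ?_ ?_
    · intro f hf _ e
      obtain ⟨hf, hc⟩ := Finset.mem_filter.1 hf
      obtain ⟨x, rfl⟩ := mem_transSet.1 hf
      rw [mul_trans, mul_inv_cancel_right, trans_eq_iff, dvd_sub_comm] at e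
      exact hc.trans_square.2 e
    · intro f hf
      obtain ⟨hf, hc⟩ := Finset.mem_filter.1 hf
      obtain ⟨x, rfl⟩ := mem_transSet.1 hf
      rw [mul_trans, mul_inv_cancel_right]
      exact Finset.mem_filter.2 ⟨mem_transSet.2 ⟨_, rfl⟩, hc.conj⟩
    · intro f hf
      obtain ⟨hf, hc⟩ := Finset.mem_filter.1 hf
      obtain ⟨x, rfl⟩ := mem_transSet.1 hf
      rw [mul_trans, mul_inv_cancel_right, mul_trans, mul_inv_cancel_right, trans_eq_iff,
        dvd_sub_comm]
      exact hc.trans_square.1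
  · intro f g
    rw [Finset.mem_filter, Finset.mem_biUnion, mem_covers]
    exact ⟨fun h => ⟨h, f, h.1, mem_covers.2 h.2⟩, fun h => h.1⟩

end FullPerm

/-! ### Splitting a complex along a grading. -/

section

variable {F V B W : Type*} [Field F] [AddCommGroup V] [Module F V] {b : Module.Basis B F V}
  {d : V →ₗ[F] V}

/-- Acyclicity can be checked in each degree of a grading which is respected by the differential. -/
theorem AcyclicOn.of_grading (ω : B → W) (hω : ∀ x y, b.repr (d (b x)) y ≠ 0 → ω y = ω x)
    {I : Set B} (h : ∀ w, AcyclicOn b d {x | ω x = w ∧ x ∈ I}) : AcyclicOn b d I := by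
  classical
  intro z hz hdz
  set s : Finset W := (b.repr z).support.image ω with hs
  set c : W → V := fun w => b.repr.symm ((b.repr z).filter fun x => ω x = w) with hc
  have hrepr : ∀ w x, b.repr (c w) x = if ω x = w then b.repr z x else 0 := by
    intro w x
    rw [hc]
    dsimp only
    rw [LinearEquiv.apply_symm_apply, Finsupp.filter_apply]
  have hsum : z = ∑ w ∈ s, c w := by
    refine b.repr.injective (Finsupp.ext fun x => ?_)
    rw [map_sum, Finsupp.finsetSum_apply, Finset.sum_congr rfl fun w _ => hrepr w x,
      Finset.sum_ite_eq]
    split_ifs with h1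
    · rfl
    · by_contra h2
      exact h1 (Finset.mem_image_of_mem ω (Finsupp.mem_support_iff.2 h2))
  have hdc : ∀ w, d (c w) = 0 := by
    intro w
    refine b.repr.injective (Finsupp.ext fun y => ?_)
    rw [map_zero, Finsupp.zero_apply]
    by_cases hy : ω y = w
    · have h0 : b.repr (d z) y = 0 := by rw [hdz, map_zero, Finsupp.zero_apply]
      rw [← h0, repr_map_eq_sum, repr_map_eq_sum, Finsupp.sum_of_support_subset (s := (b.repr z).support),
        Finsupp.sum]
      · refine Finset.sum_congr rfl fun x _ => ?_
        rw [hrepr]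
        split_ifs with hx
        · rfl
        · have : b.repr (d (b x)) y = 0 := by
            by_contra hne
            exact hx ((hω x y hne).symm.trans hy)
          rw [this, mul_zero, mul_zero]
      · intro x hx
        rw [Finsupp.mem_support_iff, hrepr] at hx
        rw [Finsupp.mem_support_iff]
        intro h0
        rw [h0, ite_self] at hx
        exact hx rfl
      · intro x _; rw [zero_mul]
    · rw [repr_map_eq_sum]
      refine Finset.sum_eq_zero fun x _ => ?_
      dsimp only
      rw [hrepr]
      split_ifs with hx
      · have : b.repr (d (b x)) y = 0 := by
          by_contra hne
          exact hy ((hω x y hne).trans hx)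
        rw [this, mul_zero]
      · rw [zero_mul]
  have hex : ∀ w, ∃ y, d y = c w := by
    intro w
    refine h w (c w) (fun x hx => ?_) (hdc w)
    rw [hrepr]
    split_ifs with h1
    · exact hz x fun h2 => hx ⟨h1, h2⟩
    · rfl
  choose y hy using hex
  refine ⟨∑ w ∈ s, y w, ?_⟩
  rw [map_sum, hsum]
  exact Finset.sum_congr rfl fun w _ => hy w

end

/-! ### The complex over the field with two elements, graded by total weight. -/

namespace FullPerm

open LiftedPartialPerm PongAlgebra

variable {m : ℕ} [m.AtLeastTwo]

noncomputable instance {k : ℕ} : IsScalarTower (ZMod 2) (BaseRing m) (PongAlgebra m k) :=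
  IsScalarTower.of_algebraMap_smul fun _ _ => rfl

/-- The differential of the pong algebra as a linear map over the field with two elements. -/
noncomputable def dZ (m : ℕ) [m.AtLeastTwo] : PongAlgebra m (m - 1) →ₗ[ZMod 2] PongAlgebra m (m - 1) :=
  d.restrictScalars (ZMod 2)

theorem dZ_apply (z : PongAlgebra m (m - 1)) : dZ m z = d z := rfl

/-- The basis of the pong algebra over the base ring. -/
noncomputable def pureBasis (m : ℕ) [m.AtLeastTwo] :
    Module.Basis (FullPerm m) (BaseRing m) (PongAlgebra m (m - 1)) :=
  ⟨LinearEquiv.refl (BaseRing m) (FullPerm m →₀ BaseRing m)⟩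

theorem pureBasis_apply (f : FullPerm m) : pureBasis m f = pure f := rfl

/-- The basis of the pong algebra over the field with two elements. -/
noncomputable def basis (m : ℕ) [m.AtLeastTwo] :
    Module.Basis ((Fin m →₀ ℕ) × FullPerm m) (ZMod 2) (PongAlgebra m (m - 1)) :=
  (MvPolynomial.basisMonomials (Fin m) (ZMod 2)).smulTower (pureBasis m)

theorem basis_apply (x : (Fin m →₀ ℕ) × FullPerm m) :
    basis m x = (MvPolynomial.monomial x.1 1 : BaseRing m) • (pure x.2 : PongAlgebra m (m - 1)) := by
  rw [basis, Module.Basis.smulTower_apply, MvPolynomial.coe_basisMonomials, pureBasis_apply]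

theorem basis_repr (z : PongAlgebra m (m - 1)) (x : (Fin m →₀ ℕ) × FullPerm m) :
    (basis m).repr z x = ((pureBasis m).repr z x.2).coeff x.1 := by
  rw [basis, Module.Basis.smulTower_repr]
  rfl

/-- The weight of a full lifted permutation. -/
noncomputable def weight (f : FullPerm m) : Fin m →₀ ℕ :=
  Finsupp.equivFunOnFinite.symm fun l => f.twiceWeight l / 2

theorem two_mul_weight (f : FullPerm m) (l : Fin m) : 2 * weight f l = f.across (l : ℕ) := by
  have h := even_across f (l : ℕ)
  rw [Nat.even_iff] at h
  change 2 * (f.across (l : ℕ) / 2) = _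
  omega

theorem bounded_iff {w : Fin m →₀ ℕ} {f : FullPerm m} : Bounded w f ↔ weight f ≤ w := by
  refine forall_congr' fun l => ?_
  rw [← two_mul_weight]
  omega

theorem Cov.weight_le {f g : FullPerm m} (h : Cov f g) : weight g ≤ weight f := by
  intro l
  have := h.across_le l
  rw [← two_mul_weight, ← two_mul_weight] at this
  omega

theorem Cov.weightMonomial_eq {f g : FullPerm m} (h : Cov f g) :
    weightMonomial f.twiceWeight g.twiceWeight =
      MvPolynomial.monomial (weight f - weight g) 1 := by
  rw [FullPerm.weightMonomial_eq]
  refine congrArg (fun e => MvPolynomial.monomial e 1) (Finsupp.ext fun l => ?_)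
  have h1 := two_mul_weight f l
  have h2 := two_mul_weight g l
  have h3 : weight g l ≤ weight f l := h.weight_le l
  change (f.across (l : ℕ) - g.across (l : ℕ)) / 2 = weight f l - weight g l
  omega

-- A cover lowers the weight, and the monomial in the differential makes up for exactly the loss. So
-- the coefficient is a matter of the cover relation and the total weight alone.
open Classical in
theorem repr_d_basis (x y : (Fin m →₀ ℕ) × FullPerm m) : (basis m).repr (dZ m (basis m x)) y =
    if Cov x.2 y.2 ∧ y.1 + weight y.2 = x.1 + weight x.2 then 1 else 0 := by
  have e : dZ m (basis m x) = ∑ g ∈ covers x.2, basis m (x.1 + (weight x.2 - weight g), g) := by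
    rw [basis_apply, dZ_apply, LinearMap.map_smul, d_pure_eq_sum, Finset.smul_sum]
    refine Finset.sum_congr rfl fun g hg => ?_
    rw [basis_apply, (mem_covers.1 hg).weightMonomial_eq, smul_smul, MvPolynomial.monomial_mul,
      mul_one]
  rw [e, map_sum, Finsupp.finsetSum_apply]
  simp only [Module.Basis.repr_self, Finsupp.single_apply]
  by_cases hc : Cov x.2 y.2
  · rw [Finset.sum_eq_single_of_mem y.2 (mem_covers.2 hc)]
    · refine if_congr ?_ rfl rfl
      have h1 : x.1 + (weight x.2 - weight y.2) + weight y.2 = x.1 + weight x.2 := by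
        rw [add_assoc, tsub_add_cancel_of_le hc.weight_le]
      constructor
      · intro h
        exact ⟨hc, by rw [← congrArg Prod.fst h, h1]⟩
      · rintro ⟨-, h⟩
        rw [← h1] at h
        exact Prod.ext (add_right_cancel h).symm rfl
    · intro g _ hg
      exact if_neg fun h => hg (congrArg Prod.snd h)
  · rw [if_neg fun h => hc h.1]
    refine Finset.sum_eq_zero fun g hg => if_neg fun h => hc ?_
    rw [← h]
    exact mem_covers.1 hg

theorem cov_of_repr_ne_zero {x y : (Fin m →₀ ℕ) × FullPerm m}
    (h : (basis m).repr (dZ m (basis m x)) y ≠ 0) :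
    Cov x.2 y.2 ∧ y.1 + weight y.2 = x.1 + weight x.2 := by
  classical
  rw [repr_d_basis] at h
  by_contra h'
  exact h (if_neg h')

/-- In total weight w each permutation of weight at most w occurs with exactly one monomial, so a
statement about sets of permutations is one about the complex. The complement of an upward closed
set spans a subcomplex. -/
theorem Collapses.acyclicOn {w : Fin m →₀ ℕ} {R : Set (FullPerm m)}
    (h : Collapses {f | Bounded w f} R) :
    AcyclicOn (basis m) (dZ m) {x | x.1 + weight x.2 = w ∧ x.2 ∉ R} := by
  classical
  suffices AcyclicOn (basis m) (dZ m) {x | x.1 + weight x.2 = w ∧ x.2 ∉ R} ∧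
      R ⊆ {f | Bounded w f} ∧
      IsLowerFor (basis m) (dZ m) {x | x.1 + weight x.2 = w ∧ x.2 ∉ R} from this.1
  have hbd : ∀ x : (Fin m →₀ ℕ) × FullPerm m, x.1 + weight x.2 = w → Bounded w x.2 := by
    intro x hx
    rw [bounded_iff, ← hx]
    exact le_add_self
  have hlow : ∀ R : Set (FullPerm m),
      (∀ f ∈ {f | Bounded w f}, ∀ g ∈ R, Cov f g → f ∈ R) →
      IsLowerFor (basis m) (dZ m) {x | x.1 + weight x.2 = w ∧ x.2 ∉ R} := by
    intro R hR x hx y hy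
    by_contra hne
    obtain ⟨h1, h2⟩ := cov_of_repr_ne_zero hne
    refine hy ⟨h2.trans hx.1, fun hyR => hx.2 (hR _ (hbd x hx.1) _ hyR h1)⟩
  induction h with
  | refl =>
    refine ⟨fun z hz _ => ⟨0, ?_⟩, subset_rfl, hlow _ fun f hf _ _ _ => hf⟩
    rw [map_zero]
    refine ((basis m).repr.map_eq_zero_iff.1 (Finsupp.ext fun x => ?_)).symm
    exact hz x fun h => h.2 (hbd x h.1)
  | @step R R' τ _ hsub hup hM ih =>
    obtain ⟨ih1, ih2, ih3⟩ := ih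
    refine ⟨?_, hsub.trans ih2, hlow _ hup⟩
    have hmem : ∀ x : (Fin m →₀ ℕ) × FullPerm m,
        x ∈ {x : (Fin m →₀ ℕ) × FullPerm m | x.1 + weight x.2 = w ∧ x.2 ∉ R'} \
          {x | x.1 + weight x.2 = w ∧ x.2 ∉ R} ↔ x.1 + weight x.2 = w ∧ x.2 ∈ R \ R' := by
      intro x
      constructor
      · rintro ⟨h1, h2⟩
        exact ⟨h1.1, by_contra fun h3 => h2 ⟨h1.1, h3⟩, h1.2⟩
      · rintro ⟨h1, h2⟩
        exact ⟨⟨h1, h2.2⟩, fun h3 => h3.2 h2.1⟩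
    have hτw : ∀ f ∈ R \ R', w - weight (τ f) + weight (τ f) = w := fun f hf =>
      tsub_add_cancel_of_le (bounded_iff.1 (ih2 (hM.maps f hf).1))
    -- The matching is lifted by giving each partner the only monomial that keeps the total weight
    -- equal to w.
    refine AcyclicOn.of_matching (U := {x | (τ x.2).cross < x.2.cross})
      (fun z => by rw [dZ_apply, dZ_apply, d_d]) ih3 (hlow _ hup)
      (fun x => (w - weight (τ x.2), τ x.2)) ?_ ?_ ?_ ?_ ?_ ih1
    · intro x hx
      rw [hmem] at hx ⊢
      exact ⟨hτw _ hx.2, hM.maps _ hx.2⟩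
    · intro x hx
      rw [hmem] at hx
      refine Prod.ext ?_ (hM.invol _ hx.2)
      dsimp only
      rw [hM.invol _ hx.2, ← hx.1, add_tsub_cancel_right]
    · intro x hx
      rw [hmem] at hx
      change (τ (τ x.2)).cross < (τ x.2).cross ↔ ¬ (τ x.2).cross < x.2.cross
      rw [hM.invol _ hx.2]
      have := hM.cross_ne _ hx.2
      omega
    · intro x hx hxU
      rw [hmem] at hx
      rw [repr_d_basis, if_pos]
      exact ⟨hM.cov _ hx.2 hxU, (hτw _ hx.2).trans hx.1.symm⟩
    · intro x hx hxU y hy hyU hne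
      rw [hmem] at hx hy
      rw [repr_d_basis, if_neg]
      rintro ⟨h1, -⟩
      rcases hM.rigid _ hx.2 _ hy.2 h1 hxU with h2 | h2
      · refine hne (Prod.ext ?_ h2)
        dsimp only
        rw [← h2, ← hy.1, add_tsub_cancel_right]
      · exact hyU h2

theorem weight_trans_pow (x : ℤ) (k : ℕ) : ⇑(weight (trans m x ^ k)) = fun _ => k := by
  funext l
  have := two_mul_weight (trans m x ^ k) l
  rw [across_trans_pow] at this
  omega

/-- The basis elements that carry the homology of the pong algebra. -/
noncomputable def critical (m : ℕ) [m.AtLeastTwo] (k : ℕ) : (Fin m →₀ ℕ) × FullPerm m :=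
  (0, trans m (pivot m) ^ k)

theorem grading_eq (x y : (Fin m →₀ ℕ) × FullPerm m)
    (h : (basis m).repr (dZ m (basis m x)) y ≠ 0) :
    (fun x : (Fin m →₀ ℕ) × FullPerm m => x.1 + weight x.2) y =
      (fun x : (Fin m →₀ ℕ) × FullPerm m => x.1 + weight x.2) x :=
  (cov_of_repr_ne_zero h).2

theorem acyclicOn_critical (hm : 3 ≤ m) :
    AcyclicOn (basis m) (dZ m) {x | x ∉ Set.range (critical m)} := by
  refine AcyclicOn.of_grading _ grading_eq fun w => ?_
  by_cases hw : ∃ k, ∀ l, w l = k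
  · obtain ⟨k, hk⟩ := hw
    have h1 := collapses_singleton hm k
    rw [← funext hk] at h1
    convert h1.acyclicOn using 1
    ext x
    refine and_congr_right fun hx => not_congr ?_
    rw [Set.mem_singleton_iff]
    constructor
    · rintro ⟨j, rfl⟩
      rw [critical, zero_add] at hx
      have : j = k := by
        have hl : 0 < m := by omega
        rw [← hk ⟨0, hl⟩, ← hx, weight_trans_pow]
      rw [this]; rfl
    · intro e
      refine ⟨k, Prod.ext ?_ e.symm⟩
      have h2 : weight (trans m (pivot m) ^ k) = w := by
        refine DFunLike.coe_injective ?_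
        rw [weight_trans_pow, ← funext hk]
      rw [e, h2] at hx
      exact (add_eq_right.1 hx).symm
  · have h1 := (collapses_empty hw).acyclicOn
    convert h1 using 1
    ext x
    refine and_congr_right fun hx => ⟨fun _ h => h, fun _ => ?_⟩
    rintro ⟨j, rfl⟩
    rw [critical, zero_add] at hx
    refine hw ⟨j, fun l => ?_⟩
    rw [← hx, weight_trans_pow]

theorem Collapses.upward {C R : Set (FullPerm m)} (h : Collapses C R) {f g : FullPerm m}
    (hf : f ∈ C) (hg : g ∈ R) (hc : Cov f g) : f ∈ R := by
  cases h with
  | refl => exact hf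
  | step _ _ _ hup _ => exact hup f hf g hg hc

/-- The last remaining set is closed upwards and has one element, so anything covering that element
within the bound would be the element itself. Hence this coefficient is a functional on homology. -/
theorem repr_d_critical (hm : 3 ≤ m) (z : PongAlgebra m (m - 1)) (k : ℕ) :
    (basis m).repr (dZ m z) (critical m k) = 0 := by
  rw [repr_map_eq_sum]
  refine Finset.sum_eq_zero fun x _ => ?_
  refine mul_eq_zero_of_right _ (by_contra fun hne => ?_)
  obtain ⟨h1, h2⟩ := cov_of_repr_ne_zero hne
  rw [critical, zero_add] at h2
  have hb : Bounded (fun _ => k) x.2 := by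
    rw [← weight_trans_pow (m := m) (pivot m) k, bounded_iff, h2]
    exact le_add_self
  have h3 := (collapses_singleton hm k).upward hb (Set.mem_singleton _) h1
  obtain ⟨-, -, -, -, h4⟩ := h1
  rw [Set.mem_singleton_iff.1 h3] at h4
  exact absurd h4 (Nat.succ_ne_self _)

end FullPerm

/-! ### Powers of Ω and the homology of P(m, m-1). -/

namespace FullPerm

open LiftedPartialPerm PongAlgebra

variable {m : ℕ} [m.AtLeastTwo]

/-- The span of the full lifted permutations that map the pivot to a number less than `c`. -/
noncomputable def lowSpan (m : ℕ) [m.AtLeastTwo] (c : ℤ) : Submodule (BaseRing m) (PongAlgebra m (m - 1)) :=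
  Submodule.span (BaseRing m) (pure '' {g : FullPerm m | g (pivot m) < c})

theorem pure_mul_pure_mem {c : ℤ} {g f : FullPerm m} (h : g (f (pivot m)) < c) :
    pure g * pure f ∈ lowSpan m c := by
  rw [pure_mul_pure_eq, term]
  split_ifs
  · exact Submodule.smul_mem _ _ (Submodule.subset_span ⟨g * f, h, rfl⟩)
  · exact Submodule.zero_mem _

theorem repr_eq_zero_of_mem_lowSpan {c : ℤ} {z : PongAlgebra m (m - 1)} (hz : z ∈ lowSpan m c)
    {f : FullPerm m} (hf : c ≤ f (pivot m)) : (pureBasis m).repr z f = 0 := by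
  induction hz using Submodule.span_induction with
  | mem x hx =>
    obtain ⟨g, hg, rfl⟩ := hx
    rw [← pureBasis_apply, Module.Basis.repr_self, Finsupp.single_eq_of_ne]
    rintro rfl
    exact absurd hg (not_lt.2 hf)
  | zero => rw [map_zero, Finsupp.zero_apply]
  | add x y _ _ hx hy => rw [map_add, Finsupp.add_apply, hx, hy, add_zero]
  | smul r x _ hx => rw [_root_.map_smul, Finsupp.smul_apply, hx, smul_zero]

/-- A single translation moves the pivot, and hence its image, by at most one period. -/
theorem mul_omega_mem_lowSpan {c : ℤ} {z : PongAlgebra m (m - 1)} (hz : z ∈ lowSpan m c) :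
    z * omega m ∈ lowSpan m (c + (2 * m - 2)) := by
  have hp := period_pos (m := m)
  induction hz using Submodule.span_induction with
  | mem x hx =>
    obtain ⟨g, hg, rfl⟩ := hx
    rw [omega, Finset.mul_sum]
    refine Submodule.sum_mem _ fun f hf => pure_mul_pure_mem ?_
    obtain ⟨x, rfl⟩ := mem_transSet.1 hf
    have h1 := FullPerm.apply_add_period g (pivot m) 1
    have h2 := FullPerm.apply_add_period g (pivot m) (-1)
    rw [mul_one] at h1
    rw [mul_neg, mul_one, ← sub_eq_add_neg, ← sub_eq_add_neg] at h2
    rw [Set.mem_ofPred_eq] at hg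
    rw [trans_apply]
    split_ifs <;> omega
  | zero => rw [zero_mul]; exact Submodule.zero_mem _
  | add x y _ _ hx hy => rw [add_mul]; exact Submodule.add_mem _ hx hy
  | smul r x _ hx => rw [PongAlgebra.smul_mul]; exact Submodule.smul_mem _ _ hx

/-- Among the j-fold products of translations only the power of the translation at the pivot moves
the pivot by j full periods, so it occurs just once in the expansion. The bound of `lowSpan` is
strict. -/
theorem omega_pow_sub_mem (j : ℕ) : omega m ^ j - pure (trans m (pivot m) ^ j) ∈
    lowSpan m (pivot m + (2 * m - 2) * j) := by
  classical
  have hp := period_pos (m := m)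
  induction j with
  | zero => rw [pow_zero, pow_zero, pure_one, sub_self]; exact Submodule.zero_mem _
  | succ j ih =>
    have h1 := mul_omega_mem_lowSpan ih
    have h2 : pure (trans m (pivot m) ^ j) * omega m - pure (trans m (pivot m) ^ (j + 1)) ∈
        lowSpan m (pivot m + (2 * m - 2) * j + (2 * m - 2)) := by
      have h3 : trans m (pivot m) ∈ transSet m := mem_transSet.2 ⟨_, rfl⟩
      rw [omega, Finset.mul_sum, ← Finset.add_sum_erase _ _ h3,
        pure_mul_pure_of_aligned (aligned_trans _ _), ← pow_succ, add_sub_cancel_left]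
      refine Submodule.sum_mem _ fun f hf => pure_mul_pure_mem ?_
      rw [Finset.mem_erase] at hf
      obtain ⟨x, rfl⟩ := mem_transSet.1 hf.2
      have h4 : ¬ 2 * (m : ℤ) - 2 ∣ pivot m - x := fun h => hf.1 (trans_eq_iff.2 h)
      have h5 := (trans m (pivot m) ^ j).apply_add_period (pivot m) (-1)
      rw [mul_neg, mul_one, ← sub_eq_add_neg, ← sub_eq_add_neg] at h5
      rw [trans_apply, if_neg h4]
      have h6 : (trans m (pivot m) ^ j) (pivot m) = pivot m + (2 * m - 2) * j := by
        rw [trans_pow_apply, if_pos (by rw [sub_self]; exact dvd_zero _)]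
      split_ifs <;> omega
    have h3 := Submodule.add_mem _ h1 h2
    rw [sub_mul (omega m ^ j), ← pow_succ, sub_add_sub_cancel] at h3
    convert h3 using 2
    push_cast; ring

theorem repr_omega_pow (j k : ℕ) (h : j ≤ k) :
    (basis m).repr (omega m ^ j) (critical m k) = if j = k then 1 else 0 := by
  classical
  have hp := period_pos (m := m)
  have h6 : (trans m (pivot m) ^ k) (pivot m) = pivot m + (2 * m - 2) * k := by
    rw [trans_pow_apply, if_pos (by rw [sub_self]; exact dvd_zero _)]
  have h1 := repr_eq_zero_of_mem_lowSpan (omega_pow_sub_mem (m := m) j)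
    (f := trans m (pivot m) ^ k) (by
      rw [h6]
      have : (2 * (m : ℤ) - 2) * j ≤ (2 * (m : ℤ) - 2) * k :=
        mul_le_mul_of_nonneg_left (by exact_mod_cast h) hp.le
      omega)
  rw [map_sub, Finsupp.sub_apply, sub_eq_zero] at h1
  rw [basis_repr, critical, h1, ← pureBasis_apply, Module.Basis.repr_self, Finsupp.single_apply]
  have h2 : trans m (pivot m) ^ j = trans m (pivot m) ^ k ↔ j = k := by
    refine ⟨fun e => ?_, fun e => by rw [e]⟩
    have h3 := across_trans_pow (m := m) (pivot m) 0 j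
    rw [e, across_trans_pow] at h3
    omega
  rw [if_congr h2 rfl rfl]
  split_ifs
  · exact MvPolynomial.coeff_zero_one
  · exact MvPolynomial.coeff_zero _

/-- Every cycle of the pong algebra is homologous to a polynomial in `Ω`. -/
theorem exists_polynomial (hm : 3 ≤ m) {z : PongAlgebra m (m - 1)} (hz : d z = 0) :
    ∃ (p : Polynomial (ZMod 2)) (y : PongAlgebra m (m - 1)), z = p.aeval (omega m) + d y := by
  have key : ∀ (n : ℕ) (z : PongAlgebra m (m - 1)), d z = 0 →
      (∀ k, n ≤ k → (basis m).repr z (critical m k) = 0) →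
      ∃ (p : Polynomial (ZMod 2)) (y : PongAlgebra m (m - 1)), z = p.aeval (omega m) + d y := by
    intro n
    induction n with
    | zero =>
      intro z hz h
      obtain ⟨y, hy⟩ := acyclicOn_critical hm z (fun x hx => by
        obtain ⟨k, rfl⟩ := not_not.1 hx
        exact h k (Nat.zero_le _)) hz
      exact ⟨0, y, by rw [map_zero, zero_add, ← hy]; rfl⟩
    | succ n ih =>
      intro z hz h
      obtain ⟨c, hc⟩ : ∃ c, c = (basis m).repr z (critical m n) := ⟨_, rfl⟩
      have hd : ∀ n, d (omega m ^ n) = 0 := by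
        intro n
        induction n with
        | zero => rw [pow_zero, d_one]
        | succ n ih => rw [pow_succ, d_mul, ih, d_omega, zero_mul, mul_zero, add_zero]
      -- Subtracting a multiple of the n-th power of Ω clears the highest critical coefficient and
      -- keeps the higher ones zero.
      obtain ⟨p, y, hp⟩ := ih (z - c • omega m ^ n) (by
        rw [← dZ_apply, map_sub, _root_.map_smul, dZ_apply, dZ_apply, hz, hd, smul_zero, sub_zero])
        fun k hk => by
          rw [map_sub, _root_.map_smul, Finsupp.sub_apply, Finsupp.smul_apply, repr_omega_pow _ _ hk]
          split_ifs with e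
          · rw [← e, ← hc, smul_eq_mul, mul_one, sub_self]
          · rw [h k (by omega), smul_zero, sub_zero]
      refine ⟨p + Polynomial.C c * Polynomial.X ^ n, y, ?_⟩
      rw [sub_eq_iff_eq_add] at hp
      rw [hp, map_add, map_mul, Polynomial.aeval_C, map_pow, Polynomial.aeval_X, ← Algebra.smul_def]
      abel
  obtain ⟨n, hn⟩ : ∃ n, ∀ k, n ≤ k → (basis m).repr z (critical m k) = 0 := by
    have hinj : Function.Injective (critical m) := by
      intro j k e
      have h3 := across_trans_pow (m := m) (pivot m) 0 j
      rw [show trans m (pivot m) ^ j = trans m (pivot m) ^ k from congrArg Prod.snd e,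
        across_trans_pow] at h3
      omega
    obtain ⟨N, hN⟩ := (((basis m).repr z).support.finite_toSet.preimage hinj.injOn).bddAbove
    refine ⟨N + 1, fun k hk => by_contra fun hne => ?_⟩
    have := hN (show k ∈ _ from Finsupp.mem_support_iff.2 hne)
    omega
  exact key n z hz hn

/-- The leading coefficient is the value at the critical element indexed by the degree, where every
boundary vanishes. -/
theorem polynomial_eq_zero (hm : 3 ≤ m) {p : Polynomial (ZMod 2)} {y : PongAlgebra m (m - 1)}
    (h : p.aeval (omega m) = d y) : p = 0 := by
  by_contra hp
  have h1 := repr_d_critical hm y p.natDegree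
  rw [dZ_apply, ← h, Polynomial.aeval_eq_sum_range, map_sum, Finsupp.finsetSum_apply,
    Finset.sum_eq_single p.natDegree] at h1
  · rw [_root_.map_smul, Finsupp.smul_apply, repr_omega_pow _ _ le_rfl, if_pos rfl, smul_eq_mul, mul_one]
      at h1
    exact hp (Polynomial.leadingCoeff_eq_zero.1 h1)
  · intro j hj hne
    rw [Finset.mem_range] at hj
    rw [_root_.map_smul, Finsupp.smul_apply, repr_omega_pow _ _ (by omega), if_neg hne, smul_zero]
  · intro h; exact absurd (Finset.mem_range.2 (Nat.lt_succ_self _)) h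

end FullPerm

/-! ### Squarefree sums with polynomial coefficients. -/

section normalForm

variable {A A' : Type*} [Ring A] [Algebra (ZMod 2) A] [Ring A'] [Algebra (ZMod 2) A']

/-- The combination of the squarefree ordered monomials in `x 0, …, x (j - 1)`, with coefficients
that are polynomials in `ω`. -/
noncomputable def squarefreeSum (x : ℕ → A) (ω : A) : ℕ → (Finset ℕ → Polynomial (ZMod 2)) → A
  | 0, c => (c ∅).aeval ω
  | j + 1, c => squarefreeSum x ω j c + x j * squarefreeSum x ω j fun s => c (insert j s)

/-- The coefficients are indexed by all finite sets so that the recursion needs no dependent types;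
only the subsets of `Finset.range j` count. -/
theorem squarefreeSum_congr (x : ℕ → A) (ω : A) (j : ℕ) {c c' : Finset ℕ → Polynomial (ZMod 2)}
    (h : ∀ s, s ⊆ Finset.range j → c s = c' s) :
    squarefreeSum x ω j c = squarefreeSum x ω j c' := by
  induction j generalizing c c' with
  | zero => rw [squarefreeSum, squarefreeSum, h _ (Finset.empty_subset _)]
  | succ j ih =>
    rw [squarefreeSum, squarefreeSum, ih fun s hs => h s (hs.trans (Finset.range_mono (by omega))),
      ih fun s hs => h (insert j s) ?_]
    rw [Finset.range_add_one]
    exact Finset.insert_subset_insert _ hs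

theorem squarefreeSum_zero (x : ℕ → A) (ω : A) (j : ℕ) :
    squarefreeSum x ω j (fun _ => 0) = 0 := by
  induction j with
  | zero => rw [squarefreeSum, map_zero]
  | succ j ih => rw [squarefreeSum, ih, mul_zero, add_zero]

theorem squarefreeSum_eq_zero (x : ℕ → A) (ω : A) (j : ℕ) {c : Finset ℕ → Polynomial (ZMod 2)}
    (h : ∀ s, s ⊆ Finset.range j → c s = 0) : squarefreeSum x ω j c = 0 :=
  (squarefreeSum_congr x ω j h).trans (squarefreeSum_zero x ω j)

theorem squarefreeSum_add (x : ℕ → A) (ω : A) (j : ℕ) (c c' : Finset ℕ → Polynomial (ZMod 2)) :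
    squarefreeSum x ω j (fun s => c s + c' s) =
      squarefreeSum x ω j c + squarefreeSum x ω j c' := by
  induction j generalizing c c' with
  | zero => rw [squarefreeSum, squarefreeSum, squarefreeSum, map_add]
  | succ j ih => rw [squarefreeSum, squarefreeSum, squarefreeSum, ih, ih, mul_add]; abel

/-- The inverse of the recursion: it glues the coefficients of the terms with and without the last
generator into one family. -/
theorem squarefreeSum_combine (x : ℕ → A) (ω : A) (j : ℕ) (c c' : Finset ℕ → Polynomial (ZMod 2)) :
    squarefreeSum x ω (j + 1) (fun s => if j ∈ s then c' (s.erase j) else c s) =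
      squarefreeSum x ω j c + x j * squarefreeSum x ω j c' := by
  rw [squarefreeSum]
  congr 1
  · refine squarefreeSum_congr x ω j fun s hs => if_neg fun h => ?_
    exact absurd (Finset.mem_range.1 (hs h)) (lt_irrefl j)
  · congr 1
    refine squarefreeSum_congr x ω j fun s hs => ?_
    have h : j ∉ s := fun h => absurd (Finset.mem_range.1 (hs h)) (lt_irrefl j)
    rw [if_pos (Finset.mem_insert_self j s), Finset.erase_insert h]

theorem map_squarefreeSum (φ : A →ₐ[ZMod 2] A') {x : ℕ → A} {x' : ℕ → A'} {ω : A} {ω' : A'}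
    {j : ℕ} (hx : ∀ i < j, φ (x i) = x' i) (hω : φ ω = ω') (c : Finset ℕ → Polynomial (ZMod 2)) :
    φ (squarefreeSum x ω j c) = squarefreeSum x' ω' j c := by
  induction j generalizing c with
  | zero => rw [squarefreeSum, squarefreeSum, ← hω, Polynomial.aeval_algHom_apply]
  | succ j ih =>
    rw [squarefreeSum, squarefreeSum, map_add, map_mul, hx j (by omega),
      ih fun i hi => hx i (by omega), ih fun i hi => hx i (by omega)]

theorem squarefreeSum_mem (S : Subalgebra (ZMod 2) A) {x : ℕ → A} {ω : A} {j : ℕ}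
    (hx : ∀ i < j, x i ∈ S) (hω : ω ∈ S) (c : Finset ℕ → Polynomial (ZMod 2)) :
    squarefreeSum x ω j c ∈ S := by
  induction j generalizing c with
  | zero => exact Polynomial.aeval_mem_adjoin_singleton _ _ |> Algebra.adjoin_le (by simpa using hω)
  | succ j ih =>
    exact S.add_mem (ih (fun i hi => hx i (by omega)) _)
      (S.mul_mem (hx j (by omega)) (ih (fun i hi => hx i (by omega)) _))

end normalForm

/-! ### Dividing out the variables one at a time. -/

namespace FullPerm

open LiftedPartialPerm PongAlgebra

variable {m : ℕ} [m.AtLeastTwo]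

/-- The multiples of the first `j` variables. -/
noncomputable def varMultiples (m : ℕ) [m.AtLeastTwo] (j : ℕ) :
    Submodule (BaseRing m) (PongAlgebra m (m - 1)) :=
  Ideal.span (MvPolynomial.X '' {i : Fin m | (i : ℕ) < j} : Set (BaseRing m)) • ⊤

theorem mem_varMultiples_iff {j : ℕ} {z : PongAlgebra m (m - 1)} : z ∈ varMultiples m j ↔
    ∀ f, (pureBasis m).repr z f ∈
      Ideal.span (MvPolynomial.X '' {i : Fin m | (i : ℕ) < j} : Set (BaseRing m)) := by
  constructor
  · intro h f
    induction h using Submodule.smul_induction_on' with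
    | smul r hr n _ =>
      rw [_root_.map_smul, Finsupp.smul_apply, smul_eq_mul]
      exact Ideal.mul_mem_right _ _ hr
    | add x _ y _ hx hy => rw [map_add, Finsupp.add_apply]; exact Ideal.add_mem _ hx hy
  · intro h
    rw [← (pureBasis m).linearCombination_repr z, Finsupp.linearCombination_apply]
    exact Submodule.sum_mem _ fun f _ => Submodule.smul_mem_smul (h f) trivial

theorem map_mem_varMultiples (T : PongAlgebra m (m - 1) →ₗ[BaseRing m] PongAlgebra m (m - 1))
    {j : ℕ} {z : PongAlgebra m (m - 1)} (h : z ∈ varMultiples m j) : T z ∈ varMultiples m j := by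
  induction h using Submodule.smul_induction_on' with
  | smul r hr n _ =>
    rw [_root_.map_smul]
    exact Submodule.smul_mem_smul hr trivial
  | add x _ y _ hx hy => rw [map_add]; exact Submodule.add_mem _ hx hy

theorem d_mem_varMultiples {j : ℕ} {z : PongAlgebra m (m - 1)} (h : z ∈ varMultiples m j) :
    d z ∈ varMultiples m j := map_mem_varMultiples d h

theorem mul_mem_varMultiples {j : ℕ} {z : PongAlgebra m (m - 1)} (h : z ∈ varMultiples m j)
    (a : PongAlgebra m (m - 1)) : a * z ∈ varMultiples m j :=
  map_mem_varMultiples (LinearMap.mulLeft (BaseRing m) a) h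

theorem varMultiples_zero : varMultiples m 0 = ⊥ := by
  rw [varMultiples]
  simp

theorem varMultiples_mono {i j : ℕ} (h : i ≤ j) : varMultiples m i ≤ varMultiples m j :=
  Submodule.smul_mono_left (Ideal.span_mono (Set.image_mono fun _ hk => lt_of_lt_of_le hk h))

theorem X_smul_mem_varMultiples (j : Fin m) (z : PongAlgebra m (m - 1)) :
    (MvPolynomial.X j : BaseRing m) • z ∈ varMultiples m (j + 1) :=
  Submodule.smul_mem_smul (Ideal.subset_span ⟨j, Nat.lt_succ_self _, rfl⟩) trivial

theorem mem_varMultiples_succ (j : Fin m) {z : PongAlgebra m (m - 1)}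
    (hz : z ∈ varMultiples m (j + 1)) :
    ∃ y k, k ∈ varMultiples m j ∧ z = (MvPolynomial.X j : BaseRing m) • y + k := by
  have e : {i : Fin m | (i : ℕ) < j + 1} = insert j {i : Fin m | (i : ℕ) < j} := by
    ext i
    rw [Set.mem_insert_iff, Set.mem_ofPred_eq, Set.mem_ofPred_eq, Fin.ext_iff]
    omega
  rw [varMultiples, e, Set.image_insert_eq, Ideal.span_insert, Submodule.sup_smul,
    Submodule.mem_sup] at hz
  obtain ⟨a, ha, k, hk, rfl⟩ := hz
  rw [Submodule.ideal_span_singleton_smul, Submodule.mem_smul_pointwise_iff_exists] at ha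
  obtain ⟨y, -, rfl⟩ := ha
  exact ⟨y, k, hk, rfl⟩

/-- The variables form a regular sequence. In the monomial ideal of the earlier ones, membership is
checked on each monomial, and multiplication by another variable does not affect it. -/
theorem mem_varMultiples_of_X_smul (j : Fin m) {z : PongAlgebra m (m - 1)}
    (h : (MvPolynomial.X j : BaseRing m) • z ∈ varMultiples m j) : z ∈ varMultiples m j := by
  rw [mem_varMultiples_iff] at *
  intro f
  have h1 := h f
  rw [_root_.map_smul, Finsupp.smul_apply, smul_eq_mul] at h1
  rw [MvPolynomial.mem_ideal_span_X_image] at *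
  intro a ha
  obtain ⟨i, hi, h2⟩ := h1 (a + Finsupp.single j 1) (by
    rw [MvPolynomial.mem_support_iff, add_comm, MvPolynomial.coeff_X_mul] 
    exact MvPolynomial.mem_support_iff.1 ha)
  refine ⟨i, hi, ?_⟩
  rwa [Finsupp.add_apply, Finsupp.single_eq_of_ne, add_zero] at h2
  rintro rfl
  exact lt_irrefl (i : ℕ) hi

/-- The normal forms in the pong algebra. -/
noncomputable def normalForm (m : ℕ) [m.AtLeastTwo] (j : ℕ) (c : Finset ℕ → Polynomial (ZMod 2)) :
    PongAlgebra m (m - 1) :=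
  squarefreeSum (fun i => pure (simple m (i : ℕ))) (omega m) j c

theorem normalForm_succ (j : ℕ) (c : Finset ℕ → Polynomial (ZMod 2)) : normalForm m (j + 1) c =
    normalForm m j c + pure (simple m (j : ℕ)) * normalForm m j fun s => c (insert j s) := rfl

theorem d_aeval_omega (p : Polynomial (ZMod 2)) : d (p.aeval (omega m)) = 0 := by
  have h : ∀ a, a ∈ cycles (dZ m) d_mul ↔ d a = 0 := fun a => Iff.rfl
  rw [← h]
  exact Algebra.adjoin_le (S := cycles (dZ m) d_mul) (by simpa using (h _).2 d_omega)
    (Polynomial.aeval_mem_adjoin_singleton _ _)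

/-- Left multiplication by X_j is a null-homotopy of multiplication by v_j. -/
theorem d_simple_mul (j : Fin m) (a : PongAlgebra m (m - 1)) : d (pure (simple m (j : ℕ)) * a) =
    (MvPolynomial.X j : BaseRing m) • a + pure (simple m (j : ℕ)) * d a := by
  rw [d_mul, d_simple_fin, PongAlgebra.smul_mul, one_mul]

theorem d_normalForm_mem {j : ℕ} (hj : j ≤ m) (c : Finset ℕ → Polynomial (ZMod 2)) :
    d (normalForm m j c) ∈ varMultiples m j := by
  induction j generalizing c with
  | zero => rw [normalForm, squarefreeSum, d_aeval_omega]; exact Submodule.zero_mem _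
  | succ j ih =>
    have hle : varMultiples m j ≤ varMultiples m (j + 1) := varMultiples_mono (Nat.le_succ j)
    rw [normalForm_succ, map_add, d_simple_mul ⟨j, hj⟩]
    refine Submodule.add_mem _ (hle (ih (by omega) _)) (Submodule.add_mem _
      (X_smul_mem_varMultiples ⟨j, hj⟩ _) (hle (mul_mem_varMultiples (ih (by omega) _) _)))

/-- The normal forms span the homology modulo the first variables. -/
theorem exists_normalForm (hm : 3 ≤ m) {j : ℕ} (hj : j ≤ m) {z : PongAlgebra m (m - 1)}
    (hz : d z ∈ varMultiples m j) : ∃ c y, z - normalForm m j c - d y ∈ varMultiples m j := by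
  induction j generalizing z with
  | zero =>
    rw [varMultiples_zero, Submodule.mem_bot] at hz
    obtain ⟨p, y, rfl⟩ := exists_polynomial hm hz
    refine ⟨fun _ => p, y, ?_⟩
    rw [normalForm, squarefreeSum, add_sub_cancel_left, sub_self]
    exact Submodule.zero_mem _
  | succ j ih =>
    have hle : varMultiples m j ≤ varMultiples m (j + 1) := varMultiples_mono (Nat.le_succ j)
    obtain ⟨y, k, hk, e⟩ := mem_varMultiples_succ ⟨j, hj⟩ hz
    -- Since d² = 0, the product of v_j with `d y` is a combination of the earlier variables;
    -- regularity removes v_j. The induction hypothesis thus applies to y as well.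
    have h1 : d y ∈ varMultiples m j := by
      refine mem_varMultiples_of_X_smul ⟨j, hj⟩ ?_
      have := congrArg d e
      rw [d_d, map_add, LinearMap.map_smul, ← sub_eq_iff_eq_add, zero_sub] at this
      rw [← this]
      exact Submodule.neg_mem _ (d_mem_varMultiples hk)
    obtain ⟨c', y', h2⟩ := ih (by omega) h1
    -- The element X_j times the normal form of y has differential v_j y up to boundaries and
    -- earlier variables. Subtracting it turns z into a cycle modulo the earlier variables only.
    obtain ⟨z', hz'⟩ : ∃ z', z' = z - pure (simple m (j : ℕ)) * normalForm m j c' -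
      (MvPolynomial.X ⟨j, hj⟩ : BaseRing m) • y' := ⟨_, rfl⟩
    have h3 : d z' ∈ varMultiples m j := by
      rw [hz', map_sub, map_sub, e, d_simple_mul ⟨j, hj⟩, LinearMap.map_smul]
      have h4 := Submodule.add_mem _ (Submodule.sub_mem _ (Submodule.smul_mem _
        (MvPolynomial.X ⟨j, hj⟩ : BaseRing m) h2) (mul_mem_varMultiples (d_normalForm_mem
          (by omega : j ≤ m) c') (pure (simple m (j : ℕ))))) hk
      convert h4 using 1
      rw [smul_sub, smul_sub]
      abel
    obtain ⟨c, y'', h4⟩ := ih (by omega) h3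
    refine ⟨fun s => if j ∈ s then c' (s.erase j) else c s, y'', ?_⟩
    rw [normalForm, squarefreeSum_combine]
    have h5 := Submodule.add_mem _ (hle h4) (X_smul_mem_varMultiples ⟨j, hj⟩ y')
    convert h5 using 1
    rw [hz']
    change z - (normalForm m j c + pure (simple m (j : ℕ)) * normalForm m j c') - d y'' = _
    abel

/-- The normal forms are linearly independent in the homology modulo the first variables. -/
theorem normalForm_independent (hm : 3 ≤ m) {j : ℕ} (hj : j ≤ m)
    {c : Finset ℕ → Polynomial (ZMod 2)} {y : PongAlgebra m (m - 1)}
    (h : normalForm m j c - d y ∈ varMultiples m j) : ∀ s, s ⊆ Finset.range j → c s = 0 := by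
  induction j generalizing c y with
  | zero =>
    rw [varMultiples_zero, Submodule.mem_bot, sub_eq_zero] at h
    intro s hs
    rw [Finset.subset_empty.1 hs]
    exact polynomial_eq_zero hm h
  | succ j ih =>
    obtain ⟨y', k, hk, e⟩ := mem_varMultiples_succ ⟨j, hj⟩ h
    set c' : Finset ℕ → Polynomial (ZMod 2) := fun s => c (insert j s) with hc'
    have hα := d_normalForm_mem (m := m) (by omega : j ≤ m) c
    have hβ := d_normalForm_mem (m := m) (by omega : j ≤ m) c'
    -- Applying d to the relation isolates the coefficients of X_j: they appear multiplied by v_j,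
    -- which regularity removes.
    have h1 : normalForm m j c' - d y' ∈ varMultiples m j := by
      refine mem_varMultiples_of_X_smul ⟨j, hj⟩ ?_
      have h2 := congrArg d e
      rw [map_sub, d_d, sub_zero, normalForm_succ, map_add, map_add, d_simple_mul ⟨j, hj⟩,
        LinearMap.map_smul] at h2
      have h3 := Submodule.sub_mem _ (Submodule.sub_mem _ (d_mem_varMultiples hk) hα)
        (mul_mem_varMultiples hβ (pure (simple m (j : ℕ))))
      convert h3 using 1
      rw [smul_sub, sub_eq_iff_eq_add]
      have h4 := (sub_eq_iff_eq_add'.2 h2)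
      rw [← h4, ← hc']
      abel
    have h2 := ih (by omega) h1
    have h3 : normalForm m j c' = 0 := squarefreeSum_eq_zero _ _ _ h2
    rw [h3, zero_sub, ← Submodule.neg_mem_iff, neg_neg] at h1
    obtain ⟨c'', y'', h4⟩ := exists_normalForm hm (by omega : j ≤ m) h1
    -- Now y' is a cycle modulo the earlier variables. In its normal form every term times v_j
    -- bounds X_j times that term, so the remaining part of the relation is a boundary modulo the
    -- earlier variables alone.
    have h5 : normalForm m j c - d (y + (MvPolynomial.X ⟨j, hj⟩ : BaseRing m) • y'' +
        pure (simple m (j : ℕ)) * normalForm m j c'') ∈ varMultiples m j := by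
      have h6 := Submodule.sub_mem _ (Submodule.add_mem _ hk (Submodule.smul_mem _
        (MvPolynomial.X ⟨j, hj⟩ : BaseRing m) h4))
        (mul_mem_varMultiples (d_normalForm_mem (m := m) (by omega : j ≤ m) c'')
          (pure (simple m (j : ℕ))))
      convert h6 using 1
      rw [normalForm_succ, ← hc', h3, mul_zero, add_zero, sub_eq_iff_eq_add] at e
      rw [e, map_add, map_add, d_simple_mul ⟨j, hj⟩, LinearMap.map_smul, smul_sub, smul_sub]
      abel
    have h6 := ih (by omega) h5
    intro s hs
    rw [Finset.range_add_one] at hs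
    by_cases hjs : j ∈ s
    · rw [← Finset.insert_erase hjs]
      exact h2 _ (Finset.subset_insert_iff.1 hs)
    · exact h6 s ((Finset.subset_insert_iff_of_notMem hjs).1 hs)

end FullPerm

/-! ### Relations between the generators. -/

namespace FullPerm

open LiftedPartialPerm PongAlgebra

variable {m : ℕ} [m.AtLeastTwo]

/-- The composition is the identity, of length 0 instead of 2, so the product vanishes already
before the variables are divided out. -/
theorem pure_simple_mul_self (l : ℤ) : PongAlgebra.pure (simple m l) * PongAlgebra.pure (simple m l) = 0 := by
  rw [pure_mul_pure_eq, sw_mul_self, term, if_neg]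
  rw [cross_simple, cross_one]
  omega

theorem pure_simple_commute {i j : ℕ} (hi : i < m) (hj : j < m) (h : i + 2 ≤ j ∨ j + 2 ≤ i) :
    PongAlgebra.pure (simple m (i : ℕ)) * PongAlgebra.pure (simple m (j : ℕ)) =
      PongAlgebra.pure (simple m (j : ℕ)) * PongAlgebra.pure (simple m (i : ℕ)) := by
  rw [pure_mul_pure_eq, pure_mul_pure_eq, simple_commute hi hj h, add_comm, add_comm (cross _)]

/-- If b does not move one of the two numbers a and a + 1, the second reflection at a does not add
strands over its line. The product of the three generators then has weight to spare there. -/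
theorem across_braid_le {a b : ℕ} (ha : a < m) (hb : b < m) (hab : b ≠ a)
    (h : simple m b a = a ∨ simple m b (a + 1) = a + 1) :
    (simple m a * (simple m b * simple m a)).across a ≤ 2 := by
  have h1 : (simple m b * simple m a).across a = 2 := by
    rw [across_simple_mul_of_ne _ hb ha hab, across_simple]
  have h2 := across_simple_mul_le_or (simple m b * simple m a) a
  rw [sw_mul_inv_apply, sw_mul_inv_apply, sw_inv, h1] at h2
  rcases h with h | h <;> rw [h] at h2
  · rw [simple_left] at h2; omega
  · rw [simple_right] at h2; omega

/-- The triple product X_a X_b X_a equals v_a y for some y. In its differential the v_b term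
contains the square of X_a and drops out, leaving v_a times the commutator, and v_a can be
cancelled. -/
theorem exists_d_eq_commutator_of {a b : ℕ} (ha : a < m) (hb : b < m) (hab : b ≠ a)
    (h : simple m b a = a ∨ simple m b (a + 1) = a + 1) :
    ∃ y, d y = PongAlgebra.pure (simple m (a : ℕ)) * PongAlgebra.pure (simple m (b : ℕ)) +
      PongAlgebra.pure (simple m (b : ℕ)) * PongAlgebra.pure (simple m (a : ℕ)) := by
  obtain ⟨y, hy⟩ : ∃ y, PongAlgebra.pure (simple m (a : ℕ)) * (PongAlgebra.pure (simple m (b : ℕ)) *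
      PongAlgebra.pure (simple m (a : ℕ))) = (MvPolynomial.X ⟨a, ha⟩ : BaseRing m) • y := by
    have h0 := cross_comp_le (composable (simple m (b : ℕ)) (simple m (a : ℕ)))
    have h1 := twiceWeight_comp (composable (simple m (b : ℕ)) (simple m (a : ℕ)))
    rw [comp_eq_mul] at h0 h1
    rw [pure_mul_pure_eq, pure_mul_term (composable _ _) h0 h1, comp_eq_mul, term]
    split_ifs
    · have hX : (MvPolynomial.X ⟨a, ha⟩ : BaseRing m) ∣ weightMonomial
          ((simple m (a : ℕ)).twiceWeight +
            ((simple m (b : ℕ)).twiceWeight + (simple m (a : ℕ)).twiceWeight))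
          (simple m (a : ℕ) * (simple m (b : ℕ) * simple m (a : ℕ))).twiceWeight := by
        -- The two factors at a contribute a strand count of 4, and at most 2 remain in the product,
        -- so v_a has exponent at least one.
        refine dvd_trans ?_ (Finset.dvd_prod_of_mem _ (Finset.mem_univ (⟨a, ha⟩ : Fin m)))
        refine dvd_pow_self _ ?_
        rw [Pi.add_apply, Pi.add_apply, twiceWeight_apply, twiceWeight_apply, twiceWeight_apply,
          across_simple]
        have := across_braid_le ha hb hab h
        dsimp only
        omega
      obtain ⟨r, hr⟩ := hX
      exact ⟨r • PongAlgebra.pure _, by rw [hr, smul_smul]⟩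
    · exact ⟨0, (smul_zero _).symm⟩
  refine ⟨y, ?_⟩
  have h1 := congrArg d hy
  rw [d_simple_mul ⟨a, ha⟩, d_simple_mul ⟨b, hb⟩, d_simple_fin ⟨a, ha⟩, LinearMap.map_smul, mul_add,
    PongAlgebra.mul_smul, PongAlgebra.mul_smul, PongAlgebra.mul_smul, pure_simple_mul_self,
    smul_zero, zero_add, mul_one, ← smul_add] at h1
  have h2 : (MvPolynomial.X ⟨a, ha⟩ : BaseRing m) • (d y - (PongAlgebra.pure (simple m (a : ℕ)) *
      PongAlgebra.pure (simple m (b : ℕ)) + PongAlgebra.pure (simple m (b : ℕ)) * PongAlgebra.pure (simple m (a : ℕ)))) = 0 := by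
    rw [smul_sub, ← h1, add_comm (PongAlgebra.pure (simple m (a : ℕ)) * _), sub_self]
  exact sub_eq_zero.1 (((smul_eq_zero_iff _ _).1 h2).resolve_left (MvPolynomial.X_ne_zero _))

/-- The classes of any two of the generators commute. -/
theorem exists_d_eq_commutator (hm : 3 ≤ m) {i j : ℕ} (hi : i < m) (hj : j < m) :
    ∃ y, d y = PongAlgebra.pure (simple m (i : ℕ)) * PongAlgebra.pure (simple m (j : ℕ)) +
      PongAlgebra.pure (simple m (j : ℕ)) * PongAlgebra.pure (simple m (i : ℕ)) := by
  wlog hij : i ≤ j generalizing i j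
  · obtain ⟨y, hy⟩ := this hj hi (by omega)
    exact ⟨y, by rw [hy, add_comm]⟩
  rcases Nat.lt_or_ge (i + 1) j with h | h
  · exact ⟨0, by rw [map_zero, pure_simple_commute hi hj (by omega), add_self]⟩
  rcases Nat.lt_or_ge i j with h' | h'
  · obtain rfl : j = i + 1 := by omega
    -- The reflection at 1 also exchanges 0 and -1, so it moves both 0 and 1. For the pair of
    -- indices 0 and 1 the roles are therefore reversed: the reflection at 0 fixes 2.
    rcases Nat.eq_zero_or_pos i with rfl | h0
    · obtain ⟨y, hy⟩ := exists_d_eq_commutator_of (m := m) (a := 0 + 1) (b := 0) hj hi (by omega) (by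
        right
        refine simple_apply_of_not_dvd ?_ ?_ ?_ ?_ <;> intro hd <;> push_cast at hd
        · have := eq_zero_of_period_dvd hd (by omega) (by omega); omega
        · have := even_of_period_dvd hd
          rw [Int.even_iff] at this; omega
        · have := even_of_period_dvd hd
          rw [Int.even_iff] at this; omega
        · have := eq_zero_of_period_dvd hd (by omega) (by omega); omega)
      exact ⟨y, by rw [hy, add_comm]⟩
    · refine exists_d_eq_commutator_of hi hj (by omega) (Or.inl ?_)
      refine simple_apply_of_not_dvd ?_ ?_ ?_ ?_ <;> intro hd <;> push_cast at hd
      · have := eq_zero_of_period_dvd hd (by omega) (by omega); omega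
      · have := eq_zero_of_period_dvd hd (by omega) (by omega); omega
      · have := eq_zero_of_period_dvd hd (by omega) (by omega); omega
      · have := even_of_period_dvd hd
        rw [Int.even_iff] at this; omega
  · obtain rfl : i = j := by omega
    exact ⟨0, by rw [map_zero, pure_simple_mul_self, add_zero]⟩

/-- The ideal of the noncommutative algebra is identified with the multiples of all m variables in
the free module, where the elimination took place. -/
theorem mem_variableIdeal_iff {z : PongAlgebra m (m - 1)} :
    z ∈ variableIdeal m (m - 1) ↔ z ∈ varMultiples m m := by
  have hX : ∀ (l : Fin m) (z : PongAlgebra m (m - 1)),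
      (MvPolynomial.X l : BaseRing m) • z ∈ variableIdeal m (m - 1) := by
    intro l z
    rw [Algebra.smul_def, Algebra.commutes]
    exact Ideal.mul_mem_left _ _ (Ideal.subset_span ⟨l, rfl⟩)
  constructor
  · intro h
    induction h using Submodule.span_induction with
    | mem x hx =>
      obtain ⟨l, rfl⟩ := hx
      beta_reduce
      rw [Algebra.algebraMap_eq_smul_one]
      exact varMultiples_mono l.2 (X_smul_mem_varMultiples l 1)
    | zero => exact Submodule.zero_mem _
    | add x y _ _ hx hy => exact Submodule.add_mem _ hx hy
    | smul r x _ hx => exact mul_mem_varMultiples hx r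
  · intro h
    have key : ∀ j, j ≤ m → ∀ z ∈ varMultiples m j, z ∈ variableIdeal m (m - 1) := by
      intro j
      induction j with
      | zero =>
        intro _ z hz
        rw [varMultiples_zero, Submodule.mem_bot] at hz
        rw [hz]; exact Ideal.zero_mem _
      | succ j ih =>
        intro hj z hz
        obtain ⟨y, k, hk, rfl⟩ := mem_varMultiples_succ ⟨j, hj⟩ hz
        exact Ideal.add_mem _ (hX _ _) (ih (by omega) k hk)
    exact key m le_rfl z h

end FullPerm

/-! ### The presentation from the squarefree normal form. -/

section presentation

variable {A : Type*} [CommRing A] [Algebra (ZMod 2) A]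

/-- Multiplication by a generator of square zero kills the monomials that contain it and inserts it
in the others. -/
theorem mul_squarefreeSum_self {x : ℕ → A} (ω : A) {i j : ℕ} (hij : i < j) (hx : x i * x i = 0)
    (c : Finset ℕ → Polynomial (ZMod 2)) : x i * squarefreeSum x ω j c =
      squarefreeSum x ω j fun s => if i ∈ s then c (s.erase i) else 0 := by
  induction j generalizing c with
  | zero => omega
  | succ j ih =>
    rw [squarefreeSum, squarefreeSum, mul_add]
    rcases Nat.lt_succ_iff_lt_or_eq.1 hij with h | rfl
    · rw [ih h, mul_left_comm, ih h]
      congr 2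
      refine squarefreeSum_congr x ω j fun s _ => ?_
      have hne : i ≠ j := by omega
      have h : i ∈ insert j s ↔ i ∈ s := by rw [Finset.mem_insert, or_iff_right hne]
      by_cases hs : i ∈ s
      · rw [if_pos hs, if_pos (h.2 hs), Finset.erase_insert_of_ne hne.symm]
      · rw [if_neg hs, if_neg (mt h.1 hs)]
    · rw [← mul_assoc, hx, zero_mul, add_zero, squarefreeSum_eq_zero x ω i (c := fun s =>
        if i ∈ s then c (s.erase i) else 0), zero_add]
      · congr 1
        refine squarefreeSum_congr x ω i fun s hs => ?_
        have h : i ∉ s := fun h => absurd (Finset.mem_range.1 (hs h)) (lt_irrefl i)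
        rw [if_pos (Finset.mem_insert_self i s), Finset.erase_insert h]
      · intro s hs
        exact if_neg fun h => absurd (Finset.mem_range.1 (hs h)) (lt_irrefl i)

theorem mul_squarefreeSum (x : ℕ → A) (ω : A) (j : ℕ) (c : Finset ℕ → Polynomial (ZMod 2)) :
    ω * squarefreeSum x ω j c = squarefreeSum x ω j fun s => Polynomial.X * c s := by
  induction j generalizing c with
  | zero => rw [squarefreeSum, squarefreeSum, map_mul, Polynomial.aeval_X]
  | succ j ih => rw [squarefreeSum, squarefreeSum, mul_add, mul_left_comm, ih, ih]

/-- A finite family, extended by zero. -/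
def extendZero {A : Type*} [Zero A] {m : ℕ} (x : Fin m → A) (j : ℕ) : A :=
  if h : j < m then x ⟨j, h⟩ else 0

theorem extendZero_of_lt {A : Type*} [Zero A] {m : ℕ} (x : Fin m → A) {j : ℕ} (h : j < m) :
    extendZero x j = x ⟨j, h⟩ := dif_pos h

theorem squarefreeSum_one (x : ℕ → A) (ω : A) (j : ℕ) (p : Polynomial (ZMod 2)) :
    squarefreeSum x ω j (fun s => if s = ∅ then p else 0) = p.aeval ω := by
  induction j with
  | zero => rw [squarefreeSum, if_pos rfl]
  | succ j ih =>
    rw [squarefreeSum, ih, squarefreeSum_eq_zero x ω j, mul_zero, add_zero]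
    exact fun s _ => if_neg (Finset.insert_ne_empty j s)

theorem exists_eq_squarefreeSum {m : ℕ} (q : MvPolynomial (Option (Fin m)) (ZMod 2) ⧸ squaresIdeal m) :
    ∃ c, q = squarefreeSum (extendZero fun l : Fin m =>
      Ideal.Quotient.mk (squaresIdeal m) (MvPolynomial.X (some l)))
      (Ideal.Quotient.mk (squaresIdeal m) (MvPolynomial.X none)) m c := by
  obtain ⟨q, rfl⟩ := Ideal.Quotient.mk_surjective q
  induction q using MvPolynomial.induction_on with
  | C a =>
    refine ⟨fun s => if s = ∅ then Polynomial.C a else 0, ?_⟩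
    rw [squarefreeSum_one, Polynomial.aeval_C]
    rfl
  | add p q hp hq =>
    obtain ⟨c, hc⟩ := hp
    obtain ⟨c', hc'⟩ := hq
    exact ⟨fun s => c s + c' s, by rw [squarefreeSum_add, map_add, hc, hc']⟩
  | mul_X p i hp =>
    obtain ⟨c, hc⟩ := hp
    rw [map_mul, hc, mul_comm]
    cases i with
    | none => exact ⟨_, mul_squarefreeSum _ _ _ _⟩
    | some l =>
      refine ⟨fun s => if (l : ℕ) ∈ s then c (s.erase l) else 0, ?_⟩
      rw [← mul_squarefreeSum_self _ l.2, extendZero_of_lt _ l.2]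
      rw [extendZero_of_lt _ l.2, ← map_mul, ← pow_two, Ideal.Quotient.eq_zero_iff_mem]
      exact Ideal.subset_span ⟨l, rfl⟩

/-- Every element of the presented algebra is itself a squarefree sum, so evaluation matches normal
forms with normal forms: `hspan` gives surjectivity and `hind` injectivity. -/
theorem exists_algEquiv_of_comm {m : ℕ} (x : Fin m → A) (ω : A) (hx : ∀ l, x l * x l = 0)
    (hspan : ∀ a, ∃ c, a = squarefreeSum (extendZero x) ω m c)
    (hind : ∀ c, squarefreeSum (extendZero x) ω m c = 0 → ∀ s, s ⊆ Finset.range m → c s = 0) :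
    ∃ e : A ≃ₐ[ZMod 2] (MvPolynomial (Option (Fin m)) (ZMod 2) ⧸ squaresIdeal m),
      (∀ l, e (x l) = Ideal.Quotient.mk (squaresIdeal m) (MvPolynomial.X (some l))) ∧
      e ω = Ideal.Quotient.mk (squaresIdeal m) (MvPolynomial.X none) := by
  let φ : (MvPolynomial (Option (Fin m)) (ZMod 2) ⧸ squaresIdeal m) →ₐ[ZMod 2] A :=
    Ideal.Quotient.liftₐ _ (MvPolynomial.aeval fun i => i.elim ω x) fun a ha => by
      have : squaresIdeal m ≤ RingHom.ker (MvPolynomial.aeval (R := ZMod 2)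
          (fun i : Option (Fin m) => i.elim ω x)) := by
        refine Ideal.span_le.2 ?_
        rintro _ ⟨l, rfl⟩
        rw [SetLike.mem_coe, RingHom.mem_ker, map_pow, MvPolynomial.aeval_X, pow_two]
        exact hx l
      exact this ha
  have hφ1 : ∀ l, φ (Ideal.Quotient.mk (squaresIdeal m) (MvPolynomial.X (some l))) = x l := by
    intro l
    exact MvPolynomial.aeval_X _ _
  have hφ2 : φ (Ideal.Quotient.mk (squaresIdeal m) (MvPolynomial.X none)) = ω :=
    MvPolynomial.aeval_X _ _
  have hφ : ∀ c, φ (squarefreeSum (extendZero fun l : Fin m =>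
      Ideal.Quotient.mk (squaresIdeal m) (MvPolynomial.X (some l)))
      (Ideal.Quotient.mk (squaresIdeal m) (MvPolynomial.X none)) m c) =
      squarefreeSum (extendZero x) ω m c := by
    intro c
    refine map_squarefreeSum φ (fun i hi => ?_) hφ2 c
    rw [extendZero_of_lt _ hi, extendZero_of_lt _ hi, hφ1]
  have hbij : Function.Bijective φ := by
    refine ⟨(injective_iff_map_eq_zero φ).2 fun q hq => ?_, fun a => ?_⟩
    · obtain ⟨c, rfl⟩ := exists_eq_squarefreeSum q
      rw [hφ] at hq
      exact squarefreeSum_eq_zero _ _ _ (hind c hq)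
    · obtain ⟨c, rfl⟩ := hspan a
      exact ⟨_, hφ c⟩
  refine ⟨(AlgEquiv.ofBijective φ hbij).symm, fun l => ?_, ?_⟩
  · rw [AlgEquiv.symm_apply_eq]; exact (hφ1 l).symm
  · rw [AlgEquiv.symm_apply_eq]; exact hφ2.symm

/-- Commutativity is not assumed: the generators commute with each other and generate, so every
centralizer of a generator, and then the center, is everything. -/
theorem exists_algEquiv {H : Type*} [Ring H] [Algebra (ZMod 2) H] {m : ℕ} (x : Fin m → H) (ω : H)
    (hx : ∀ l, x l * x l = 0) (hxx : ∀ l l', x l * x l' = x l' * x l) (hxω : ∀ l, x l * ω = ω * x l)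
    (hspan : ∀ a, ∃ c, a = squarefreeSum (extendZero x) ω m c)
    (hind : ∀ c, squarefreeSum (extendZero x) ω m c = 0 → ∀ s, s ⊆ Finset.range m → c s = 0) :
    ∃ e : H ≃ₐ[ZMod 2] (MvPolynomial (Option (Fin m)) (ZMod 2) ⧸ squaresIdeal m),
      (∀ l, e (x l) = Ideal.Quotient.mk (squaresIdeal m) (MvPolynomial.X (some l))) ∧
      e ω = Ideal.Quotient.mk (squaresIdeal m) (MvPolynomial.X none) := by
  have hS : ∀ S : Subalgebra (ZMod 2) H, (∀ l, x l ∈ S) → ω ∈ S → ∀ a, a ∈ S := by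
    intro S h1 h2 a
    obtain ⟨c, rfl⟩ := hspan a
    refine squarefreeSum_mem S (fun i hi => ?_) h2 c
    rw [extendZero_of_lt _ hi]; exact h1 _
  have hcx : ∀ l a, x l * a = a * x l := fun l a => by
    have := hS (Subalgebra.centralizer (ZMod 2) {x l})
      (fun l' => (Subalgebra.mem_centralizer_iff _).2 fun g hg => by
        rw [Set.mem_singleton_iff.1 hg, hxx])
      ((Subalgebra.mem_centralizer_iff _).2 fun g hg => by
        rw [Set.mem_singleton_iff.1 hg, hxω]) a
    exact (Subalgebra.mem_centralizer_iff _).1 this _ rfl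
  have hcω : ∀ a, ω * a = a * ω := fun a => by
    have := hS (Subalgebra.centralizer (ZMod 2) {ω})
      (fun l' => (Subalgebra.mem_centralizer_iff _).2 fun g hg => by
        rw [Set.mem_singleton_iff.1 hg, hxω])
      ((Subalgebra.mem_centralizer_iff _).2 fun g hg => by
        rw [Set.mem_singleton_iff.1 hg]) a
    exact (Subalgebra.mem_centralizer_iff _).1 this _ rfl
  have hcomm : ∀ a b : H, a * b = b * a := by
    intro a b
    have := hS (Subalgebra.center (ZMod 2) H)
      (fun l => Subalgebra.mem_center_iff.2 fun b => (hcx l b).symm)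
      (Subalgebra.mem_center_iff.2 fun b => (hcω b).symm) b
    exact Subalgebra.mem_center_iff.1 this a
  let _ : CommRing H := { (inferInstance : Ring H) with mul_comm := hcomm }
  exact exists_algEquiv_of_comm x ω hx hspan hind

end presentation

/-! ### From cycles to homology classes. -/

section homologyClass

variable {A : Type} [Ring A] [Algebra (ZMod 2) A] {d : A →ₗ[ZMod 2] A}
  {hd : ∀ a b, d (a * b) = d a * b + a * d b}

/-- The quotient map from the cycles to the homology. -/
noncomputable def homologyMap (d : A →ₗ[ZMod 2] A) (hd : ∀ a b, d (a * b) = d a * b + a * d b) :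
    cycles d hd →ₐ[ZMod 2] Homology d hd :=
  Ideal.Quotient.mkₐ (ZMod 2) (boundaries d hd)

theorem homologyMap_surjective : Function.Surjective (homologyMap d hd) :=
  Ideal.Quotient.mk_surjective

theorem homologyMap_eq_zero_iff {a : cycles d hd} : homologyMap d hd a = 0 ↔ ∃ y, d y = a :=
  Ideal.Quotient.eq_zero_iff_mem

/-- The homology of a differential algebra is identified by cycles which commute and square to
zero up to boundaries, and whose squarefree sums represent every class exactly once. -/
theorem exists_homology_algEquiv {m : ℕ} (x : Fin m → A) (ω : A) (hx : ∀ l, d (x l) = 0)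
    (hω : d ω = 0) (hxx : ∀ l, x l * x l = 0)
    (hcomm : ∀ l l', ∃ y, d y = x l * x l' - x l' * x l) (hxω : ∀ l, x l * ω = ω * x l)
    (hspan : ∀ z, d z = 0 → ∃ c y, d y = z - squarefreeSum (extendZero x) ω m c)
    (hind : ∀ c y, d y = squarefreeSum (extendZero x) ω m c → ∀ s, s ⊆ Finset.range m → c s = 0) :
    ∃ e : Homology d hd ≃ₐ[ZMod 2] (MvPolynomial (Option (Fin m)) (ZMod 2) ⧸ squaresIdeal m),
      (∀ l, e (homologyClass d hd (x l) (hx l)) =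
        Ideal.Quotient.mk (squaresIdeal m) (MvPolynomial.X (some l))) ∧
      e (homologyClass d hd ω hω) = Ideal.Quotient.mk (squaresIdeal m) (MvPolynomial.X none) := by
  let x' : Fin m → cycles d hd := fun l => ⟨x l, hx l⟩
  let ω' : cycles d hd := ⟨ω, hω⟩
  have hH : ∀ c, homologyMap d hd (squarefreeSum (extendZero x') ω' m c) =
      squarefreeSum (extendZero fun l => homologyMap d hd (x' l)) (homologyMap d hd ω') m c :=
    map_squarefreeSum _ (fun i hi => by rw [extendZero_of_lt _ hi, extendZero_of_lt _ hi]) rfl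
  have hQ : ∀ c, (cycles d hd).val (squarefreeSum (extendZero x') ω' m c) =
      squarefreeSum (extendZero x) ω m c :=
    map_squarefreeSum _ (fun i hi => by rw [extendZero_of_lt _ hi, extendZero_of_lt _ hi]; rfl) rfl
  have hker : ∀ a b : cycles d hd, (∃ y, d y = (a : A) - b) →
      homologyMap d hd a = homologyMap d hd b := by
    intro a b h
    rw [← sub_eq_zero, ← map_sub]
    exact homologyMap_eq_zero_iff.2 h
  refine exists_algEquiv (fun l => homologyMap d hd (x' l)) (homologyMap d hd ω') ?_ ?_ ?_ ?_ ?_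
  · intro l
    rw [← map_mul, homologyMap_eq_zero_iff]
    exact ⟨0, (map_zero d).trans (hxx l).symm⟩
  · intro l l'
    rw [← map_mul, ← map_mul]
    exact hker _ _ (hcomm l l')
  · intro l
    rw [← map_mul, ← map_mul]
    exact congrArg _ (Subtype.ext (hxω l))
  · intro a
    obtain ⟨⟨q, hq⟩, rfl⟩ := homologyMap_surjective a
    obtain ⟨c, y, h⟩ := hspan q hq
    refine ⟨c, ?_⟩
    rw [← hH]
    exact hker _ _ ⟨y, h.trans (congrArg (q - ·) (hQ c).symm)⟩
  · intro c hc
    rw [← hH, homologyMap_eq_zero_iff] at hc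
    obtain ⟨y, hy⟩ := hc
    exact hind c y (hy.trans (hQ c))

end homologyClass

/-! ### The generators in Q(m, m-1). -/

section generators

open FullPerm

variable {m : ℕ} [m.AtLeastTwo]

theorem xGen_eq (l : Fin m) : xGen m l = toQuot m (m - 1) (PongAlgebra.pure (simple m (l : ℕ))) :=
  congrArg (fun f => toQuot m (m - 1) (PongAlgebra.pure f)) (exchange_eq_sw _ _ _)

theorem omegaGen_eq : omegaGen m = toQuot m (m - 1) (omega m) := by
  rw [omegaGen, omega_eq_commutators]

theorem toQuot_eq_zero_iff {z : PongAlgebra m (m - 1)} :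
    toQuot m (m - 1) z = 0 ↔ z ∈ varMultiples m m := by
  rw [← mem_variableIdeal_iff]; exact Ideal.Quotient.eq_zero_iff_mem

theorem toQuot_eq_iff {z w : PongAlgebra m (m - 1)} :
    toQuot m (m - 1) z = toQuot m (m - 1) w ↔ z - w ∈ varMultiples m m := by
  rw [← toQuot_eq_zero_iff, map_sub, sub_eq_zero]

theorem quotD_xGen (l : Fin m) : quotD m (m - 1) (xGen m l) = 0 := by
  rw [xGen_eq, quotD_toQuot, toQuot_eq_zero_iff, d_simple_fin]
  exact varMultiples_mono l.2 (X_smul_mem_varMultiples l 1)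

theorem quotD_omegaGen : quotD m (m - 1) (omegaGen m) = 0 := by
  rw [omegaGen_eq, quotD_toQuot, d_omega, map_zero]

theorem squarefreeSum_xGen (c : Finset ℕ → Polynomial (ZMod 2)) :
    squarefreeSum (extendZero (xGen m)) (omegaGen m) m c = toQuot m (m - 1) (normalForm m m c) :=
  (map_squarefreeSum (Ideal.Quotient.mkₐ (ZMod 2) (variableIdeal m (m - 1)))
    (fun i hi => by rw [extendZero_of_lt _ hi, xGen_eq]; rfl) omegaGen_eq.symm c).symm

theorem xGen_mul_self (l : Fin m) : xGen m l * xGen m l = 0 := by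
  rw [xGen_eq, ← map_mul, pure_simple_mul_self, map_zero]

theorem xGen_mul_omegaGen (l : Fin m) : xGen m l * omegaGen m = omegaGen m * xGen m l := by
  rw [xGen_eq, omegaGen_eq, ← map_mul, ← map_mul, omega_mul]

theorem exists_quotD_eq_commutator (hm : 3 ≤ m) (l l' : Fin m) :
    ∃ y, quotD m (m - 1) y = xGen m l * xGen m l' - xGen m l' * xGen m l := by
  obtain ⟨y, hy⟩ := exists_d_eq_commutator hm l.2 l'.2
  refine ⟨toQuot m (m - 1) y, ?_⟩
  rw [quotD_toQuot, hy, xGen_eq, xGen_eq, ← map_mul, ← map_mul, ← map_sub]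
  congr 1
  rw [eq_sub_iff_add_eq, add_assoc, PongAlgebra.add_self, add_zero]

theorem exists_quotD_eq_sub_squarefreeSum (hm : 3 ≤ m) (q : QuotAlgebra m (m - 1))
    (hq : quotD m (m - 1) q = 0) : ∃ c y, quotD m (m - 1) y =
      q - squarefreeSum (extendZero (xGen m)) (omegaGen m) m c := by
  obtain ⟨z, rfl⟩ : ∃ z, toQuot m (m - 1) z = q := Ideal.Quotient.mk_surjective q
  rw [quotD_toQuot, toQuot_eq_zero_iff] at hq
  obtain ⟨c, y, h⟩ := exists_normalForm hm le_rfl hq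
  refine ⟨c, toQuot m (m - 1) y, ?_⟩
  rw [quotD_toQuot, squarefreeSum_xGen, ← map_sub]
  exact (toQuot_eq_iff.2 h).symm

theorem eq_zero_of_quotD_eq_squarefreeSum (hm : 3 ≤ m) (c : Finset ℕ → Polynomial (ZMod 2))
    (q : QuotAlgebra m (m - 1))
    (h : quotD m (m - 1) q = squarefreeSum (extendZero (xGen m)) (omegaGen m) m c) :
    ∀ s, s ⊆ Finset.range m → c s = 0 := by
  obtain ⟨y, rfl⟩ : ∃ z, toQuot m (m - 1) z = q := Ideal.Quotient.mk_surjective q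
  rw [quotD_toQuot, squarefreeSum_xGen] at h
  exact normalForm_independent hm le_rfl (toQuot_eq_iff.1 h.symm)

end generators

end Pong

theorem mainTheorem11 (m : ℕ) [m.AtLeastTwo] (hm : 3 ≤ m) :
    ∃ (hX : ∀ l : Fin m, Pong.quotD m (m - 1) (Pong.xGen m l) = 0)
      (hΩ : Pong.quotD m (m - 1) (Pong.omegaGen m) = 0)
      (e : Pong.QuotHomology m (m - 1) ≃ₐ[ZMod 2]
        (MvPolynomial (Option (Fin m)) (ZMod 2) ⧸ Pong.squaresIdeal m)),
      (∀ l : Fin m, e (Pong.homologyClass _ (Pong.quotD_mul m (m - 1)) (Pong.xGen m l) (hX l)) =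
        Ideal.Quotient.mk (Pong.squaresIdeal m) (MvPolynomial.X (some l))) ∧
      e (Pong.homologyClass _ (Pong.quotD_mul m (m - 1)) (Pong.omegaGen m) hΩ) =
        Ideal.Quotient.mk (Pong.squaresIdeal m) (MvPolynomial.X none) :=
  ⟨Pong.quotD_xGen, Pong.quotD_omegaGen,
    Pong.exists_homology_algEquiv (Pong.xGen m) (Pong.omegaGen m) Pong.quotD_xGen
      Pong.quotD_omegaGen Pong.xGen_mul_self (Pong.exists_quotD_eq_commutator hm)
      Pong.xGen_mul_omegaGen (Pong.exists_quotD_eq_sub_squarefreeSum hm)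
      (Pong.eq_zero_of_quotD_eq_squarefreeSum hm)⟩
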